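/- Let $T>0$, $M\in\mathbb N$, $\beta>0$, $p\in[1,\infty]$, and let $\mathcal V\subset\mathbb Z^M$ be a finite set with at least two elements. Equip $L^1(0,T)^M$ with the norm $\|u\|_{L^1}=\int_0^T\|u(t)\|_1\,dt$. For $u\in L^1(0,T)^M$ let $$TV_p(u)=\sup\Big\{\int_0^T u^\top\varphi'\,dt : \varphi\in C_c^1(0,T)^M,\ \|\varphi(t)\|_{p'}\le 1\ \ \forall t\in(0,T)\Big\},\qquad \tfrac1p+\tfrac1{p'}=1,$$ and let $U_{ad}$ be the set of all $u\in BV(0,T)^M$ (i.e. $u\in L^1(0,T)^M$ with $TV_2(u)<\infty$) such that $u(t)\in\mathcal V$ for almost all $t\in(0,T)$. Consider the problem $$\text{(P)}\qquad \min\ F(u)+\beta\,TV_p(u)\quad\text{subject to } u\in U_{ad}.$$ Let $F\colon L^1(0,T)^M\to\mathbb R$ be twice Fréchet differentiable and let $u\in U_{ad}$. Suppose that $F'(u)$ and $F''(u)$ are represented by $\nabla F(u)\in C^1([0,T])^M$ and $\nabla^2F(u)\in C([0,T]^2;\mathbb R^{M\times M})$, i.e. $F'(u)v=\int_0^T\nabla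 F(u)(t)^\top v(t)\,dt$ and $F''(u)[v,w]=\int_0^T\!\int_0^T v(r)^\top\nabla^2F(u)(r,s)\,w(s)\,dr\,ds$ for all $v,w\in L^1(0,T)^M$. Then $u$ has a minimal representation $(n,a,t)$: there are $n\ge1$, $0=t_0<t_1<\dots<t_{n-1}<t_n=T$ and $a_1,\dots,a_n\in\mathcal V$ with $a_i\neq a_{i+1}$ for $1\le i\le n-1$ such that $u=a_j$ a.e. on $(t_{j-1},t_j)$ for $j=1,\dots,n$. For every minimal representation, put $\mu_j=a_j-a_{j+1}$ for $j=1,\dots,n-1$ and let $J$ be the set of all $j\in\{1,\dots,n-1\}$ such that $\lambda a_j+(1-\lambda)a_{j+1}\in\mathcal V$ for some $\lambda\in(0,1)$. Then the following hold. 1. If $u$ is a local minimizer of (P) in $L^1(0,T)^M$, then - $\mu_j^\top\nabla F(u)(t_j)=0$ for all $j=1,\dots,n-1$, - $\mu_j^\top(\nabla F(u))'(t_j)\ge0$ for all $j\in J$, - $\sum_{j=1}^{n-1}\mu_j^\top(\nabla F(u))'(t_j)\,\tau_j^2+\sum_{j,k=1}^{n-1}\mu_j^\top\nabla^2F(u)(t_j,t_k)\mu_k\,\tau_j\tau_k\ge0$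 for all $\tau\in\mathbb R^{n-1}$. 2. If $p\in(1,\infty)$, then $u$ is a local minimizer of (P) satisfying a quadratic growth condition in $L^1(0,T)^M$, i.e. there are $\varepsilon,\eta>0$ with $$F(w)+\beta\,TV_p(w)\ \ge\ F(u)+\beta\,TV_p(u)+\tfrac\eta2\|w-u\|_{L^1}^2\qquad\forall w\in U_{ad},\ \|w-u\|_{L^1}\le\varepsilon,$$ if and only if - $\mu_j^\top\nabla F(u)(t_j)=0$ for all $j=1,\dots,n-1$, - $\mu_j^\top(\nabla F(u))'(t_j)>0$ for all $j\in J$, - $\sum_{j=1}^{n-1}\mu_j^\top(\nabla F(u))'(t_j)\,\tau_j^2+\sum_{j,k=1}^{n-1}\mu_j^\top\nabla^2F(u)(t_j,t_k)\mu_k\,\tau_j\tau_k>0$ for all $\tau\in\mathbb R^{n-1}\setminus\{0\}$. -/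

import Mathlib

open Set MeasureTheory
open scoped ENNReal Matrix

namespace SwitchingControl

/-- The space `L¹(0,T)^M`, normed by `‖u‖ = ∫₀ᵀ ‖u(t)‖₁ dt`. -/
abbrev ControlSpace (M : ℕ) (T : ℝ) : Type :=
  Lp (PiLp 1 (fun _ : Fin M => ℝ)) 1 ((volume : Measure ℝ).restrict (Ioo 0 T))

/-- The `p`-norm of a vector of `ℝ^M`, for `p ∈ [1,∞]`. -/
noncomputable def pNorm {M : ℕ} (p : ℝ≥0∞) (x : Fin M → ℝ) : ℝ :=
  ‖(WithLp.toLp p x : PiLp p (fun _ : Fin M => ℝ))‖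

/-- `φ ∈ C_c¹(0,T)^M` with `‖φ(t)‖_{p'} ≤ 1` for all `t`, where `1/p + 1/p' = 1`. -/
structure IsTestFunction {M : ℕ} (T : ℝ) (p : ℝ≥0∞) (φ : ℝ → Fin M → ℝ) : Prop where
  contDiff : ContDiff ℝ 1 φ
  hasCompactSupport : HasCompactSupport φ
  tsupport_subset : tsupport φ ⊆ Ioo 0 T
  pNorm_le : ∀ t ∈ Ioo (0 : ℝ) T, pNorm p.conjExponent (φ t) ≤ 1

/-- The total variation `TV_p(u) ∈ [0,∞]`. Clipping negative values of the integral does not change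
the supremum, as `φ = 0` is a test function. -/
noncomputable def TV {M : ℕ} {T : ℝ} (p : ℝ≥0∞) (u : ControlSpace M T) : ℝ≥0∞ :=
  ⨆ (φ : ℝ → Fin M → ℝ) (_ : IsTestFunction T p φ),
    ENNReal.ofReal (∫ t in Ioo 0 T, (u t).ofLp ⬝ᵥ deriv φ t)

/-- The embedding `ℤ^M → ℝ^M`. -/
def toReal {M : ℕ} (ν : Fin M → ℤ) : Fin M → ℝ := fun i => (ν i : ℝ)

/-- The admissible controls: `u ∈ BV(0,T)^M` with `u(t) ∈ V` for almost all `t ∈ (0,T)`. -/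
def admissible {M : ℕ} (T : ℝ) (V : Finset (Fin M → ℤ)) : Set (ControlSpace M T) :=
  {u | TV 2 u < ∞ ∧
    ∀ᵐ t ∂((volume : Measure ℝ).restrict (Ioo 0 T)), ∃ ν ∈ V, (u t).ofLp = toReal ν}

/-- The objective `F(u) + β TV_p(u)`, with values in `(-∞,∞]`. -/
noncomputable def objective {M : ℕ} {T : ℝ} (F : ControlSpace M T → ℝ) (β : ℝ) (p : ℝ≥0∞)
    (u : ControlSpace M T) : EReal :=
  (F u : EReal) + (β : EReal) * (TV p u : EReal)

/-- `u` is admissible and locally minimal for the objective among the admissible controls,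
with respect to the `L¹` norm. -/
def IsLocalMinimizer {M : ℕ} {T : ℝ} (V : Finset (Fin M → ℤ)) (F : ControlSpace M T → ℝ) (β : ℝ)
    (p : ℝ≥0∞) (u : ControlSpace M T) : Prop :=
  u ∈ admissible T V ∧ IsLocalMinOn (objective F β p) (admissible T V) u

/-- The local quadratic growth condition at `u` in `L¹`. -/
def HasQuadraticGrowth {M : ℕ} {T : ℝ} (V : Finset (Fin M → ℤ)) (F : ControlSpace M T → ℝ) (β : ℝ)
    (p : ℝ≥0∞) (u : ControlSpace M T) : Prop :=
  ∃ ε > (0 : ℝ), ∃ η > (0 : ℝ), ∀ w ∈ admissible T V, ‖w - u‖ ≤ ε →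
    objective F β p u + ((η / 2 * ‖w - u‖ ^ 2 : ℝ) : EReal) ≤ objective F β p w

/-- The grid `0, t_1, …, t_m, T`. -/
def grid {m : ℕ} (T : ℝ) (t : Fin m → ℝ) : Fin (m + 2) → ℝ :=
  Fin.cons (α := fun _ => ℝ) 0 (Fin.snoc (α := fun _ => ℝ) t T)

/-- The step function with the value `a j` between the `j`-th and the next point of the grid
(on the interval `(0,T)`, which is where controls live). -/
noncomputable def stepFunction {M m : ℕ} (T : ℝ) (t : Fin m → ℝ) (a : Fin (m + 1) → Fin M → ℤ) :
    ℝ → Fin M → ℝ :=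
  fun s => ∑ j : Fin (m + 1),
    (Ico (grid T t j.castSucc) (grid T t j.succ)).indicator (fun _ => toReal (a j)) s

/-- `(n, a, t)` with `n = m + 1` pieces and `m` switching times is the minimal representation
of `u`. -/
structure IsMinimalRepresentation {M : ℕ} {T : ℝ} (V : Finset (Fin M → ℤ)) (u : ControlSpace M T)
    {m : ℕ} (a : Fin (m + 1) → Fin M → ℤ) (t : Fin m → ℝ) : Prop where
  strictMono : StrictMono (grid T t)
  mem : ∀ j, a j ∈ V
  ne : ∀ j : Fin m, a j.castSucc ≠ a j.succ
  ae_eq : ∀ᵐ s ∂((volume : Measure ℝ).restrict (Ioo 0 T)), (u s).ofLp = stepFunction T t a s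

/-- The jump `μ_j = a_j - a_{j+1}`. -/
def jump {M m : ℕ} (a : Fin (m + 1) → Fin M → ℤ) (j : Fin m) : Fin M → ℝ :=
  toReal (a j.castSucc) - toReal (a j.succ)

/-- The set `J` of those `j` for which some `λ a_j + (1 - λ) a_{j+1}` with `λ ∈ (0,1)` lies in
`V`. -/
def intermediate {M m : ℕ} (V : Finset (Fin M → ℤ)) (a : Fin (m + 1) → Fin M → ℤ) :
    Set (Fin m) :=
  {j | ∃ l ∈ Ioo (0 : ℝ) 1, ∃ ν ∈ V,
    l • toReal (a j.castSucc) + (1 - l) • toReal (a j.succ) = toReal ν}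

/-- `g` represents the gradient `∇F(u)`. -/
def IsGradient {M : ℕ} {T : ℝ} (F : ControlSpace M T → ℝ) (u : ControlSpace M T)
    (g : ℝ → Fin M → ℝ) : Prop :=
  ∀ v : ControlSpace M T, fderiv ℝ F u v = ∫ t in Ioo 0 T, g t ⬝ᵥ (v t).ofLp

/-- `H` represents the second derivative `∇²F(u)` as an integral kernel. -/
def IsHessian {M : ℕ} {T : ℝ} (F : ControlSpace M T → ℝ) (u : ControlSpace M T)
    (H : ℝ → ℝ → Matrix (Fin M) (Fin M) ℝ) : Prop :=
  ∀ v w : ControlSpace M T, fderiv ℝ (fderiv ℝ F) u v w =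
    ∫ s in Ioo 0 T, ∫ r in Ioo 0 T, (v r).ofLp ⬝ᵥ (H r s *ᵥ (w s).ofLp)

/-- The quadratic form
`∑ⱼ μⱼᵀ (∇F(u))'(tⱼ) τⱼ² + ∑ⱼₖ μⱼᵀ ∇²F(u)(tⱼ,tₖ) μₖ τⱼ τₖ`. -/
noncomputable def quadForm {M m : ℕ} (T : ℝ) (g : ℝ → Fin M → ℝ)
    (H : ℝ → ℝ → Matrix (Fin M) (Fin M) ℝ) (a : Fin (m + 1) → Fin M → ℤ) (t : Fin m → ℝ)
    (τ : Fin m → ℝ) : ℝ :=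
  ∑ j, jump a j ⬝ᵥ derivWithin g (Icc 0 T) (t j) * τ j ^ 2 +
    ∑ j, ∑ k, jump a j ⬝ᵥ (H (t j) (t k) *ᵥ jump a k) * τ j * τ k

end SwitchingControl

namespace SwitchingControl

open Filter Topology

/-! Values of an admissible control are integer vectors, so every change of value costs at least one
unit of variation and finite variation allows only finitely many switches. This gives the minimal
representation, and duality gives `TV p u = ∑ j, pNorm p (jump a j)`.

Everything else is about perturbations `w = u + ∑ j, θ j • jump a j`, where `θ j` lives near `t j`,
is nonpositive to the left and nonnegative to the right of it, and has modulus at most one. Let τ_j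
= ∫ θ_j, n_j = ∫ |θ_j| and X_j = ∫ θ_j (s - t_j), and let c_j and h_jk be the coefficients of the
quadratic form. If the gradient vanishes against each jump at its switching time, then F(w) - F(u) =
∑ c_j X_j + (1/2) ∑ h_jk τ_j τ_k up to a small multiple of ∑ X_j + (∑ n_j)² (`expansion`).

Necessity: two kinds of competitor do not increase the variation
(`IsMinimalRepresentation.competitor`). Shifting the switching times along a direction gives X_j =
τ_j²/2, and thus half the quadratic form. If j ∈ J, an intermediate value can be inserted around `t
j` so that τ_j = 0 and X_j > 0; only c_j X_j survives, which gives the sign of c_j. Both arguments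
allow a growth constant η ≥ 0, so η = 0 yields part 1 and η > 0 the necessary half of part 2.

Sufficiency, for 1 < p < ∞: since V is finite, a nearby admissible w either exceeds the variation of
u by a fixed γ > 0, which beats the continuous F, or has exactly the minimal variation across each
jump. In the latter case equality in the triangle inequality and strict convexity put the values of
w on the segments between consecutive values of u, so w is a perturbation as above; for j ∉ J only
the endpoints are available and `θ j` is a pure shift (`IsMinimalRepresentation.exists_gap`). A
rearrangement bound, X_j ≥ (τ_j² + n_j²)/4 (`IsShiftProfile.moment_ge`), then splits the expansion
into half the quadratic form in τ plus the nonnegative terms c_j (n_j² - τ_j²)/4 for j ∈ J. Together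
these control all n_j², hence the squared L¹ distance. -/

/-! ### Norms on ℝ^M: Hölder duality and strict convexity -/

theorem pNorm_one {M : ℕ} (x : Fin M → ℝ) : pNorm 1 x = ∑ i, |x i| := by
  simp [pNorm, PiLp.norm_eq_of_L1]

theorem pNorm_top {M : ℕ} (x : Fin M → ℝ) : pNorm ∞ x = ⨆ i, |x i| := by
  simp [pNorm, PiLp.norm_eq_ciSup]

theorem pNorm_of_toReal_pos {M : ℕ} {p : ℝ≥0∞} (hp : 0 < p.toReal) (x : Fin M → ℝ) :
    pNorm p x = (∑ i, |x i| ^ p.toReal) ^ (1 / p.toReal) := by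
  simp [pNorm, PiLp.norm_eq_sum hp]

theorem pNorm_nonneg {M : ℕ} {p : ℝ≥0∞} (hp : 1 ≤ p) (x : Fin M → ℝ) : 0 ≤ pNorm p x := by
  have : Fact (1 ≤ p) := ⟨hp⟩
  exact norm_nonneg (WithLp.toLp p x : PiLp p (fun _ : Fin M => ℝ))

theorem abs_le_pNorm_top {M : ℕ} (x : Fin M → ℝ) (i : Fin M) : |x i| ≤ pNorm ∞ x := by
  rw [pNorm_top]
  exact le_ciSup (f := fun i => |x i|) (Set.finite_range _).bddAbove i

theorem dotProduct_le_pNorm_one_mul_top {M : ℕ} (x y : Fin M → ℝ) :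
    x ⬝ᵥ y ≤ pNorm 1 x * pNorm ∞ y := by
  rw [pNorm_one, Finset.sum_mul]
  refine Finset.sum_le_sum fun i _ => (le_abs_self _).trans ?_
  rw [abs_mul]
  exact mul_le_mul_of_nonneg_left (abs_le_pNorm_top y i) (abs_nonneg _)

theorem conjExponent_one : (1 : ℝ≥0∞).conjExponent = ∞ := by simp [ENNReal.conjExponent]

theorem conjExponent_top : (∞ : ℝ≥0∞).conjExponent = 1 := by simp [ENNReal.conjExponent]

theorem holderConjugate_toReal {p : ℝ≥0∞} (hp : 1 < p) (hp' : p < ∞) :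
    p.toReal.HolderConjugate p.conjExponent.toReal := by
  lift p to NNReal using hp'.ne
  have h1 : 1 < p := by exact_mod_cast hp
  rw [← ENNReal.coe_conjExponent h1]
  simpa using NNReal.holderConjugate_coe_iff.2 (NNReal.HolderConjugate.conjExponent h1)

theorem dotProduct_le_pNorm_mul {M : ℕ} {p : ℝ≥0∞} (hp : 1 ≤ p) (x y : Fin M → ℝ) :
    x ⬝ᵥ y ≤ pNorm p x * pNorm p.conjExponent y := by
  rcases hp.eq_or_lt with rfl | h1
  · rw [conjExponent_one]
    exact dotProduct_le_pNorm_one_mul_top x y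
  rcases eq_or_ne p ∞ with rfl | h2
  · rw [conjExponent_top, dotProduct_comm, mul_comm]
    exact dotProduct_le_pNorm_one_mul_top y x
  have h := holderConjugate_toReal h1 h2.lt_top
  rw [pNorm_of_toReal_pos h.pos, pNorm_of_toReal_pos h.symm.pos]
  exact Real.inner_le_Lp_mul_Lq _ _ _ h

/-- Every vector has a dual vector: the norm is attained in Hölder's inequality. -/
theorem exists_dual_vector {M : ℕ} {p : ℝ≥0∞} (hp : 1 ≤ p) (x : Fin M → ℝ) :
    ∃ y : Fin M → ℝ, pNorm p.conjExponent y ≤ 1 ∧ x ⬝ᵥ y = pNorm p x := by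
  have hsgn : ∀ r : ℝ, r * SignType.sign r = |r| := fun r => by
    rcases lt_trichotomy r 0 with h | h | h <;> simp [h, abs_of_neg, abs_of_pos]
  have hsgn' : ∀ r : ℝ, |((SignType.sign r : SignType) : ℝ)| ≤ 1 := fun r => by
    rcases lt_trichotomy r 0 with h | h | h <;> simp [h]
  rcases hp.eq_or_lt with rfl | h1
  · refine ⟨fun i => SignType.sign (x i), ?_, ?_⟩
    · rw [conjExponent_one, pNorm_top]
      exact Real.iSup_le (fun i => hsgn' _) zero_le_one
    · simp [pNorm_one, dotProduct, hsgn]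
  rcases eq_or_ne p ∞ with rfl | h2
  · rw [conjExponent_top, pNorm_top]
    -- The dual vector is carried by a coordinate of maximal modulus, which does not exist for `M =
    -- 0`.
    rcases isEmpty_or_nonempty (Fin M) with hM | hM
    · exact ⟨x, by simp [pNorm_one], by simp [dotProduct]⟩
    · obtain ⟨i, hi⟩ := exists_eq_ciSup_of_finite (f := fun i => |x i|)
      refine ⟨Pi.single i (SignType.sign (x i)), ?_, ?_⟩
      · rw [pNorm_one, Finset.sum_eq_single i]
        · simpa using hsgn' (x i)
        · intro j _ hj
          simp [hj]
        · simp
      · rw [dotProduct_single, hsgn, hi]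
  have h := holderConjugate_toReal h1 h2.lt_top
  rw [pNorm_of_toReal_pos h.pos]
  obtain ⟨y, hy, hxy⟩ := (NNReal.isGreatest_Lp Finset.univ (fun i => ‖x i‖₊) h).1
  refine ⟨fun i => SignType.sign (x i) * y i, ?_, ?_⟩
  · rw [pNorm_of_toReal_pos h.symm.pos]
    refine Real.rpow_le_one (Finset.sum_nonneg fun i _ => by positivity) ?_ (by
      have := h.symm.pos; positivity)
    have hy' : ((∑ i, y i ^ p.conjExponent.toReal : NNReal) : ℝ) ≤ 1 := by exact_mod_cast hy
    push_cast at hy'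
    refine le_trans (Finset.sum_le_sum fun i _ => ?_) hy'
    refine Real.rpow_le_rpow (abs_nonneg _) ?_ h.symm.nonneg
    rw [abs_mul, NNReal.abs_eq]
    exact mul_le_of_le_one_left (y i).2 (hsgn' _)
  · have := congrArg (fun r : NNReal => (r : ℝ)) hxy
    push_cast at this
    simp only [Real.norm_eq_abs] at this
    rw [← this]
    refine Finset.sum_congr rfl fun i _ => ?_
    rw [← mul_assoc, hsgn]

/-- The finite-dimensional `ℓ^p` spaces are strictly convex for `1 < p < ∞`. -/
theorem strictConvexSpace_piLp {M : ℕ} {p : ℝ≥0∞} [Fact (1 ≤ p)] (h1 : 1 < p) (h2 : p < ∞) :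
    StrictConvexSpace ℝ (PiLp p (fun _ : Fin M => ℝ)) := by
  have hp1 : 1 < p.toReal := by
    simpa using (ENNReal.toReal_lt_toReal ENNReal.one_ne_top h2.ne).2 h1
  have hp0 : 0 < p.toReal := by linarith
  set q := p.toReal
  have hnorm : ∀ x : PiLp p (fun _ : Fin M => ℝ), ‖x‖ = (∑ i, |x i| ^ q) ^ (1 / q) := fun x => by
    simp [PiLp.norm_eq_sum hp0, q]
  have hle : ∀ a b : ℝ, |2⁻¹ * a + 2⁻¹ * b| ^ q ≤ 2⁻¹ * |a| ^ q + 2⁻¹ * |b| ^ q := fun a b => by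
    have h3 := (strictConvexOn_rpow hp1).convexOn.2 (abs_nonneg a) (abs_nonneg b)
      (show (0 : ℝ) ≤ 2⁻¹ by norm_num) (show (0 : ℝ) ≤ 2⁻¹ by norm_num) (by norm_num)
    refine le_trans (Real.rpow_le_rpow (abs_nonneg _) ?_ hp0.le) h3
    refine (abs_add_le _ _).trans_eq ?_
    simp [abs_mul]
  have hlt : ∀ a b : ℝ, a ≠ b →
      |2⁻¹ * a + 2⁻¹ * b| ^ q < 2⁻¹ * |a| ^ q + 2⁻¹ * |b| ^ q := fun a b hab => by
    -- Strict convexity of the power needs different moduli; if they agree, then `a = -b` and the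
    -- midpoint is zero.
    by_cases h : |a| = |b|
    · have hb : a = -b := (abs_eq_abs.1 h).resolve_left hab
      have hb0 : b ≠ 0 := fun h0 => hab (by simp [hb, h0])
      have : 0 < |b| ^ q := Real.rpow_pos_of_pos (abs_pos.2 hb0) _
      subst hb
      simp only [mul_neg, neg_add_cancel, abs_zero, abs_neg]
      rw [Real.zero_rpow hp0.ne']
      linarith
    · have h3 := (strictConvexOn_rpow hp1).2 (abs_nonneg a) (abs_nonneg b) h
        (show (0 : ℝ) < 2⁻¹ by norm_num) (show (0 : ℝ) < 2⁻¹ by norm_num) (by norm_num)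
      refine lt_of_le_of_lt (Real.rpow_le_rpow (abs_nonneg _) ?_ hp0.le) h3
      refine (abs_add_le _ _).trans_eq ?_
      simp [abs_mul]
  refine StrictConvexSpace.of_norm_combo_lt_one fun x y hx hy hxy => ⟨2⁻¹, 2⁻¹, by norm_num, ?_⟩
  have hone : ∀ x : PiLp p (fun _ : Fin M => ℝ), ‖x‖ = 1 → ∑ i, |x i| ^ q = 1 := fun x hx => by
    have h0 : 0 ≤ ∑ i, |x i| ^ q := Finset.sum_nonneg fun i _ => by positivity
    rw [hnorm] at hx
    have := congrArg (fun r : ℝ => r ^ q) hx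
    simpa [← Real.rpow_mul h0, inv_mul_cancel₀ hp0.ne'] using this
  rw [hnorm]
  refine Real.rpow_lt_one (Finset.sum_nonneg fun i _ => by positivity) ?_ (by positivity)
  obtain ⟨i, hi⟩ : ∃ i, x i ≠ y i := by
    by_contra! h
    exact hxy (PiLp.ext h)
  calc ∑ i, |((2⁻¹ : ℝ) • x + (2⁻¹ : ℝ) • y : PiLp p (fun _ : Fin M => ℝ)) i| ^ q
      < ∑ i, (2⁻¹ * |x i| ^ q + 2⁻¹ * |y i| ^ q) :=
        Finset.sum_lt_sum (fun i _ => by simpa using hle (x i) (y i))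
          ⟨i, Finset.mem_univ _, by simpa using hlt _ _ hi⟩
    _ = 1 := by
      rw [Finset.sum_add_distrib, ← Finset.mul_sum, ← Finset.mul_sum, hone x hx, hone y hy]
      norm_num

/-! ### Step functions as sums of jumps -/

/-- The indicator function of `(-∞, x)`. -/
noncomputable def below (x : ℝ) : ℝ → ℝ := (Iio x).indicator 1

theorem below_of_lt {x s : ℝ} (h : s < x) : below x s = 1 := by simp [below, h]

theorem below_of_le {x s : ℝ} (h : x ≤ s) : below x s = 0 := by simp [below, h]

theorem below_nonneg (x s : ℝ) : 0 ≤ below x s := by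
  rcases lt_or_ge s x with h | h
  · simp [below_of_lt h]
  · simp [below_of_le h]

theorem below_le_one (x s : ℝ) : below x s ≤ 1 := by
  rcases lt_or_ge s x with h | h
  · simp [below_of_lt h]
  · simp [below_of_le h]

theorem measurable_below (x : ℝ) : Measurable (below x) :=
  measurable_one.indicator measurableSet_Iio

theorem indicator_Ico_eq_below {E : Type*} [AddCommGroup E] [Module ℝ E] {x y : ℝ} (h : x ≤ y)
    (v : E) (s : ℝ) :
    (Ico x y).indicator (fun _ => v) s = below y s • v - below x s • v := by
  rcases lt_or_ge s x with h1 | h1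
  · rw [indicator_of_notMem (fun h2 => absurd h2.1 (not_le.2 h1)), below_of_lt h1,
      below_of_lt (h1.trans_le h), sub_self]
  · rcases lt_or_ge s y with h2 | h2
    · rw [indicator_of_mem (show s ∈ Ico x y from ⟨h1, h2⟩), below_of_le h1, below_of_lt h2]
      simp
    · rw [indicator_of_notMem (fun h3 => absurd h3.2 (not_lt.2 h2)), below_of_le h1,
        below_of_le h2]
      simp

theorem grid_zero {m : ℕ} (T : ℝ) (t : Fin m → ℝ) : grid T t 0 = 0 := rfl

theorem grid_last {m : ℕ} (T : ℝ) (t : Fin m → ℝ) : grid T t (Fin.last (m + 1)) = T := by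
  rw [grid, ← Fin.succ_last, Fin.cons_succ, Fin.snoc_last]

theorem grid_castSucc_succ {m : ℕ} (T : ℝ) (t : Fin m → ℝ) (j : Fin m) :
    grid T t j.castSucc.succ = t j := by
  rw [grid, Fin.cons_succ, Fin.snoc_castSucc]

theorem grid_succ_castSucc {m : ℕ} (T : ℝ) (t : Fin m → ℝ) (j : Fin m) :
    grid T t j.succ.castSucc = t j := by
  rw [← Fin.succ_castSucc, grid_castSucc_succ]

theorem mem_Ioo_of_strictMono_grid {m : ℕ} {T : ℝ} {t : Fin m → ℝ} (h : StrictMono (grid T t))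
    (j : Fin m) : t j ∈ Ioo 0 T := by
  constructor
  · have := h (Fin.succ_pos j.castSucc)
    rwa [grid_zero, grid_castSucc_succ] at this
  · have := h (Fin.castSucc_lt_last j.succ)
    rwa [grid_last, grid_succ_castSucc] at this

theorem strictMono_of_strictMono_grid {m : ℕ} {T : ℝ} {t : Fin m → ℝ}
    (h : StrictMono (grid T t)) : StrictMono t := by
  intro i j hij
  have := h (Fin.succ_lt_succ_iff.2 (Fin.castSucc_lt_castSucc_iff.2 hij))
  rwa [grid_castSucc_succ, grid_castSucc_succ] at this

/-- The step function with value `a (last)` at the right end and jumps `jump a j` at `t j`. -/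
noncomputable def jumpForm {M m : ℕ} (a : Fin (m + 1) → Fin M → ℤ) (t : Fin m → ℝ) (s : ℝ) :
    Fin M → ℝ :=
  toReal (a (Fin.last m)) + ∑ j, below (t j) s • jump a j

/-- Abel summation: the contributions at the two ends of the grid are constant on (0,T), and each
inner point keeps the difference of its neighbouring values. In this form a switching time moves
without touching the others. -/
theorem stepFunction_eq_jumpForm {M m : ℕ} {T : ℝ} {t : Fin m → ℝ}
    (h : Monotone (grid T t)) (a : Fin (m + 1) → Fin M → ℤ) {s : ℝ} (hs : s ∈ Ioo 0 T) :
    stepFunction T t a s = jumpForm a t s := by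
  have h1 : stepFunction T t a s = ∑ j : Fin (m + 1), below (grid T t j.succ) s • toReal (a j)
      - ∑ j : Fin (m + 1), below (grid T t j.castSucc) s • toReal (a j) := by
    rw [stepFunction, ← Finset.sum_sub_distrib]
    exact Finset.sum_congr rfl fun j _ =>
      indicator_Ico_eq_below (h (Fin.castSucc_lt_succ (i := j)).le) _ _
  rw [h1, Fin.sum_univ_castSucc, Fin.sum_univ_succ (n := m), Fin.succ_last, grid_last,
    Fin.castSucc_zero, grid_zero, below_of_lt hs.2, below_of_le hs.1.le, jumpForm]
  simp only [grid_castSucc_succ, grid_succ_castSucc, jump, smul_sub, Finset.sum_sub_distrib]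
  simp
  abel

/-- Telescoping from the last value back to the `j`-th one. -/
theorem add_sum_ite_smul_sub {E : Type*} [AddCommGroup E] [Module ℝ E] {m : ℕ}
    (v : Fin (m + 1) → E) (j : Fin (m + 1)) :
    v (Fin.last m) + ∑ k : Fin m,
      (if j ≤ k.castSucc then (1 : ℝ) else 0) • (v k.castSucc - v k.succ) = v j := by
  induction m with
  | zero =>
    rw [Fin.fin_one_eq_zero j]
    simp
  | succ m ih =>
    rw [Fin.sum_univ_castSucc]
    induction j using Fin.lastCases with
    | last =>
      have h : ∀ k : Fin (m + 1), ¬ Fin.last (m + 1) ≤ k.castSucc := fun k =>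
        not_le.2 (Fin.castSucc_lt_last k)
      simp [h]
    | cast j =>
      have := ih (fun i => v i.castSucc) j
      rw [if_pos (Fin.castSucc_le_castSucc_iff.2 (Fin.le_last j)), one_smul]
      simp only [Fin.castSucc_le_castSucc_iff, Fin.succ_castSucc, Fin.succ_last] at this ⊢
      rw [← this]
      abel

theorem jumpForm_eq {M m : ℕ} (a : Fin (m + 1) → Fin M → ℤ) {t : Fin m → ℝ} {s : ℝ}
    (j : Fin (m + 1)) (h1 : ∀ k : Fin m, k.castSucc < j → t k ≤ s)
    (h2 : ∀ k : Fin m, j ≤ k.castSucc → s < t k) : jumpForm a t s = toReal (a j) := by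
  rw [← add_sum_ite_smul_sub (fun i => toReal (a i)) j, jumpForm]
  congr 1
  refine Finset.sum_congr rfl fun k _ => ?_
  rw [jump]
  split_ifs with h
  · rw [below_of_lt (h2 k h)]
  · rw [below_of_le (h1 k (not_le.1 h))]

/-- Every time lies in one of the intervals of a monotone grid. -/
theorem exists_index {m : ℕ} {t : Fin m → ℝ} (ht : Monotone t) (s : ℝ) :
    ∃ j : Fin (m + 1), (∀ k : Fin m, k.castSucc < j → t k ≤ s) ∧
      ∀ k : Fin m, j ≤ k.castSucc → s < t k := by
  by_cases h : ∃ k, s < t k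
  · obtain ⟨k, hk, hmin⟩ := WellFounded.has_min (wellFounded_lt (α := Fin m)) {k | s < t k} h
    refine ⟨k.castSucc, fun i hi => ?_, fun i hi => ?_⟩
    · exact not_lt.1 fun h' => hmin i h' (Fin.castSucc_lt_castSucc_iff.1 hi)
    · exact lt_of_lt_of_le hk (ht (Fin.castSucc_le_castSucc_iff.1 hi))
  · push Not at h
    exact ⟨Fin.last m, fun k _ => h k, fun k hk => absurd hk (not_le.2 (Fin.castSucc_lt_last k))⟩

/-! ### Total variation from above -/

theorem hasDerivAt_dotProduct {M : ℕ} {φ : ℝ → Fin M → ℝ} {φ' : Fin M → ℝ} {s : ℝ}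
    (h : HasDerivAt φ φ' s) (v : Fin M → ℝ) :
    HasDerivAt (fun s => v ⬝ᵥ φ s) (v ⬝ᵥ φ') s :=
  HasDerivAt.fun_sum fun i _ => (hasDerivAt_pi.1 h i).const_mul (v i)

theorem IsTestFunction.eq_zero {M : ℕ} {T : ℝ} {p : ℝ≥0∞} {φ : ℝ → Fin M → ℝ}
    (h : IsTestFunction T p φ) {s : ℝ} (hs : s ∉ Ioo 0 T) : φ s = 0 :=
  image_eq_zero_of_notMem_tsupport fun h' => hs (h.tsupport_subset h')

theorem continuous_dotProduct_deriv {M : ℕ} {φ : ℝ → Fin M → ℝ} (h : ContDiff ℝ 1 φ)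
    (v : Fin M → ℝ) : Continuous fun s => v ⬝ᵥ deriv φ s :=
  continuous_const.dotProduct (h.continuous_deriv le_rfl)

theorem integrableOn_below_mul {f : ℝ → ℝ} (hf : Continuous f) (T x : ℝ) :
    IntegrableOn (fun s => below x s * f s) (Ioo 0 T) := by
  have h1 : IntegrableOn f (Ioo 0 T) :=
    (hf.integrableOn_Icc (a := 0) (b := T)).mono_set Ioo_subset_Icc_self
  refine Integrable.bdd_mul (c := 1) h1 (measurable_below x).aestronglyMeasurable ?_
  refine Filter.Eventually.of_forall fun s => ?_
  rw [Real.norm_of_nonneg (below_nonneg x s)]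
  exact below_le_one x s

theorem setIntegral_below_mul {f : ℝ → ℝ} {T x : ℝ} (hx : x ∈ Icc 0 T) :
    ∫ s in Ioo 0 T, below x s * f s = ∫ s in (0 : ℝ)..x, f s := by
  have h1 : ∀ s, below x s * f s = (Iio x).indicator f s := fun s => by
    rcases lt_or_ge s x with h | h
    · rw [below_of_lt h, indicator_of_mem (mem_Iio.2 h), one_mul]
    · rw [below_of_le h, indicator_of_notMem (show s ∉ Iio x from not_lt.2 h), zero_mul]
  simp_rw [h1]
  rw [setIntegral_indicator measurableSet_Iio, intervalIntegral.integral_of_le hx.1,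
    integral_Ioc_eq_integral_Ioo]
  congr 2
  ext s
  constructor
  · rintro ⟨h2, h3⟩
    exact ⟨h2.1, h3⟩
  · rintro ⟨h2, h3⟩
    exact ⟨⟨h2, h3.trans_le hx.2⟩, h3⟩

/-- Integration from 0, where the test function vanishes, to `x`: a jump at `x` contributes the
value of the test function there. -/
theorem IsTestFunction.setIntegral_below_mul {M : ℕ} {T : ℝ} {p : ℝ≥0∞} {φ : ℝ → Fin M → ℝ}
    (h : IsTestFunction T p φ) (v : Fin M → ℝ) {x : ℝ} (hx : x ∈ Icc 0 T) :
    ∫ s in Ioo 0 T, below x s * (v ⬝ᵥ deriv φ s) = v ⬝ᵥ φ x := by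
  rw [SwitchingControl.setIntegral_below_mul hx,
    intervalIntegral.integral_eq_sub_of_hasDerivAt (f := fun s => v ⬝ᵥ φ s)
      (fun s _ => hasDerivAt_dotProduct
        ((h.contDiff.differentiable one_ne_zero) s).hasDerivAt v)
      ((continuous_dotProduct_deriv h.contDiff v).intervalIntegrable _ _),
    h.eq_zero (s := 0) (by simp)]
  simp

theorem IsTestFunction.dotProduct_le {M : ℕ} {T : ℝ} {p : ℝ≥0∞} (hp : 1 ≤ p)
    {φ : ℝ → Fin M → ℝ} (h : IsTestFunction T p φ) (v : Fin M → ℝ) (x : ℝ) :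
    v ⬝ᵥ φ x ≤ pNorm p v := by
  by_cases hx : x ∈ Ioo 0 T
  · exact (dotProduct_le_pNorm_mul hp v (φ x)).trans
      (mul_le_of_le_one_right (pNorm_nonneg hp v) (h.pNorm_le x hx))
  · rw [h.eq_zero hx, dotProduct_zero]
    exact pNorm_nonneg hp v

/-- The total variation of a convex combination of step functions with common jumps. -/
theorem TV_le_sum_pNorm {M m : ℕ} {T : ℝ} (hT : 0 < T) {p : ℝ≥0∞} (hp : 1 ≤ p)
    (w : ControlSpace M T) (c : Fin M → ℝ) (μ : Fin m → Fin M → ℝ) {l x y : Fin m → ℝ}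
    (hl : ∀ j, l j ∈ Icc (0 : ℝ) 1) (hx : ∀ j, x j ∈ Icc 0 T) (hy : ∀ j, y j ∈ Icc 0 T)
    (hw : ∀ᵐ s ∂(volume : Measure ℝ).restrict (Ioo 0 T),
      (w s).ofLp = c + ∑ j, (l j * below (x j) s + (1 - l j) * below (y j) s) • μ j) :
    TV p w ≤ ENNReal.ofReal (∑ j, pNorm p (μ j)) := by
  refine iSup₂_le fun φ hφ => ENNReal.ofReal_le_ofReal ?_
  have hi := fun (v : Fin M → ℝ) (x : ℝ) =>
    integrableOn_below_mul (continuous_dotProduct_deriv hφ.contDiff v) T x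
  have h1 : ∫ s in Ioo 0 T, (w s).ofLp ⬝ᵥ deriv φ s =
      ∫ s in Ioo 0 T, (below T s * (c ⬝ᵥ deriv φ s) +
        ∑ j, (l j * (below (x j) s * (μ j ⬝ᵥ deriv φ s)) +
          (1 - l j) * (below (y j) s * (μ j ⬝ᵥ deriv φ s)))) := by
    refine integral_congr_ae ?_
    filter_upwards [hw, ae_restrict_mem measurableSet_Ioo] with s hs hsT
    rw [hs, add_dotProduct, below_of_lt hsT.2, one_mul, sum_dotProduct]
    congr 1
    refine Finset.sum_congr rfl fun j _ => ?_
    rw [smul_dotProduct, smul_eq_mul]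
    ring
  have h2 : ∀ j, Integrable (fun s => l j * (below (x j) s * (μ j ⬝ᵥ deriv φ s)) +
      (1 - l j) * (below (y j) s * (μ j ⬝ᵥ deriv φ s))) (volume.restrict (Ioo 0 T)) := fun j =>
    ((hi _ _).const_mul _).add ((hi _ _).const_mul _)
  rw [h1, integral_add (hi _ _) (integrable_finsetSum _ fun j _ => h2 j),
    integral_finsetSum _ fun j _ => h2 j,
    hφ.setIntegral_below_mul c (right_mem_Icc.2 hT.le), hφ.eq_zero (s := T) (by simp),
    dotProduct_zero, zero_add]
  -- Each jump contributes a convex combination of two values `μ j ⬝ᵥ φ`, both bounded by the norm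
  -- of the jump through Hölder.
  refine Finset.sum_le_sum fun j _ => ?_
  rw [integral_add ((hi _ _).const_mul _) ((hi _ _).const_mul _), integral_const_mul,
    integral_const_mul, hφ.setIntegral_below_mul _ (hx j), hφ.setIntegral_below_mul _ (hy j)]
  have h2 := mul_le_mul_of_nonneg_left (hφ.dotProduct_le hp (μ j) (x j)) (hl j).1
  have h3 := mul_le_mul_of_nonneg_left (hφ.dotProduct_le hp (μ j) (y j)) (sub_nonneg.2 (hl j).2)
  linarith

/-! ### Total variation from below, by mollified test functions -/

/-- A sequence of smooth bump functions concentrating at the origin. -/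
noncomputable def bumpSeq (n : ℕ) : ContDiffBump (0 : ℝ) where
  rIn := 1 / (n + 1)
  rOut := 2 / (n + 1)
  rIn_pos := by positivity
  rIn_lt_rOut := by gcongr; norm_num

theorem tendsto_rOut_bumpSeq : Tendsto (fun n => (bumpSeq n).rOut) atTop (𝓝 0) := by
  have := (tendsto_one_div_add_atTop_nhds_zero_nat (𝕜 := ℝ)).const_mul 2
  simpa [bumpSeq, div_eq_mul_inv] using this

/-- The mollified control converges at `x` to the value of the control. -/
def IsRegularPoint {M : ℕ} {T : ℝ} (w : ControlSpace M T) (x : ℝ) : Prop :=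
  ∀ k, Tendsto (fun n => ∫ s in Ioo 0 T, (bumpSeq n).normed volume (x - s) * (w s).ofLp k)
    atTop (𝓝 ((w x).ofLp k))

theorem integrable_coord {M : ℕ} {T : ℝ} (w : ControlSpace M T) (k : Fin M) :
    Integrable (fun s => (w s).ofLp k) (volume.restrict (Ioo 0 T)) :=
  (EuclideanSpace.proj k : EuclideanSpace ℝ (Fin M) →L[ℝ] ℝ).integrable_comp
    ((PiLp.continuousLinearEquiv 2 ℝ (fun _ : Fin M => ℝ)).symm.toContinuousLinearMap.integrable_comp
    ((PiLp.continuousLinearEquiv 1 ℝ (fun _ : Fin M => ℝ)).toContinuousLinearMap.integrable_comp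
      (L1.integrable_coeFn w)))

theorem ae_isRegularPoint {M : ℕ} {T : ℝ} (w : ControlSpace M T) :
    ∀ᵐ x ∂(volume : Measure ℝ).restrict (Ioo 0 T), IsRegularPoint w x := by
  refine ae_all_iff.2 fun k => ?_
  have hi : Integrable ((Ioo 0 T).indicator fun s => (w s).ofLp k) :=
    (integrable_indicator_iff measurableSet_Ioo).2 (integrable_coord w k)
  -- `K = 2` is the fixed ratio of outer to inner radius, as the Lebesgue differentiation argument
  -- needs comparable radii.
  have h := ContDiffBump.ae_convolution_tendsto_right_of_locallyIntegrable (K := 2)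
    (φ := bumpSeq) (l := atTop) tendsto_rOut_bumpSeq
    (Eventually.of_forall fun n => by simp [bumpSeq]; ring_nf; rfl) hi.locallyIntegrable
  filter_upwards [ae_restrict_of_ae h, ae_restrict_mem measurableSet_Ioo] with x hx hxT
  rw [indicator_of_mem hxT] at hx
  refine hx.congr fun n => ?_
  rw [convolution_eq_swap, ← integral_indicator measurableSet_Ioo]
  refine integral_congr_ae (Eventually.of_forall fun s => ?_)
  by_cases hs : s ∈ Ioo 0 T <;> simp [hs]

/-- The function `s ↦ ∑ᵢ (∫_{x i - s}^{x (i+1) - s} ρ) ψ i`. -/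
noncomputable def chainTest {M : ℕ} (ρ : ℝ → ℝ) (x : ℕ → ℝ) (ψ : ℕ → Fin M → ℝ) (N : ℕ) (s : ℝ) :
    Fin M → ℝ :=
  ∑ i ∈ Finset.range N, (∫ y in (x i - s)..(x (i + 1) - s), ρ y) • ψ i

/-- The derivative is a difference of bumps at consecutive points, so testing a control against it
produces differences of its mollified values. -/
theorem hasDerivAt_chainTest {M : ℕ} {ρ : ℝ → ℝ} (hρ : Continuous ρ) (x : ℕ → ℝ)
    (ψ : ℕ → Fin M → ℝ) (N : ℕ) (s : ℝ) :
    HasDerivAt (chainTest ρ x ψ N)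
      (∑ i ∈ Finset.range N, (ρ (x i - s) - ρ (x (i + 1) - s)) • ψ i) s := by
  refine HasDerivAt.fun_sum fun i _ => HasDerivAt.smul_const ?_ _
  have hI : ∀ a b, IntervalIntegrable ρ volume a b := fun a b => hρ.intervalIntegrable a b
  have h1 : ∀ z : ℝ, HasDerivAt (fun s => ∫ y in (0 : ℝ)..(z - s), ρ y) (-ρ (z - s)) s := fun z => by
    have h2 : HasDerivAt (fun u => ∫ y in (0 : ℝ)..u, ρ y) (ρ (z - s)) (z - s) :=
      intervalIntegral.integral_hasDerivAt_right (hI _ _)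
        hρ.stronglyMeasurable.stronglyMeasurableAtFilter hρ.continuousAt
    exact (h2.comp s ((hasDerivAt_id s).const_sub z)).congr_deriv (by ring)
  have h3 := (h1 (x (i + 1))).sub (h1 (x i))
  refine (h3.congr_deriv (by ring)).congr_of_eventuallyEq (Eventually.of_forall fun s => ?_)
  exact (intervalIntegral.integral_interval_sub_left (hI _ _) (hI _ _)).symm

theorem contDiff_chainTest {M : ℕ} {ρ : ℝ → ℝ} (hρ : Continuous ρ) (x : ℕ → ℝ)
    (ψ : ℕ → Fin M → ℝ) (N : ℕ) : ContDiff ℝ 1 (chainTest ρ x ψ N) := by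
  refine contDiff_one_iff_deriv.2
    ⟨fun s => (hasDerivAt_chainTest hρ x ψ N s).differentiableAt, ?_⟩
  have : deriv (chainTest ρ x ψ N) =
      fun s => ∑ i ∈ Finset.range N, (ρ (x i - s) - ρ (x (i + 1) - s)) • ψ i :=
    funext fun s => (hasDerivAt_chainTest hρ x ψ N s).deriv
  rw [this]
  fun_prop

/-- The weights are integrals of a probability density over adjacent intervals: they are nonnegative
with sum at most one. -/
theorem pNorm_chainTest_le {M : ℕ} {q : ℝ≥0∞} (hq : 1 ≤ q) {ρ : ℝ → ℝ} (hρ : Continuous ρ)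
    (hρi : Integrable ρ) (hρ0 : ∀ y, 0 ≤ ρ y) (hρ1 : ∫ y, ρ y = 1) {x : ℕ → ℝ} (hx : Monotone x)
    {ψ : ℕ → Fin M → ℝ} (hψ : ∀ i, pNorm q (ψ i) ≤ 1) (N : ℕ) (s : ℝ) :
    pNorm q (chainTest ρ x ψ N s) ≤ 1 := by
  have : Fact (1 ≤ q) := ⟨hq⟩
  have hI : ∀ a b, IntervalIntegrable ρ volume a b := fun a b => hρ.intervalIntegrable a b
  have h0 : ∀ i, 0 ≤ ∫ y in (x i - s)..(x (i + 1) - s), ρ y := fun i =>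
    intervalIntegral.integral_nonneg (by linarith [hx (Nat.le_succ i)]) fun y _ => hρ0 y
  calc pNorm q (chainTest ρ x ψ N s)
      = ‖∑ i ∈ Finset.range N, (∫ y in (x i - s)..(x (i + 1) - s), ρ y) •
          (WithLp.toLp q (ψ i) : PiLp q (fun _ : Fin M => ℝ))‖ := by
        rw [pNorm, chainTest, WithLp.toLp_sum]
        rfl
    _ ≤ ∑ i ∈ Finset.range N, ∫ y in (x i - s)..(x (i + 1) - s), ρ y := by
        refine norm_sum_le_of_le _ fun i _ => ?_
        rw [norm_smul, Real.norm_of_nonneg (h0 i)]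
        exact mul_le_of_le_one_right (h0 i) (hψ i)
    _ = ∫ y in (x 0 - s)..(x N - s), ρ y :=
        intervalIntegral.sum_integral_adjacent_intervals (a := fun i => x i - s) fun i _ => hI _ _
    _ ≤ ∫ y, ρ y := by
        rw [intervalIntegral.integral_of_le (by linarith [hx (Nat.zero_le N)])]
        exact setIntegral_le_integral hρi (Eventually.of_forall hρ0)
    _ = 1 := hρ1

theorem chainTest_eq_zero {M : ℕ} {ρ : ℝ → ℝ} {r : ℝ} (hρ : ∀ y, r ≤ |y| → ρ y = 0)
    {x : ℕ → ℝ} (hx : Monotone x) (ψ : ℕ → Fin M → ℝ) {N : ℕ} {s : ℝ}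
    (hs : s ∉ Icc (x 0 - r) (x N + r)) : chainTest ρ x ψ N s = 0 := by
  refine Finset.sum_eq_zero fun i hi => ?_
  have h1 : x 0 ≤ x i := hx (Nat.zero_le i)
  have h2 : x i ≤ x (i + 1) := hx (Nat.le_succ i)
  have h3 : x (i + 1) ≤ x N := hx (Finset.mem_range.1 hi)
  have : ∫ y in (x i - s)..(x (i + 1) - s), ρ y = ∫ _ in (x i - s)..(x (i + 1) - s), (0 : ℝ) := by
    refine intervalIntegral.integral_congr fun y hy => hρ y ?_
    rw [uIcc_of_le (by linarith)] at hy
    by_cases h : x 0 - r ≤ s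
    · have h4 : x N + r < s := by
        by_contra! h5
        exact hs ⟨h, h5⟩
      exact le_abs.2 (Or.inr (by linarith [hy.2]))
    · exact le_abs.2 (Or.inl (by linarith [hy.1]))
  rw [this]
  simp

theorem integrable_bump_mul {M : ℕ} {T : ℝ} (w : ControlSpace M T) (k : Fin M) (n : ℕ) (z : ℝ) :
    Integrable (fun s => (bumpSeq n).normed volume (z - s) * (w s).ofLp k)
      (volume.restrict (Ioo 0 T)) := by
  obtain ⟨C, hC⟩ := (bumpSeq n).continuous_normed (μ := volume).bounded_above_of_compact_support
    (bumpSeq n).hasCompactSupport_normed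
  refine (integrable_coord w k).bdd_mul (c := C) ?_ (Eventually.of_forall fun s => hC _)
  exact ((bumpSeq n).continuous_normed.comp (continuous_const.sub continuous_id)).aestronglyMeasurable

/-- Take for the vectors of the test function the dual vectors of the increments. Its integral
against the control converges to the sum of their norms as the mollification disappears. -/
theorem sum_pNorm_sub_le_TV {M : ℕ} {T : ℝ} {p : ℝ≥0∞} (hp : 1 ≤ p) (w : ControlSpace M T)
    {x : ℕ → ℝ} (hx : Monotone x) (hxT : ∀ i, x i ∈ Ioo 0 T) (hxw : ∀ i, IsRegularPoint w (x i))
    (N : ℕ) :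
    ENNReal.ofReal (∑ i ∈ Finset.range N, pNorm p ((w (x i)).ofLp - (w (x (i + 1))).ofLp)) ≤
      TV p w := by
  choose ψ hψ1 hψ2 using fun i => exists_dual_vector hp ((w (x i)).ofLp - (w (x (i + 1))).ofLp)
  have hconj : 1 ≤ p.conjExponent := by simp [ENNReal.conjExponent]
  set ρ : ℕ → ℝ → ℝ := fun n => (bumpSeq n).normed volume with hρdef
  have hρc : ∀ n, Continuous (ρ n) := fun n => (bumpSeq n).continuous_normed
  have hval : ∀ n, ∫ s in Ioo 0 T, (w s).ofLp ⬝ᵥ deriv (chainTest (ρ n) x ψ N) s =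
      ∑ i ∈ Finset.range N, ∑ k, ((∫ s in Ioo 0 T, ρ n (x i - s) * (w s).ofLp k) -
        ∫ s in Ioo 0 T, ρ n (x (i + 1) - s) * (w s).ofLp k) * ψ i k := fun n => by
    have h1 : ∀ s, (w s).ofLp ⬝ᵥ deriv (chainTest (ρ n) x ψ N) s =
        ∑ i ∈ Finset.range N, ∑ k, (ρ n (x i - s) * (w s).ofLp k -
          ρ n (x (i + 1) - s) * (w s).ofLp k) * ψ i k := fun s => by
      rw [(hasDerivAt_chainTest (hρc n) x ψ N s).deriv, dotProduct_sum]
      refine Finset.sum_congr rfl fun i _ => Finset.sum_congr rfl fun k _ => ?_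
      simp only [Pi.smul_apply, smul_eq_mul]
      ring
    have h2 : ∀ i k, Integrable (fun s => (ρ n (x i - s) * (w s).ofLp k -
          ρ n (x (i + 1) - s) * (w s).ofLp k) * ψ i k) (volume.restrict (Ioo 0 T)) := fun i k =>
      ((integrable_bump_mul w k n _).sub (integrable_bump_mul w k n _)).mul_const _
    simp_rw [h1]
    rw [integral_finsetSum _ fun i _ => integrable_finsetSum _ fun k _ => h2 i k]
    refine Finset.sum_congr rfl fun i _ => ?_
    rw [integral_finsetSum _ fun k _ => h2 i k]
    refine Finset.sum_congr rfl fun k _ => ?_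
    rw [integral_mul_const, integral_sub (integrable_bump_mul w k n _)
      (integrable_bump_mul w k n _)]
  have hlim : Tendsto (fun n => ENNReal.ofReal
      (∫ s in Ioo 0 T, (w s).ofLp ⬝ᵥ deriv (chainTest (ρ n) x ψ N) s)) atTop
      (𝓝 (ENNReal.ofReal
        (∑ i ∈ Finset.range N, pNorm p ((w (x i)).ofLp - (w (x (i + 1))).ofLp)))) := by
    refine ENNReal.tendsto_ofReal ?_
    simp_rw [hval, ← hψ2]
    exact tendsto_finsetSum _ fun i _ => tendsto_finsetSum _ fun k _ =>
      ((hxw i k).sub (hxw (i + 1) k)).mul_const _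
  refine le_of_tendsto hlim ?_
  -- For small radii the support of the test function stays inside (0,T).
  have hr : 0 < min (x 0) (T - x N) := lt_min (hxT 0).1 (sub_pos.2 (hxT N).2)
  filter_upwards [tendsto_rOut_bumpSeq.eventually (gt_mem_nhds hr)] with n hn
  have hsupp : ∀ s, s ∉ Icc (x 0 - (bumpSeq n).rOut) (x N + (bumpSeq n).rOut) →
      chainTest (ρ n) x ψ N s = 0 := fun s hs => by
    refine chainTest_eq_zero (fun y hy => ?_) hx ψ hs
    rw [hρdef]
    simp only [ContDiffBump.normed_def]
    rw [(bumpSeq n).zero_of_le_dist (by simpa [Real.dist_eq] using hy), zero_div]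
  refine le_iSup₂_of_le (chainTest (ρ n) x ψ N)
    ⟨contDiff_chainTest (hρc n) x ψ N, HasCompactSupport.intro isCompact_Icc hsupp, ?_,
      fun s _ => ?_⟩ le_rfl
  · have h1 : tsupport (chainTest (ρ n) x ψ N) ⊆
        Icc (x 0 - (bumpSeq n).rOut) (x N + (bumpSeq n).rOut) :=
      closure_minimal (fun s hs => by_contra fun h => hs (hsupp s h)) isClosed_Icc
    exact h1.trans (Icc_subset_Ioo (by linarith [hn.trans_le (min_le_left _ _)])
      (by linarith [hn.trans_le (min_le_right _ _)]))
  · exact pNorm_chainTest_le hconj (hρc n) (bumpSeq n).integrable_normed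
      (bumpSeq n).nonneg_normed (bumpSeq n).integral_normed hx hψ1 N s

/-- The pointwise variation over regular points is bounded by the total variation. -/
theorem eVariationOn_le_TV {M : ℕ} {T : ℝ} {p : ℝ≥0∞} [Fact (1 ≤ p)] (w : ControlSpace M T)
    {G : Set ℝ} (hG : ∀ x ∈ G, x ∈ Ioo 0 T ∧ IsRegularPoint w x) :
    eVariationOn (fun s => (WithLp.toLp p (w s).ofLp : PiLp p (fun _ : Fin M => ℝ))) G ≤
      TV p w := by
  refine iSup_le fun ⟨N, x, hx, hxG⟩ => ?_
  refine le_trans (le_of_eq ?_) (sum_pNorm_sub_le_TV Fact.out w hx (fun i => (hG _ (hxG i)).1)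
    (fun i => (hG _ (hxG i)).2) N)
  rw [ENNReal.ofReal_sum_of_nonneg fun i _ => pNorm_nonneg Fact.out _]
  refine Finset.sum_congr rfl fun i _ => ?_
  rw [edist_comm, edist_dist, dist_eq_norm]
  rfl

/-! ### Finitely many switches: existence of the minimal representation -/

/-- Almost every point of a set of reals is charged by the set from the left. -/
theorem ae_left_density (D : Set ℝ) :
    volume {s ∈ D | ∃ b < s, volume (D ∩ Ioo b s) = 0} = 0 := by
  set B : ℚ → Set ℝ := fun q => {s ∈ D | (q : ℝ) < s ∧ volume (D ∩ Ioo (q : ℝ) s) = 0}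
  -- Lindelöf: countably many of the intervals `(q, s)` have the same union as all of them. Their
  -- traces on `D` are null and cover `B q` except possibly its largest point.
  have hB : ∀ q, volume (B q) = 0 := fun q => by
    obtain ⟨C, hCs, hC, hCU⟩ := TopologicalSpace.isOpen_biUnion_countable (B q)
      (fun s => Ioo (q : ℝ) s) fun _ _ => isOpen_Ioo
    have h1 : volume (⋃ s ∈ C, D ∩ Ioo (q : ℝ) s) = 0 :=
      (measure_biUnion_null_iff hC).2 fun s hs => (hCs hs).2.2
    have h2 : (B q \ ⋃ s ∈ C, D ∩ Ioo (q : ℝ) s).Subsingleton := by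
      have h3 : ∀ x y, x ∈ B q → y ∈ B q → x < y → x ∈ ⋃ s ∈ C, D ∩ Ioo (q : ℝ) s := by
        intro x y hx hy hxy
        have h4 : x ∈ ⋃ s ∈ C, Ioo (q : ℝ) s := by
          rw [hCU]
          exact mem_biUnion hy ⟨hx.2.1, hxy⟩
        obtain ⟨s, hs, hxs⟩ := mem_iUnion₂.1 h4
        exact mem_biUnion hs ⟨hx.1, hxs⟩
      rintro x ⟨hx, hx'⟩ y ⟨hy, hy'⟩
      rcases lt_trichotomy x y with h | h | h
      · exact absurd (h3 x y hx hy h) hx'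
      · exact h
      · exact absurd (h3 y x hy hx h) hy'
    refine measure_mono_null (t := (⋃ s ∈ C, D ∩ Ioo (q : ℝ) s) ∪
      (B q \ ⋃ s ∈ C, D ∩ Ioo (q : ℝ) s)) (by rw [union_sdiff_self]; exact subset_union_right) ?_
    exact measure_union_null h1 (h2.measure_zero _)
  refine measure_mono_null ?_ (measure_iUnion_null hB)
  rintro s ⟨hs, b, hb, h⟩
  obtain ⟨q, hq1, hq2⟩ := exists_rat_btwn hb
  exact mem_iUnion.2 ⟨q, hs, hq2,
    measure_mono_null (inter_subset_inter_right _ (Ioo_subset_Ioo_left hq1.le)) h⟩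

/-- There is a chain in `G` that ends at `s` and along which `f` changes its value `k` times. -/
def HasChain {α : Type*} (f : ℝ → α) (G : Set ℝ) : ℕ → ℝ → Prop
  | 0, s => s ∈ G
  | k + 1, s => s ∈ G ∧ ∃ s' < s, HasChain f G k s' ∧ f s' ≠ f s

theorem HasChain.mem {α : Type*} {f : ℝ → α} {G : Set ℝ} {k : ℕ} {s : ℝ} (h : HasChain f G k s) :
    s ∈ G := by
  cases k with
  | zero => exact h
  | succ k => exact h.1

theorem HasChain.of_lt {α : Type*} {f : ℝ → α} {G : Set ℝ} {k : ℕ} {s s' : ℝ}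
    (h : HasChain f G k s') (hs : s ∈ G) (hlt : s' < s) (hf : f s' = f s) : HasChain f G k s := by
  cases k with
  | zero => exact hs
  | succ k =>
    obtain ⟨_, x, hx, hxk, hxf⟩ := h
    exact ⟨hs, x, hx.trans hlt, hxk, hf ▸ hxf⟩

/-- The largest number of changes along a chain ending at `s` is a nondecreasing function of `s`,
and `f` is constant on its level sets. The switching times are the suprema of its sublevel sets;
there the value may belong to either side, so they are excluded. -/
theorem exists_grid_of_chain_bound {α : Type*} {f : ℝ → α} {G : Set ℝ} {T : ℝ} {N : ℕ}
    (hN : ∀ k s, HasChain f G k s → k ≤ N) (hGT : G ⊆ Ioo 0 T) (hne : G.Nonempty)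
    (hleft : ∀ s ∈ G, ∀ b < s, ∃ s' ∈ G, b < s' ∧ s' < s ∧ f s' = f s) :
    ∃ (m : ℕ) (c : Fin (m + 1) → ℝ) (t : Fin m → ℝ), (∀ j, c j ∈ G) ∧
      (∀ j : Fin m, f (c j.castSucc) ≠ f (c j.succ)) ∧ StrictMono (grid T t) ∧
      ∀ s ∈ G, s ∉ range t → ∃ j, (∀ k : Fin m, k.castSucc < j → t k ≤ s) ∧
        (∀ k : Fin m, j ≤ k.castSucc → s < t k) ∧ f s = f (c j) := by
  have hbdd : ∀ s, BddAbove {k | HasChain f G k s} := fun s => ⟨N, fun k hk => hN k s hk⟩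
  set n : ℝ → ℕ := fun s => sSup {k | HasChain f G k s}
  have hn1 : ∀ {s}, s ∈ G → HasChain f G (n s) s := fun {s} hs =>
    Nat.sSup_mem ⟨0, hs⟩ (hbdd s)
  have hn2 : ∀ {k s}, HasChain f G k s → k ≤ n s := fun {k s} h => le_csSup (hbdd s) h
  have hmono : ∀ {x y}, x ∈ G → y ∈ G → x ≤ y → n x ≤ n y := by
    intro x y hx hy hxy
    rcases hxy.eq_or_lt with rfl | hxy
    · rfl
    by_cases h : f x = f y
    · exact hn2 ((hn1 hx).of_lt hy hxy h)
    · exact (Nat.le_succ _).trans (hn2 (k := n x + 1) ⟨hy, x, hxy, hn1 hx, h⟩)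
  have heq : ∀ {x y}, x ∈ G → y ∈ G → n x = n y → f x = f y := by
    have h1 : ∀ {x y}, x ∈ G → y ∈ G → x < y → n x = n y → f x = f y := by
      intro x y hx hy hxy h
      by_contra h2
      have := hn2 (k := n x + 1) ⟨hy, x, hxy, hn1 hx, h2⟩
      omega
    intro x y hx hy h
    rcases lt_trichotomy x y with h2 | h2 | h2
    · exact h1 hx hy h2 h
    · rw [h2]
    · exact (h1 hy hx h2 h.symm).symm
  have hpred : ∀ {s k}, s ∈ G → n s = k + 1 →
      ∃ x ∈ G, x < s ∧ n x = k ∧ HasChain f G k x ∧ f x ≠ f s := by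
    intro s k hs hk
    have h := hn1 hs
    rw [hk] at h
    obtain ⟨_, x, hx, hxk, hxf⟩ := h
    refine ⟨x, hxk.mem, hx, ?_, hxk, hxf⟩
    have h1 := hn2 hxk
    have h2 := hmono hxk.mem hs hx.le
    have h3 : n x ≠ n s := fun h => hxf (heq hxk.mem hs h)
    omega
  obtain ⟨m, ⟨s₀, hs₀, hm⟩, hmax⟩ : ∃ m, (∃ s ∈ G, n s = m) ∧ ∀ s ∈ G, n s ≤ m := by
    have hb : BddAbove (n '' G) := ⟨N, by rintro _ ⟨s, hs, rfl⟩; exact hN _ _ (hn1 hs)⟩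
    exact ⟨sSup (n '' G), Nat.sSup_mem (hne.image n) hb, fun s hs => le_csSup hb ⟨s, hs, rfl⟩⟩
  have hall : ∀ i, i ≤ m → ∃ s ∈ G, n s = i := fun i hi =>
    Nat.decreasingInduction (motive := fun i _ => ∃ s ∈ G, n s = i)
      (fun k _ ⟨s, hs, hk⟩ => by
        obtain ⟨x, hx, _, hxk, _⟩ := hpred hs hk
        exact ⟨x, hx, hxk⟩) ⟨s₀, hs₀, hm⟩ hi
  -- Every level contains two points of `G`, by approach from the left with the same value. This
  -- makes the grid strictly increasing.
  have htwo : ∀ {s}, s ∈ G → ∃ s' ∈ G, s' < s ∧ n s' = n s := by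
    intro s hs
    rcases hk : n s with _ | k
    · obtain ⟨s', hs', _, h2, _⟩ := hleft s hs 0 (hGT hs).1
      have := hmono hs' hs h2.le
      exact ⟨s', hs', h2, by omega⟩
    · obtain ⟨x, hx, hxs, _, hxk, hxf⟩ := hpred hs hk
      obtain ⟨s', hs', h1, h2, h3⟩ := hleft s hs x hxs
      -- The approximating point is taken to the right of the predecessor `x`, so the chain of `s`
      -- can also end in `s'`.
      have h4 := hn2 (k := k + 1) ⟨hs', x, h1, hxk, h3 ▸ hxf⟩
      have := hmono hs' hs h2.le
      exact ⟨s', hs', h2, by omega⟩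
  choose c hcG hcn using fun i : Fin (m + 1) => hall i (Nat.lt_succ_iff.1 i.2)
  set t : Fin m → ℝ := fun j => sSup {s ∈ G | n s ≤ j}
  have htb : ∀ j : Fin m, BddAbove {s ∈ G | n s ≤ j} := fun j => ⟨T, fun s hs => (hGT hs.1).2.le⟩
  have ht1 : ∀ (j : Fin m) {s}, s ∈ G → n s ≤ j → s ≤ t j := fun j s hs h => le_csSup (htb j) ⟨hs, h⟩
  have ht2 : ∀ (j : Fin m) {s}, s ∈ G → j < n s → t j ≤ s := fun j s hs h => by
    refine csSup_le ⟨c j.castSucc, hcG _, by simp [hcn]⟩ fun x hx => ?_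
    by_contra! h2
    have := hmono hs hx.1 h2.le
    have := hx.2
    omega
  refine ⟨m, c, t, hcG, fun j h => ?_, Fin.strictMono_iff_lt_succ.2 fun i => ?_,
    fun s hs hst => ⟨⟨n s, Nat.lt_succ_iff.2 (hmax s hs)⟩, fun k hk => ?_, fun k hk => ?_, ?_⟩⟩
  · obtain ⟨x, hx, _, hxk, _, hxf⟩ := hpred (hcG j.succ) (k := j) (by simp [hcn])
    exact hxf ((heq hx (hcG j.castSucc) (by simp [hxk, hcn])).trans h)
  · obtain ⟨s', hs', hlt, hn'⟩ := htwo (hcG i)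
    rw [hcn] at hn'
    refine lt_of_le_of_lt (b := s') ?_ (lt_of_lt_of_le hlt ?_)
    · induction i using Fin.cases with
      | zero => exact (hGT hs').1.le
      | succ j =>
        rw [grid_succ_castSucc]
        exact ht2 j hs' (by simp [hn'])
    · induction i using Fin.lastCases with
      | last =>
        rw [Fin.succ_last, grid_last]
        exact (hGT (hcG _)).2.le
      | cast j =>
        rw [grid_castSucc_succ]
        exact ht1 j (hcG _) (by simp [hcn])
  · exact ht2 k hs (by simpa [Fin.lt_def] using hk)
  · exact lt_of_le_of_ne (ht1 k hs (by simpa [Fin.le_def] using hk)) fun h => hst ⟨k, h.symm⟩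
  · exact heq hs (hcG _) (by simp [hcn])

theorem toReal_injective {M : ℕ} : Function.Injective (toReal (M := M)) := fun a b h =>
  funext fun i => by simpa [toReal] using congrFun h i

/-- Some coordinate differs by a nonzero integer, and the norm dominates every coordinate. -/
theorem one_le_pNorm_toReal_sub {M : ℕ} {p : ℝ≥0∞} (hp : 1 ≤ p) {a b : Fin M → ℤ} (h : a ≠ b) :
    1 ≤ pNorm p (toReal a - toReal b) := by
  have : Fact (1 ≤ p) := ⟨hp⟩
  obtain ⟨i, hi⟩ := Function.ne_iff.1 h
  refine le_trans ?_ (PiLp.norm_apply_le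
    (WithLp.toLp p (toReal a - toReal b) : PiLp p (fun _ : Fin M => ℝ)) i)
  have h1 : (1 : ℤ) ≤ |a i - b i| := Int.one_le_abs (sub_ne_zero.2 hi)
  have h2 : (1 : ℝ) ≤ ((|a i - b i| : ℤ) : ℝ) := by exact_mod_cast h1
  simpa [toReal] using h2

/-- Each change of value adds a pair to the right of the part already counted, at distance at least
one. -/
theorem HasChain.le_eVariationOn {α E : Type*} [PseudoEMetricSpace E] {f : ℝ → α} {F : ℝ → E}
    {G : Set ℝ} (hF : ∀ x ∈ G, ∀ y ∈ G, f x ≠ f y → 1 ≤ edist (F x) (F y)) {k : ℕ} {s : ℝ}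
    (h : HasChain f G k s) : (k : ℝ≥0∞) ≤ eVariationOn F (G ∩ Iic s) := by
  induction k generalizing s with
  | zero => simp
  | succ k ih =>
    obtain ⟨hs, x, hx, hxk, hxf⟩ := h
    push_cast
    calc (k : ℝ≥0∞) + 1 ≤ eVariationOn F (G ∩ Iic x) + eVariationOn F {x, s} := by
          rw [eVariationOn.pair]
          exact add_le_add (ih hxk) (hF _ hxk.mem _ hs hxf)
      _ ≤ eVariationOn F (G ∩ Iic x ∪ {x, s}) := by
          refine eVariationOn.add_le_union F fun y hy z hz => ?_
          rcases hz with rfl | rfl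
          · exact hy.2
          · exact le_trans hy.2 hx.le
      _ ≤ eVariationOn F (G ∩ Iic s) := by
          refine eVariationOn.mono F (union_subset ?_ ?_)
          · exact inter_subset_inter_right _ (Iic_subset_Iic.2 hx.le)
          · rintro y (rfl | rfl)
            · exact ⟨hxk.mem, hx.le⟩
            · exact ⟨hs, mem_Iic.2 le_rfl⟩

theorem exists_isMinimalRepresentation {M : ℕ} {T : ℝ} (hT : 0 < T) {V : Finset (Fin M → ℤ)}
    {u : ControlSpace M T} (hu : u ∈ admissible T V) :
    ∃ (m : ℕ) (a : Fin (m + 1) → Fin M → ℤ) (t : Fin m → ℝ),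
      IsMinimalRepresentation V u a t := by
  set f : ℝ → Fin M → ℝ := fun s => (u s).ofLp
  set D : (Fin M → ℤ) → Set ℝ := fun ν => {s ∈ Ioo 0 T | IsRegularPoint u s ∧ f s = toReal ν}
  -- The points that their own level set does not charge from the left form a null set. Without them
  -- every remaining point has earlier remaining points of the same value arbitrarily close to it.
  set B : (Fin M → ℤ) → Set ℝ := fun ν => {s ∈ D ν | ∃ b < s, volume (D ν ∩ Ioo b s) = 0}
  have hB : ∀ ν, volume (B ν) = 0 := fun ν => ae_left_density (D ν)
  set G : Set ℝ := {s | ∃ ν ∈ V, s ∈ D ν \ B ν}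
  have hGT : G ⊆ Ioo 0 T := fun s ⟨ν, _, hs⟩ => hs.1.1
  have hGae : ∀ᵐ s ∂(volume : Measure ℝ).restrict (Ioo 0 T), s ∈ G := by
    have hB' : ∀ᵐ s ∂(volume : Measure ℝ).restrict (Ioo 0 T), ∀ ν ∈ V, s ∉ B ν :=
      (ae_ball_iff V.countable_toSet).2 fun ν _ =>
        ae_restrict_of_ae (measure_eq_zero_iff_ae_notMem.1 (hB ν))
    filter_upwards [hB', hu.2, ae_isRegularPoint u, ae_restrict_mem measurableSet_Ioo]
      with s h1 ⟨ν, hν, h2⟩ h3 h4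
    exact ⟨ν, hν, ⟨h4, h3, h2⟩, h1 ν hν⟩
  have hleft : ∀ s ∈ G, ∀ b < s, ∃ s' ∈ G, b < s' ∧ s' < s ∧ f s' = f s := by
    rintro s ⟨ν, hν, hs, hsB⟩ b hb
    have h1 : volume (D ν ∩ Ioo b s) ≠ 0 := fun h => hsB ⟨hs, b, hb, h⟩
    obtain ⟨s', hs', hs'B⟩ : ((D ν ∩ Ioo b s) \ B ν).Nonempty := by
      refine nonempty_of_measure_ne_zero (μ := volume) ?_
      rwa [measure_sdiff_null (hB ν)]
    exact ⟨s', ⟨ν, hν, hs'.1, hs'B⟩, hs'.2.1, hs'.2.2, hs'.1.2.2.trans hs.2.2.symm⟩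
  have hne : G.Nonempty := by
    have : (ae ((volume : Measure ℝ).restrict (Ioo 0 T))).NeBot := by
      rw [ae_neBot]
      simpa using hT
    exact hGae.exists
  obtain ⟨N, hN⟩ := ENNReal.exists_nat_gt hu.1.ne
  have hchain : ∀ k s, HasChain f G k s → k ≤ N := by
    intro k s h
    have h1 : (k : ℝ≥0∞) ≤ eVariationOn
        (fun s => (WithLp.toLp 2 (u s).ofLp : PiLp 2 (fun _ : Fin M => ℝ))) (G ∩ Iic s) := by
      refine h.le_eVariationOn ?_
      rintro x ⟨ν, _, hx⟩ y ⟨ν', _, hy⟩ hxy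
      rw [edist_dist, dist_eq_norm, ENNReal.one_le_ofReal]
      have h2 := one_le_pNorm_toReal_sub (p := 2) one_le_two (a := ν) (b := ν') (by
        rintro rfl
        exact hxy (hx.1.2.2.trans hy.1.2.2.symm))
      rw [← hx.1.2.2, ← hy.1.2.2] at h2
      exact h2
    have h3 := eVariationOn_le_TV (p := 2) u (G := G) fun x ⟨ν, _, hx⟩ => ⟨hx.1.1, hx.1.2.1⟩
    have h4 := (h1.trans (eVariationOn.mono _ inter_subset_left)).trans h3
    exact_mod_cast (h4.trans hN.le)
  obtain ⟨m, c, t, hc, hcne, hmono, hst⟩ := exists_grid_of_chain_bound hchain hGT hne hleft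
  choose a ha hac using fun j => hc j
  have hfa : ∀ j, f (c j) = toReal (a j) := fun j => (hac j).1.2.2
  refine ⟨m, a, t, hmono, ha, fun j h => hcne j (by rw [hfa, hfa, h]), ?_⟩
  have ht : ∀ᵐ s ∂(volume : Measure ℝ).restrict (Ioo 0 T), s ∉ range t :=
    ae_restrict_of_ae (measure_eq_zero_iff_ae_notMem.1 ((finite_range t).measure_zero _))
  filter_upwards [hGae, ht, ae_restrict_mem measurableSet_Ioo] with s hs hst' hsT
  obtain ⟨j, h1, h2, h3⟩ := hst s hs hst'
  rw [stepFunction_eq_jumpForm hmono.monotone a hsT, jumpForm_eq a j h1 h2, ← hfa, ← h3]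

/-! ### Expansion of the objective along perturbations near the switching times -/

/-- Second-order Taylor expansion with Peano remainder. -/
theorem taylor_two {E : Type*} [NormedAddCommGroup E] [NormedSpace ℝ E] {F : E → ℝ}
    (hF : Differentiable ℝ F) (hF' : Differentiable ℝ (fderiv ℝ F)) (u : E) {ε : ℝ} (hε : 0 < ε) :
    ∃ r > 0, ∀ v, ‖v‖ < r →
      |F (u + v) - F u - fderiv ℝ F u v - 1 / 2 * fderiv ℝ (fderiv ℝ F) u v v| ≤ ε * ‖v‖ ^ 2 := by
  set A := fderiv ℝ (fderiv ℝ F) u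
  have hA : HasFDerivAt (fderiv ℝ F) A u := (hF' u).hasFDerivAt
  have hsymm : ∀ v w, A v w = A w v :=
    second_derivative_symmetric (fun y => (hF y).hasFDerivAt) hA
  obtain ⟨r, hr, hr'⟩ := Metric.eventually_nhds_iff.1 (hA.isLittleO.def hε)
  refine ⟨r, hr, fun v hv => ?_⟩
  -- By symmetry of the second derivative, the derivative of the Taylor remainder is the remainder
  -- of the first-order expansion of `fderiv ℝ F`. The mean value inequality on a ball then supplies
  -- the second factor of the norm.
  set φ : E → ℝ := fun v => F (u + v) - F u - fderiv ℝ F u v - 1 / 2 * A v v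
  have hφ : ∀ v, HasFDerivAt φ (fderiv ℝ F (u + v) - fderiv ℝ F u - A v) v := fun v => by
    have h1 : HasFDerivAt (fun v => F (u + v)) (fderiv ℝ F (u + v)) v :=
      (hasFDerivAt_comp_add_left u).2 (hF (u + v)).hasFDerivAt
    have h2 := (A.hasFDerivAt (x := v)).clm_apply (hasFDerivAt_id v)
    refine (((h1.sub_const (F u)).sub (fderiv ℝ F u).hasFDerivAt).sub
      (h2.const_mul (1 / 2))).congr_fderiv ?_
    ext w
    simp [hsymm w v]
    ring
  have hb : ∀ x ∈ Metric.closedBall (0 : E) ‖v‖,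
      ‖fderiv ℝ F (u + x) - fderiv ℝ F u - A x‖ ≤ ε * ‖v‖ := fun x hx => by
    have hx' : ‖x‖ ≤ ‖v‖ := by simpa using hx
    have := hr' (y := u + x) (by simpa using hx'.trans_lt hv)
    simp only [add_sub_cancel_left] at this
    exact this.trans (mul_le_mul_of_nonneg_left hx' hε.le)
  have := (convex_closedBall (0 : E) ‖v‖).norm_image_sub_le_of_norm_hasFDerivWithin_le
    (fun x _ => (hφ x).hasFDerivWithinAt) hb (x := 0) (y := v) (by simp) (by simp)
  have h0 : φ 0 = 0 := by simp [φ]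
  rw [h0, sub_zero, sub_zero, Real.norm_eq_abs] at this
  calc _ ≤ ε * ‖v‖ * ‖v‖ := this
    _ = ε * ‖v‖ ^ 2 := by ring

theorem integrable_toLp_smul {M : ℕ} {θ : ℝ → ℝ} {μ : Measure ℝ} (hθ : Integrable θ μ)
    (v : Fin M → ℝ) :
    Integrable (fun s => (WithLp.toLp 1 (θ s • v) : PiLp 1 (fun _ : Fin M => ℝ))) μ := by
  simp_rw [WithLp.toLp_smul]
  exact hθ.smul_const _

/-- The control `s ↦ θ(s) v`. -/
noncomputable def scaledControl {M : ℕ} (T : ℝ) {θ : ℝ → ℝ} (hθ : Integrable θ)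
    (v : Fin M → ℝ) : ControlSpace M T :=
  (integrable_toLp_smul (hθ.restrict (s := Ioo 0 T)) v).toL1 _

theorem scaledControl_ae {M : ℕ} {T : ℝ} {θ : ℝ → ℝ} (hθ : Integrable θ) (v : Fin M → ℝ) :
    ∀ᵐ s ∂(volume : Measure ℝ).restrict (Ioo 0 T),
      (scaledControl T hθ v s).ofLp = θ s • v := by
  filter_upwards [(integrable_toLp_smul (hθ.restrict (s := Ioo 0 T)) v).coeFn_toL1] with s hs
  rw [scaledControl, hs]

theorem sum_scaledControl_ae {M m : ℕ} {T : ℝ} {θ : Fin m → ℝ → ℝ} (hθ : ∀ j, Integrable (θ j))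
    (v : Fin m → Fin M → ℝ) : ∀ᵐ s ∂(volume : Measure ℝ).restrict (Ioo 0 T),
      ((∑ j, scaledControl T (hθ j) (v j) : ControlSpace M T) s).ofLp = ∑ j, θ j s • v j := by
  filter_upwards [Lp.coeFn_finsetSum Finset.univ fun j => scaledControl T (hθ j) (v j),
    ae_all_iff.2 fun j => scaledControl_ae (T := T) (hθ j) (v j)] with s h1 h2
  rw [h1, Finset.sum_apply, WithLp.ofLp_sum]
  exact Finset.sum_congr rfl fun j _ => h2 j

theorem norm_control_eq {M : ℕ} {T : ℝ} (w : ControlSpace M T) :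
    ‖w‖ = ∫ s in Ioo 0 T, pNorm 1 (w s).ofLp := L1.norm_eq_integral_norm w

theorem pNorm_smul {M : ℕ} {p : ℝ≥0∞} (hp : 1 ≤ p) (r : ℝ) (v : Fin M → ℝ) :
    pNorm p (r • v) = |r| * pNorm p v := by
  have : Fact (1 ≤ p) := ⟨hp⟩
  rw [pNorm, WithLp.toLp_smul]
  exact norm_smul r _

theorem norm_scaledControl_le {M : ℕ} {T : ℝ} {θ : ℝ → ℝ} (hθ : Integrable θ)
    (v : Fin M → ℝ) : ‖scaledControl T hθ v‖ ≤ pNorm 1 v * ∫ s, |θ s| := by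
  have : ‖scaledControl T hθ v‖ = (∫ s in Ioo 0 T, |θ s|) * pNorm 1 v := by
    rw [norm_control_eq, ← integral_mul_const]
    refine integral_congr_ae ?_
    filter_upwards [scaledControl_ae hθ v] with s hs
    rw [hs, pNorm_smul le_rfl]
  rw [this, mul_comm]
  exact mul_le_mul_of_nonneg_left
    (setIntegral_le_integral hθ.abs (Eventually.of_forall fun s => abs_nonneg _))
    (pNorm_nonneg le_rfl v)

/-- A perturbation profile supported near `t`, nonpositive left of `t`, nonnegative right
of `t`, and with values of modulus at most one. -/
structure IsShiftProfile (t ρ : ℝ) (θ : ℝ → ℝ) : Prop where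
  integrable : Integrable θ
  eq_zero : ∀ s, ρ ≤ |s - t| → θ s = 0
  abs_le_one : ∀ᵐ s, |θ s| ≤ 1
  sign : ∀ᵐ s, 0 ≤ θ s * (s - t)

theorem IsShiftProfile.abs_le_indicator {t ρ : ℝ} {θ : ℝ → ℝ} (h : IsShiftProfile t ρ θ) :
    ∀ᵐ s, |θ s| ≤ (Ioo (t - ρ) (t + ρ)).indicator (fun _ => (1 : ℝ)) s := by
  filter_upwards [h.abs_le_one] with s hs
  by_cases hst : ρ ≤ |s - t|
  · rw [h.eq_zero s hst, abs_zero]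
    exact indicator_nonneg (fun _ _ => zero_le_one) s
  · rw [indicator_of_mem]
    · exact hs
    · have := abs_lt.1 (not_le.1 hst)
      constructor <;> linarith

theorem IsShiftProfile.integral_abs_le {t ρ : ℝ} {θ : ℝ → ℝ} (h : IsShiftProfile t ρ θ)
    (hρ : 0 ≤ ρ) : ∫ s, |θ s| ≤ 2 * ρ := by
  have h1 : Integrable ((Ioo (t - ρ) (t + ρ)).indicator (fun _ => (1 : ℝ))) :=
    (integrable_indicator_iff measurableSet_Ioo).2 (integrableOn_const (by simp))
  refine (integral_mono_ae h.integrable.abs h1 h.abs_le_indicator).trans_eq ?_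
  rw [integral_indicator measurableSet_Ioo]
  simp
  rw [max_eq_left (by linarith)]
  ring

theorem IsShiftProfile.integrable_mul_sub {t ρ : ℝ} {θ : ℝ → ℝ} (h : IsShiftProfile t ρ θ) :
    Integrable fun s => θ s * (s - t) := by
  refine Integrable.mono' (h.integrable.abs.mul_const ρ)
    (h.integrable.aestronglyMeasurable.mul (by fun_prop)) (Eventually.of_forall fun s => ?_)
  rw [norm_mul, Real.norm_eq_abs, Real.norm_eq_abs]
  by_cases hst : ρ ≤ |s - t|
  · simp [h.eq_zero s hst]
  · exact mul_le_mul_of_nonneg_left (not_le.1 hst).le (abs_nonneg _)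

theorem IsShiftProfile.mem_of_ne_zero {t ρ : ℝ} {θ : ℝ → ℝ} (h : IsShiftProfile t ρ θ) {s : ℝ}
    (hs : θ s ≠ 0) : |s - t| < ρ := by
  by_contra! h'
  exact hs (h.eq_zero s h')

theorem IsShiftProfile.abs_mul {t ρ : ℝ} {θ : ℝ → ℝ} (h : IsShiftProfile t ρ θ) :
    ∀ᵐ s, |θ s| * |s - t| = θ s * (s - t) := by
  filter_upwards [h.sign] with s hs
  rw [← _root_.abs_mul, abs_of_nonneg hs]

theorem IsShiftProfile.setIntegral_eq {T t ρ : ℝ} {θ : ℝ → ℝ} (h : IsShiftProfile t ρ θ)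
    (h0 : ρ ≤ t) (hT : t + ρ ≤ T) {f : ℝ → ℝ} (hf : ∀ s, θ s = 0 → f s = 0) :
    ∫ s in Ioo 0 T, f s = ∫ s, f s := by
  refine setIntegral_eq_integral_of_forall_compl_eq_zero fun s hs => hf s ?_
  by_contra h1
  have := abs_lt.1 (h.mem_of_ne_zero h1)
  exact hs ⟨by linarith, by linarith⟩

/-- The sign condition makes `|θ s| * |s - t|` equal to `θ s * (s - t)`, so the linearisation error
is controlled by the first moment itself. -/
theorem IsShiftProfile.abs_setIntegral_mul_sub_le {T t ρ c ε : ℝ} {θ f : ℝ → ℝ}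
    (h : IsShiftProfile t ρ θ) (h0 : ρ ≤ t) (hT : t + ρ ≤ T)
    (hfc : ContinuousOn f (Icc 0 T))
    (hf : ∀ s, |s - t| < ρ → |f s - c * (s - t)| ≤ ε * |s - t|) :
    |(∫ s in Ioo 0 T, θ s * f s) - c * ∫ s, θ s * (s - t)| ≤ ε * ∫ s, θ s * (s - t) := by
  have hX := h.integrable_mul_sub
  have h1 : ∀ᵐ s ∂volume.restrict (Ioo 0 T),
      ‖θ s * (f s - c * (s - t))‖ ≤ ε * (θ s * (s - t)) := by
    filter_upwards [ae_restrict_of_ae h.abs_mul] with s hs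
    by_cases hθ : θ s = 0
    · simp [hθ]
    · rw [norm_mul, Real.norm_eq_abs, Real.norm_eq_abs, ← hs]
      calc _ ≤ |θ s| * (ε * |s - t|) :=
            mul_le_mul_of_nonneg_left (hf s (h.mem_of_ne_zero hθ)) (abs_nonneg _)
        _ = _ := by ring
  have hi : IntegrableOn (fun s => θ s * (f s - c * (s - t))) (Ioo 0 T) := by
    refine Integrable.mono' (hX.restrict.const_mul ε) ?_ h1
    exact h.integrable.aestronglyMeasurable.restrict.mul
      (((hfc.mono Ioo_subset_Icc_self).aestronglyMeasurable measurableSet_Ioo).sub (by fun_prop))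
  have h2 : (∫ s in Ioo 0 T, θ s * f s) - c * ∫ s, θ s * (s - t) =
      ∫ s in Ioo 0 T, θ s * (f s - c * (s - t)) := by
    rw [← h.setIntegral_eq h0 hT (f := fun s => θ s * (s - t)) (fun s hs => by simp [hs]),
      ← integral_const_mul, sub_eq_iff_eq_add, ← integral_add hi (hX.restrict.const_mul c)]
    congr 1
    ext s
    ring
  rw [h2, ← h.setIntegral_eq h0 hT (f := fun s => θ s * (s - t)) (fun s hs => by simp [hs]),
    ← integral_const_mul]
  exact norm_integral_le_of_norm_le (hX.restrict.const_mul ε) h1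

/-- The kernel is replaced by its value `c` at the pair of switching times, from which it differs by
at most `ε` wherever both profiles are nonzero. -/
theorem abs_integral_integral_sub_le {T t t' ρ ρ' c ε : ℝ} {θ θ' : ℝ → ℝ} {K : ℝ → ℝ → ℝ}
    (h : IsShiftProfile t ρ θ) (h0 : ρ ≤ t) (hT : t + ρ ≤ T)
    (h' : IsShiftProfile t' ρ' θ') (h0' : ρ' ≤ t') (hT' : t' + ρ' ≤ T)
    (hKc : ContinuousOn (fun z : ℝ × ℝ => K z.1 z.2) (Icc 0 T ×ˢ Icc 0 T))
    (hK : ∀ r s, |r - t| < ρ → |s - t'| < ρ' → |K r s - c| ≤ ε) :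
    |(∫ s in Ioo 0 T, ∫ r in Ioo 0 T, θ r * θ' s * K r s) - c * (∫ s, θ s) * ∫ s, θ' s| ≤
      ε * (∫ s, |θ s|) * ∫ s, |θ' s| := by
  set ν := (volume : Measure ℝ).restrict (Ioo 0 T)
  have e1 : ∫ s, θ s = ∫ s, θ s ∂ν := (h.setIntegral_eq h0 hT (fun s hs => hs)).symm
  have e2 : ∫ s, θ' s = ∫ s, θ' s ∂ν := (h'.setIntegral_eq h0' hT' (fun s hs => hs)).symm
  have e3 : ∫ s, |θ s| = ∫ s, |θ s| ∂ν :=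
    (h.setIntegral_eq h0 hT (fun s hs => by simp [hs])).symm
  have e4 : ∫ s, |θ' s| = ∫ s, |θ' s| ∂ν :=
    (h'.setIntegral_eq h0' hT' (fun s hs => by simp [hs])).symm
  rw [e1, e2, e3, e4]
  -- The outer variable `s` is the first coordinate of the product, hence the swapped arguments of
  -- `K`.
  have hi : Integrable (fun z : ℝ × ℝ => θ' z.1 * θ z.2) (ν.prod ν) :=
    Integrable.mul_prod h'.integrable.restrict h.integrable.restrict
  have hKm : AEStronglyMeasurable (fun z : ℝ × ℝ => K z.2 z.1) (ν.prod ν) := by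
    rw [Measure.prod_restrict]
    refine ContinuousOn.aestronglyMeasurable ?_ (measurableSet_Ioo.prod measurableSet_Ioo)
    exact hKc.comp (f := fun z : ℝ × ℝ => (z.2, z.1)) (by fun_prop)
      fun z hz => ⟨Ioo_subset_Icc_self hz.2, Ioo_subset_Icc_self hz.1⟩
  have hb : ∀ z : ℝ × ℝ, ‖θ' z.1 * θ z.2 * (K z.2 z.1 - c)‖ ≤ ε * (|θ' z.1| * |θ z.2|) := by
    intro z
    by_cases h1 : θ z.2 = 0
    · simp [h1]
    by_cases h2 : θ' z.1 = 0
    · simp [h2]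
    rw [norm_mul, norm_mul, Real.norm_eq_abs, Real.norm_eq_abs, Real.norm_eq_abs, mul_comm]
    exact mul_le_mul_of_nonneg_right
      (hK _ _ (h.mem_of_ne_zero h1) (h'.mem_of_ne_zero h2)) (by positivity)
  have hi2 : Integrable (fun z : ℝ × ℝ => ε * (|θ' z.1| * |θ z.2|)) (ν.prod ν) :=
    (Integrable.mul_prod h'.integrable.restrict.abs h.integrable.restrict.abs).const_mul ε
  have hi3 : Integrable (fun z : ℝ × ℝ => θ' z.1 * θ z.2 * (K z.2 z.1 - c)) (ν.prod ν) :=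
    Integrable.mono' hi2 (hi.aestronglyMeasurable.mul (hKm.sub aestronglyMeasurable_const))
      (Eventually.of_forall hb)
  have hi4 : Integrable (fun z : ℝ × ℝ => θ z.2 * θ' z.1 * K z.2 z.1) (ν.prod ν) := by
    refine (hi3.add (hi.mul_const c)).congr (Eventually.of_forall fun z => ?_)
    simp only [Pi.add_apply]
    ring
  have e5 : (∫ s, ∫ r, θ r * θ' s * K r s ∂ν ∂ν) - c * (∫ s, θ s ∂ν) * ∫ s, θ' s ∂ν =
      ∫ z, θ' z.1 * θ z.2 * (K z.2 z.1 - c) ∂ν.prod ν := by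
    have e6 := integral_prod _ hi4
    have e7 : ∫ z, θ' z.1 * θ z.2 ∂ν.prod ν = (∫ s, θ' s ∂ν) * ∫ s, θ s ∂ν :=
      integral_prod_mul θ' θ
    rw [← e6, mul_assoc, mul_comm (∫ s, θ s ∂ν), ← e7, ← integral_const_mul,
      ← integral_sub hi4 (hi.const_mul c)]
    congr 1
    ext z
    ring
  rw [e5]
  refine (norm_integral_le_of_norm_le hi2 (Eventually.of_forall hb)).trans_eq ?_
  rw [integral_const_mul, integral_prod_mul (fun s => |θ' s|) fun s => |θ s|]
  ring

theorem IsGradient.fderiv_scaledControl {M : ℕ} {T : ℝ} {F : ControlSpace M T → ℝ}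
    {u : ControlSpace M T} {g : ℝ → Fin M → ℝ} (hg : IsGradient F u g) {θ : ℝ → ℝ}
    (hθ : Integrable θ) (v : Fin M → ℝ) :
    fderiv ℝ F u (scaledControl T hθ v) = ∫ s in Ioo 0 T, θ s * (v ⬝ᵥ g s) := by
  rw [hg]
  refine integral_congr_ae ?_
  filter_upwards [scaledControl_ae hθ v] with s hs
  rw [hs, dotProduct_smul, dotProduct_comm, smul_eq_mul]

theorem IsHessian.fderiv_scaledControl {M : ℕ} {T : ℝ} {F : ControlSpace M T → ℝ}
    {u : ControlSpace M T} {H : ℝ → ℝ → Matrix (Fin M) (Fin M) ℝ} (hH : IsHessian F u H)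
    {θ θ' : ℝ → ℝ} (hθ : Integrable θ) (hθ' : Integrable θ') (v v' : Fin M → ℝ) :
    fderiv ℝ (fderiv ℝ F) u (scaledControl T hθ v) (scaledControl T hθ' v') =
      ∫ s in Ioo 0 T, ∫ r in Ioo 0 T, θ r * θ' s * (v ⬝ᵥ (H r s *ᵥ v')) := by
  rw [hH]
  refine integral_congr_ae ?_
  filter_upwards [scaledControl_ae hθ' v'] with s hs
  refine integral_congr_ae ?_
  filter_upwards [scaledControl_ae hθ v] with r hr
  rw [hs, hr, Matrix.mulVec_smul, smul_dotProduct, dotProduct_smul, smul_eq_mul, smul_eq_mul,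
    mul_assoc]

theorem hasDerivAt_of_contDiffOn {M : ℕ} {T : ℝ} {g : ℝ → Fin M → ℝ}
    (hg : ContDiffOn ℝ 1 g (Icc 0 T)) (v : Fin M → ℝ) {t : ℝ} (ht : t ∈ Ioo 0 T) :
    HasDerivAt (fun s => v ⬝ᵥ g s) (v ⬝ᵥ derivWithin g (Icc 0 T) t) t :=
  hasDerivAt_dotProduct (((hg.differentiableOn one_ne_zero) t
    (Ioo_subset_Icc_self ht)).hasDerivWithinAt.hasDerivAt (Icc_mem_nhds ht.1 ht.2)) v

theorem continuousOn_dotProduct {X : Type*} [TopologicalSpace X] {M : ℕ} {f : X → Fin M → ℝ}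
    {s : Set X} (hf : ContinuousOn f s) (v : Fin M → ℝ) : ContinuousOn (fun x => v ⬝ᵥ f x) s :=
  (Continuous.dotProduct continuous_const continuous_id).comp_continuousOn hf

theorem eventually_abs_sub_le {f : ℝ → ℝ} {c t ε : ℝ} (hf : HasDerivAt f c t) (h0 : f t = 0)
    (hε : 0 < ε) :
    ∀ᶠ ρ in 𝓝[>] (0 : ℝ), ∀ s, |s - t| < ρ → |f s - c * (s - t)| ≤ ε * |s - t| := by
  obtain ⟨r, hr, h⟩ := Metric.eventually_nhds_iff.1 (hf.isLittleO.def hε)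
  filter_upwards [Ioo_mem_nhdsGT hr] with ρ hρ s hs
  have := h (y := s) (by rw [Real.dist_eq]; exact hs.trans hρ.2)
  simpa [h0, mul_comm] using this

theorem eventually_abs_kernel_sub_le {K : ℝ × ℝ → ℝ} {t t' ε : ℝ} (hK : ContinuousAt K (t, t'))
    (hε : 0 < ε) :
    ∀ᶠ ρ in 𝓝[>] (0 : ℝ), ∀ r s, |r - t| < ρ → |s - t'| < ρ → |K (r, s) - K (t, t')| ≤ ε := by
  obtain ⟨δ, hδ, h⟩ := Metric.continuousAt_iff.1 hK ε hε
  filter_upwards [Ioo_mem_nhdsGT hδ] with ρ hρ r s hr hs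
  refine (h (x := (r, s)) ?_).le
  rw [Prod.dist_eq, Real.dist_eq, Real.dist_eq]
  exact max_lt (hr.trans hρ.2) (hs.trans hρ.2)

/-- Second-order expansion of the objective along perturbations concentrated at the switching
times. -/
theorem expansion {M m : ℕ} {T : ℝ} {F : ControlSpace M T → ℝ} (hF : Differentiable ℝ F)
    (hF' : Differentiable ℝ (fderiv ℝ F)) {u : ControlSpace M T} {g : ℝ → Fin M → ℝ}
    (hg : IsGradient F u g) (hg_smooth : ContDiffOn ℝ 1 g (Icc 0 T))
    {H : ℝ → ℝ → Matrix (Fin M) (Fin M) ℝ} (hH : IsHessian F u H)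
    (hH_cont : ContinuousOn (fun x : ℝ × ℝ => H x.1 x.2) (Icc 0 T ×ˢ Icc 0 T))
    {t : Fin m → ℝ} (ht : ∀ j, t j ∈ Ioo 0 T) {μ : Fin m → Fin M → ℝ}
    (h0 : ∀ j, μ j ⬝ᵥ g (t j) = 0) {ε : ℝ} (hε : 0 < ε) :
    ∀ᶠ ρ in 𝓝[>] (0 : ℝ), ∀ (θ : Fin m → ℝ → ℝ) (hθ : ∀ j, IsShiftProfile (t j) ρ (θ j)),
      |F (u + ∑ j, scaledControl T (hθ j).integrable (μ j)) - F u
        - ∑ j, (μ j ⬝ᵥ derivWithin g (Icc 0 T) (t j)) * (∫ s, θ j s * (s - t j))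
        - 1 / 2 * ∑ j, ∑ k, (μ j ⬝ᵥ (H (t j) (t k) *ᵥ μ k)) * (∫ s, θ j s) * (∫ s, θ k s)| ≤
      ε * (∑ j, (∫ s, θ j s * (s - t j)) + (∑ j, ∫ s, |θ j s|) ^ 2) := by
  set C := ∑ j, pNorm 1 (μ j)
  have hμ0 : ∀ j, 0 ≤ pNorm 1 (μ j) := fun j => pNorm_nonneg le_rfl _
  have hC0 : 0 ≤ C := Finset.sum_nonneg fun j _ => hμ0 j
  -- The norm of the perturbation is at most `C` times the total mass of the profiles, so the Taylor
  -- remainder uses half of `ε`; the other half goes to the Hessian term with its factor 1/2.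
  have hεT : 0 < ε / (2 * (C ^ 2 + 1)) := by positivity
  obtain ⟨r, hr, htaylor⟩ := taylor_two hF hF' u hεT
  have hKc : ∀ j k, ContinuousOn (fun z : ℝ × ℝ => μ j ⬝ᵥ (H z.1 z.2 *ᵥ μ k))
      (Icc 0 T ×ˢ Icc 0 T) := fun j k =>
    continuousOn_dotProduct ((Continuous.matrix_mulVec continuous_id continuous_const).comp_continuousOn hH_cont) _
  have e1 : ∀ᶠ ρ in 𝓝[>] (0 : ℝ), ∀ j, ∀ s, |s - t j| < ρ →
      |μ j ⬝ᵥ g s - (μ j ⬝ᵥ derivWithin g (Icc 0 T) (t j)) * (s - t j)| ≤ ε * |s - t j| :=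
    eventually_all.2 fun j =>
      eventually_abs_sub_le (hasDerivAt_of_contDiffOn hg_smooth (μ j) (ht j)) (h0 j) hε
  have e2 : ∀ᶠ ρ in 𝓝[>] (0 : ℝ), ∀ j k, ∀ r s, |r - t j| < ρ → |s - t k| < ρ →
      |μ j ⬝ᵥ (H r s *ᵥ μ k) - μ j ⬝ᵥ (H (t j) (t k) *ᵥ μ k)| ≤ ε :=
    eventually_all.2 fun j => eventually_all.2 fun k =>
      eventually_abs_kernel_sub_le ((hKc j k).continuousAt
        (prod_mem_nhds (Icc_mem_nhds (ht j).1 (ht j).2) (Icc_mem_nhds (ht k).1 (ht k).2))) hε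
  have e3 : ∀ᶠ ρ in 𝓝[>] (0 : ℝ), ∀ j, ρ ≤ t j ∧ t j + ρ ≤ T := eventually_all.2 fun j => by
    filter_upwards [Ioo_mem_nhdsGT (ht j).1, Ioo_mem_nhdsGT (sub_pos.2 (ht j).2)] with ρ h1 h2
    exact ⟨h1.2.le, by linarith [h2.2]⟩
  -- This bound on `ρ` keeps the perturbation, of norm at most `2 * C * ρ`, inside the Taylor ball.
  filter_upwards [e1, e2, e3, Ioo_mem_nhdsGT (show 0 < r / (2 * C + 1) by positivity)]
    with ρ hρ1 hρ2 hρ3 hρ4 θ hθ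
  set δ : Fin m → ControlSpace M T := fun j => scaledControl T (hθ j).integrable (μ j)
  set X : Fin m → ℝ := fun j => ∫ s, θ j s * (s - t j)
  set τ : Fin m → ℝ := fun j => ∫ s, θ j s
  set n : Fin m → ℝ := fun j => ∫ s, |θ j s|
  have hn0 : ∀ j, 0 ≤ n j := fun j => integral_nonneg fun s => abs_nonneg _
  have hδ : ‖∑ j, δ j‖ ≤ ∑ j, pNorm 1 (μ j) * n j :=
    norm_sum_le_of_le _ fun j _ => norm_scaledControl_le _ _
  have hδ1 : ‖∑ j, δ j‖ ≤ C * ∑ j, n j := by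
    refine hδ.trans ?_
    rw [Finset.mul_sum]
    exact Finset.sum_le_sum fun j _ => mul_le_mul_of_nonneg_right
      (Finset.single_le_sum (fun j _ => hμ0 j) (Finset.mem_univ j)) (hn0 j)
  have hδ2 : ‖∑ j, δ j‖ < r := by
    calc ‖∑ j, δ j‖ ≤ ∑ j, pNorm 1 (μ j) * (2 * ρ) := hδ.trans (Finset.sum_le_sum fun j _ =>
          mul_le_mul_of_nonneg_left ((hθ j).integral_abs_le hρ4.1.le) (hμ0 j))
      _ = ρ * (2 * C) := by rw [← Finset.sum_mul]; ring
      _ < ρ * (2 * C + 1) := mul_lt_mul_of_pos_left (by linarith) hρ4.1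
      _ < r := (lt_div_iff₀ (by positivity)).1 hρ4.2
  have hT1 := htaylor _ hδ2
  have h1 : |fderiv ℝ F u (∑ j, δ j) - ∑ j, (μ j ⬝ᵥ derivWithin g (Icc 0 T) (t j)) * X j| ≤
      ε * ∑ j, X j := by
    rw [map_sum, ← Finset.sum_sub_distrib, Finset.mul_sum]
    refine (Finset.abs_sum_le_sum_abs _ _).trans (Finset.sum_le_sum fun j _ => ?_)
    rw [hg.fderiv_scaledControl]
    exact (hθ j).abs_setIntegral_mul_sub_le (hρ3 j).1 (hρ3 j).2
      (continuousOn_dotProduct hg_smooth.continuousOn _) (hρ1 j)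
  have h2 : |fderiv ℝ (fderiv ℝ F) u (∑ j, δ j) (∑ j, δ j) -
      ∑ j, ∑ k, (μ j ⬝ᵥ (H (t j) (t k) *ᵥ μ k)) * τ j * τ k| ≤ ε * (∑ j, n j) ^ 2 := by
    have h3 : fderiv ℝ (fderiv ℝ F) u (∑ j, δ j) (∑ j, δ j) =
        ∑ j, ∑ k, fderiv ℝ (fderiv ℝ F) u (δ j) (δ k) := by
      simp only [map_sum, _root_.sum_apply]
      exact Finset.sum_comm
    have h4 : ε * (∑ j, n j) ^ 2 = ∑ j, ∑ k, ε * n j * n k := by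
      rw [sq, Finset.sum_mul_sum, Finset.mul_sum]
      simp only [Finset.mul_sum, mul_assoc]
    rw [h3, h4, ← Finset.sum_sub_distrib]
    refine (Finset.abs_sum_le_sum_abs _ _).trans (Finset.sum_le_sum fun j _ => ?_)
    rw [← Finset.sum_sub_distrib]
    refine (Finset.abs_sum_le_sum_abs _ _).trans (Finset.sum_le_sum fun k _ => ?_)
    rw [hH.fderiv_scaledControl]
    exact abs_integral_integral_sub_le (hθ j) (hρ3 j).1 (hρ3 j).2 (hθ k) (hρ3 k).1 (hρ3 k).2
      (hKc j k) (hρ2 j k)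
  have h5 : ε / (2 * (C ^ 2 + 1)) * ‖∑ j, δ j‖ ^ 2 ≤ ε / 2 * (∑ j, n j) ^ 2 := by
    have h6 : ‖∑ j, δ j‖ ^ 2 ≤ (C ^ 2 + 1) * (∑ j, n j) ^ 2 := by
      calc ‖∑ j, δ j‖ ^ 2 ≤ (C * ∑ j, n j) ^ 2 := pow_le_pow_left₀ (norm_nonneg _) hδ1 2
        _ = C ^ 2 * (∑ j, n j) ^ 2 := mul_pow _ _ _
        _ ≤ _ := mul_le_mul_of_nonneg_right (by linarith) (sq_nonneg _)
    calc _ ≤ ε / (2 * (C ^ 2 + 1)) * ((C ^ 2 + 1) * (∑ j, n j) ^ 2) :=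
          mul_le_mul_of_nonneg_left h6 hεT.le
      _ = _ := by field_simp
  rw [abs_le] at hT1 h1 h2 ⊢
  constructor <;> linarith [hT1.1, hT1.2, h1.1, h1.2, h2.1, h2.2]

/-! ### Cells around the switching times and the value of the total variation -/

/-- The points that are at least as close to `t j` as to the other `t k`. -/
def cell {m : ℕ} (t : Fin m → ℝ) (j : Fin m) : Set ℝ := {s | ∀ k, |s - t j| ≤ |s - t k|}

/-- Cells are intervals that meet at the midpoints between neighbouring switching times. Being
ordered, they make the variations over them superadditive. -/
theorem le_of_mem_cell {m : ℕ} {t : Fin m → ℝ} (ht : StrictMono t) {i j : Fin m} (hij : i < j)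
    {x y : ℝ} (hx : x ∈ cell t i) (hy : y ∈ cell t j) : x ≤ y := by
  have h := ht hij
  have h1 := hx j
  have h2 := hy i
  by_contra! hlt
  rcases abs_cases (x - t i) with ⟨e1, _⟩ | ⟨e1, _⟩ <;> rcases abs_cases (x - t j) with ⟨e2, _⟩ | ⟨e2, _⟩ <;>
  rcases abs_cases (y - t i) with ⟨e3, _⟩ | ⟨e3, _⟩ <;> rcases abs_cases (y - t j) with ⟨e4, _⟩ | ⟨e4, _⟩ <;>
  linarith

theorem mem_cell_of_abs_lt {m : ℕ} {t : Fin m → ℝ} {ρ : ℝ}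
    (hsep : ∀ i j, i ≠ j → 2 * ρ ≤ |t i - t j|) {j : Fin m} {s : ℝ} (hs : |s - t j| < ρ) :
    s ∈ cell t j := by
  intro k
  by_cases hk : j = k
  · rw [hk]
  · have h1 := hsep j k hk
    have h2 : |t j - t k| ≤ |s - t j| + |s - t k| := by
      have := abs_sub_le (t j) s (t k)
      rwa [abs_sub_comm (t j) s] at this
    linarith

theorem exists_mem_cell {m : ℕ} [Nonempty (Fin m)] (t : Fin m → ℝ) (s : ℝ) : ∃ j, s ∈ cell t j :=
  Finite.exists_min fun k => |s - t k|

theorem lt_of_mem_cell {m : ℕ} {t : Fin m → ℝ} (ht : StrictMono t) {j : Fin m} {s : ℝ}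
    (hs : s ∈ cell t j) : (∀ k < j, t k < s) ∧ ∀ k, j < k → s < t k := by
  refine ⟨fun k hk => ?_, fun k hk => ?_⟩
  · have h := ht hk
    have h1 := hs k
    by_contra! h2
    rw [abs_of_nonpos (by linarith), abs_of_nonpos (by linarith)] at h1
    linarith
  · have h := ht hk
    have h1 := hs k
    by_contra! h2
    rw [abs_of_nonneg (by linarith), abs_of_nonneg (by linarith)] at h1
    linarith

theorem jumpForm_of_mem_cell {M m : ℕ} (a : Fin (m + 1) → Fin M → ℤ) {t : Fin m → ℝ}
    (ht : StrictMono t) {j : Fin m} {s : ℝ} (hs : s ∈ cell t j) :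
    jumpForm a t s = toReal (a j.succ) + below (t j) s • jump a j := by
  obtain ⟨h1, h2⟩ := lt_of_mem_cell ht hs
  rcases lt_or_ge s (t j) with h | h
  · rw [below_of_lt h, one_smul, jump, add_sub_cancel]
    refine jumpForm_eq a j.castSucc (fun k hk => (h1 k (by simpa using hk)).le) fun k hk => ?_
    exact h.trans_le (ht.monotone (by simpa using hk))
  · rw [below_of_le h, zero_smul, add_zero]
    refine jumpForm_eq a j.succ (fun k hk => ?_) fun k hk => h2 k (by simpa using hk)
    exact le_trans (ht.monotone (Fin.castSucc_lt_succ_iff.1 hk)) h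

theorem sum_eVariationOn_le {E : Type*} [PseudoEMetricSpace E] (f : ℝ → E) {m : ℕ}
    (S : Fin m → Set ℝ) (hS : ∀ i j, i < j → ∀ x ∈ S i, ∀ y ∈ S j, x ≤ y) :
    ∑ j, eVariationOn f (S j) ≤ eVariationOn f (⋃ j, S j) := by
  induction m with
  | zero => simp
  | succ m ih =>
    rw [Fin.sum_univ_castSucc]
    calc _ ≤ eVariationOn f (⋃ j : Fin m, S j.castSucc) + eVariationOn f (S (Fin.last m)) :=
          add_le_add_left (ih _ fun i j hij => hS _ _ (by simpa using hij)) _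
      _ ≤ eVariationOn f ((⋃ j : Fin m, S j.castSucc) ∪ S (Fin.last m)) := by
          refine eVariationOn.add_le_union f fun x hx y hy => ?_
          obtain ⟨j, hj⟩ := mem_iUnion.1 hx
          exact hS _ _ (Fin.castSucc_lt_last j) x hj y hy
      _ ≤ _ := eVariationOn.mono f (union_subset
          (iUnion_subset fun j => subset_iUnion S j.castSucc) (subset_iUnion S (Fin.last m)))

/-- The pointwise variations over the cells add up to at most the total variation. -/
theorem sum_eVariationOn_cell_le_TV {M m : ℕ} {T : ℝ} {p : ℝ≥0∞} [Fact (1 ≤ p)]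
    (w : ControlSpace M T) {G : Set ℝ} (hG : ∀ x ∈ G, x ∈ Ioo 0 T ∧ IsRegularPoint w x)
    {t : Fin m → ℝ} (ht : StrictMono t) :
    ∑ j, eVariationOn (fun s => (WithLp.toLp p (w s).ofLp : PiLp p (fun _ : Fin M => ℝ)))
      (G ∩ cell t j) ≤ TV p w := by
  refine (sum_eVariationOn_le _ _ fun i j hij x hx y hy => ?_).trans ((eVariationOn.mono _
    (iUnion_subset fun j => inter_subset_left)).trans (eVariationOn_le_TV w hG))
  exact le_of_mem_cell ht hij hx.2 hy.2

theorem exists_mem_Ioo_of_ae {T a b : ℝ} {P : ℝ → Prop}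
    (h : ∀ᵐ s ∂(volume : Measure ℝ).restrict (Ioo 0 T), P s) (hab : a < b) (ha : 0 ≤ a)
    (hb : b ≤ T) : ∃ s ∈ Ioo a b, P s := by
  have h1 : ∀ᵐ s ∂(volume : Measure ℝ).restrict (Ioo a b), P s :=
    ae_restrict_of_ae_restrict_of_subset (Ioo_subset_Ioo ha hb) h
  have : (ae ((volume : Measure ℝ).restrict (Ioo a b))).NeBot := by
    rw [ae_neBot]
    simpa using hab
  exact (h1.and (ae_restrict_mem measurableSet_Ioo)).exists.imp fun s hs => ⟨hs.2, hs.1⟩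

theorem eventually_separated {m : ℕ} {T : ℝ} {t : Fin m → ℝ} (ht : StrictMono (grid T t)) :
    ∀ᶠ ρ in 𝓝[>] (0 : ℝ), 0 < ρ ∧ (∀ i j, i ≠ j → 2 * ρ ≤ |t i - t j|) ∧
      ∀ j, ρ ≤ t j ∧ t j + ρ ≤ T := by
  refine eventually_mem_nhdsWithin.and (Eventually.and ?_ ?_)
  · refine eventually_all.2 fun i => eventually_all.2 fun j => ?_
    by_cases hij : i = j
    · simp [hij]
    · have h : 0 < |t i - t j| :=
        abs_pos.2 (sub_ne_zero.2 ((strictMono_of_strictMono_grid ht).injective.ne hij))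
      filter_upwards [Ioo_mem_nhdsGT (half_pos h)] with ρ hρ _
      linarith [hρ.2]
  · refine eventually_all.2 fun j => ?_
    have hj := mem_Ioo_of_strictMono_grid ht j
    filter_upwards [Ioo_mem_nhdsGT hj.1, Ioo_mem_nhdsGT (sub_pos.2 hj.2)] with ρ h1 h2
    exact ⟨h1.2.le, by linarith [h2.2]⟩

theorem IsMinimalRepresentation.ae_eq_jumpForm {M m : ℕ} {T : ℝ} {V : Finset (Fin M → ℤ)}
    {u : ControlSpace M T} {a : Fin (m + 1) → Fin M → ℤ} {t : Fin m → ℝ}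
    (h : IsMinimalRepresentation V u a t) :
    ∀ᵐ s ∂(volume : Measure ℝ).restrict (Ioo 0 T), (u s).ofLp = jumpForm a t s := by
  filter_upwards [h.ae_eq, ae_restrict_mem measurableSet_Ioo] with s hs hsT
  rw [hs, stepFunction_eq_jumpForm h.strictMono.monotone a hsT]

/-- The upper bound is the estimate for sums of jumps. For the lower bound, two regular points on
both sides of each switching time, inside its cell, already see the whole jump. -/
theorem IsMinimalRepresentation.TV_eq {M m : ℕ} {T : ℝ} (hT : 0 < T) {V : Finset (Fin M → ℤ)}
    {u : ControlSpace M T} {a : Fin (m + 1) → Fin M → ℤ} {t : Fin m → ℝ}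
    (h : IsMinimalRepresentation V u a t) {p : ℝ≥0∞} (hp : 1 ≤ p) :
    TV p u = ENNReal.ofReal (∑ j, pNorm p (jump a j)) := by
  have : Fact (1 ≤ p) := ⟨hp⟩
  have ht := strictMono_of_strictMono_grid h.strictMono
  have htT := mem_Ioo_of_strictMono_grid h.strictMono
  refine le_antisymm ?_ ?_
  -- With weights one and equal times, the convex combinations reduce to the unperturbed jumps.
  · refine TV_le_sum_pNorm hT hp u (toReal (a (Fin.last m))) (jump a) (l := 1) (x := t) (y := t)
      (fun j => by simp) (fun j => Ioo_subset_Icc_self (htT j))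
      (fun j => Ioo_subset_Icc_self (htT j)) ?_
    filter_upwards [h.ae_eq_jumpForm] with s hs
    rw [hs, jumpForm]
    simp
  · obtain ⟨ρ, hρ, hsep, hin⟩ := (eventually_separated h.strictMono).exists
    have hG : ∀ᵐ s ∂(volume : Measure ℝ).restrict (Ioo 0 T),
        (s ∈ Ioo 0 T ∧ IsRegularPoint u s) ∧ (u s).ofLp = jumpForm a t s := by
      filter_upwards [ae_restrict_mem measurableSet_Ioo, ae_isRegularPoint u, h.ae_eq_jumpForm]
        with s h1 h2 h3
      exact ⟨⟨h1, h2⟩, h3⟩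
    refine le_trans ?_ (sum_eVariationOn_cell_le_TV u
      (G := {s | (s ∈ Ioo 0 T ∧ IsRegularPoint u s) ∧ (u s).ofLp = jumpForm a t s})
      (fun x hx => hx.1) ht)
    rw [ENNReal.ofReal_sum_of_nonneg fun j _ => pNorm_nonneg hp _]
    refine Finset.sum_le_sum fun j _ => ?_
    obtain ⟨x, hx, hxG⟩ := exists_mem_Ioo_of_ae hG (show t j - ρ < t j by linarith)
      (by linarith [(hin j).1]) (htT j).2.le
    obtain ⟨y, hy, hyG⟩ := exists_mem_Ioo_of_ae hG (show t j < t j + ρ by linarith)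
      (htT j).1.le (hin j).2
    have hxc : x ∈ cell t j := mem_cell_of_abs_lt hsep (abs_lt.2 ⟨by linarith [hx.1], by linarith [hx.2]⟩)
    have hyc : y ∈ cell t j := mem_cell_of_abs_lt hsep (abs_lt.2 ⟨by linarith [hy.1], by linarith [hy.2]⟩)
    refine le_trans (le_of_eq ?_) (eVariationOn.edist_le _ ⟨hxG, hxc⟩ ⟨hyG, hyc⟩)
    rw [hxG.2, hyG.2, jumpForm_of_mem_cell a ht hxc, jumpForm_of_mem_cell a ht hyc,
      below_of_lt hx.2, below_of_le hy.1.le, edist_dist, dist_eq_norm, ← WithLp.toLp_sub, pNorm]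
    congr 3
    simp

/-! ### Shifts of the switching times, their moments, and competitors -/

/-- The profile of a convex combination of two shifts of the switching time `t`. -/
noncomputable def shiftProfile (t l x y s : ℝ) : ℝ :=
  l * (below x s - below t s) + (1 - l) * (below y s - below t s)

theorem below_sub_below_of_le {t x : ℝ} (h : t ≤ x) :
    (fun s => below x s - below t s) = (Ico t x).indicator fun _ => (1 : ℝ) :=
  funext fun s => by simp [indicator_Ico_eq_below h (1 : ℝ) s]

theorem below_sub_below_of_ge {t x : ℝ} (h : x ≤ t) :
    (fun s => below x s - below t s) = fun s => -(Ico x t).indicator (fun _ => (1 : ℝ)) s :=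
  funext fun s => by simp [indicator_Ico_eq_below h (1 : ℝ) s]

/-- A later switch adds the jump on the right of `t`, an earlier one subtracts it on the left; hence
the sign condition. -/
theorem isShiftProfile_below {t x ρ : ℝ} (h : |x - t| < ρ) :
    IsShiftProfile t ρ fun s => below x s - below t s := by
  have h' := abs_lt.1 h
  rcases le_total t x with htx | htx
  · rw [below_sub_below_of_le htx]
    refine ⟨(integrable_indicator_iff measurableSet_Ico).2 (integrableOn_const (by simp)),
      fun s hs => indicator_of_notMem (fun hs' => ?_) _, Eventually.of_forall fun s => ?_,
      Eventually.of_forall fun s => ?_⟩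
    · rw [abs_of_nonneg (by linarith [hs'.1])] at hs
      linarith [hs'.2]
    · by_cases hs : s ∈ Ico t x <;> simp [hs]
    · by_cases hs : s ∈ Ico t x
      · simpa [hs] using hs.1
      · simp [hs]
  · rw [below_sub_below_of_ge htx]
    refine ⟨((integrable_indicator_iff measurableSet_Ico).2 (integrableOn_const (by simp))).neg,
      fun s hs => ?_, Eventually.of_forall fun s => ?_, Eventually.of_forall fun s => ?_⟩
    · rw [indicator_of_notMem, neg_zero]
      intro hs'
      rw [abs_of_nonpos (by linarith [hs'.2])] at hs
      linarith [hs'.1]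
    · by_cases hs : s ∈ Ico x t <;> simp [hs]
    · by_cases hs : s ∈ Ico x t
      · simpa [hs] using hs.2.le
      · simp [hs]

theorem IsShiftProfile.convexComb {t ρ l : ℝ} {θ θ' : ℝ → ℝ} (h : IsShiftProfile t ρ θ)
    (h' : IsShiftProfile t ρ θ') (hl : l ∈ Icc (0 : ℝ) 1) :
    IsShiftProfile t ρ fun s => l * θ s + (1 - l) * θ' s := by
  have hl' : 0 ≤ 1 - l := sub_nonneg.2 hl.2
  refine ⟨(h.integrable.const_mul _).add (h'.integrable.const_mul _),
    fun s hs => by simp [h.eq_zero s hs, h'.eq_zero s hs], ?_, ?_⟩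
  · filter_upwards [h.abs_le_one, h'.abs_le_one] with s h1 h2
    calc _ ≤ l * |θ s| + (1 - l) * |θ' s| := by
          refine (abs_add_le _ _).trans_eq ?_
          rw [_root_.abs_mul, _root_.abs_mul, abs_of_nonneg hl.1, abs_of_nonneg hl']
      _ ≤ l * 1 + (1 - l) * 1 := add_le_add (mul_le_mul_of_nonneg_left h1 hl.1)
          (mul_le_mul_of_nonneg_left h2 hl')
      _ = 1 := by ring
  · filter_upwards [h.sign, h'.sign] with s h1 h2
    have := add_nonneg (mul_nonneg hl.1 h1) (mul_nonneg hl' h2)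
    linarith

theorem isShiftProfile_shiftProfile {t l x y ρ : ℝ} (hl : l ∈ Icc (0 : ℝ) 1) (hx : |x - t| < ρ)
    (hy : |y - t| < ρ) : IsShiftProfile t ρ (shiftProfile t l x y) :=
  (isShiftProfile_below hx).convexComb (isShiftProfile_below hy) hl

theorem integral_below_sub_below_mul (t x : ℝ) (f : ℝ → ℝ) :
    ∫ s, (below x s - below t s) * f s = ∫ s in t..x, f s := by
  have h1 : ∀ a b : ℝ, a ≤ b →
      ∫ s, (Ico a b).indicator (fun _ => (1 : ℝ)) s * f s = ∫ s in a..b, f s := fun a b hab => by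
    rw [intervalIntegral.integral_of_le hab, integral_Ioc_eq_integral_Ioo,
      ← integral_Ico_eq_integral_Ioo, ← integral_indicator measurableSet_Ico]
    refine integral_congr_ae (Eventually.of_forall fun s => ?_)
    by_cases hs : s ∈ Ico a b <;> simp [hs]
  rcases le_total t x with h | h
  · rw [← h1 t x h, ← below_sub_below_of_le h]
  · have h2 : (fun s => (below x s - below t s) * f s) =
        fun s => -((Ico x t).indicator (fun _ => (1 : ℝ)) s * f s) := by
      ext s
      rw [congrFun (below_sub_below_of_ge h) s, neg_mul]
    rw [h2, integral_neg, h1 x t h, intervalIntegral.integral_symm, neg_neg]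

theorem integral_below_sub_below (t x : ℝ) : ∫ s, (below x s - below t s) = x - t := by
  simpa using integral_below_sub_below_mul t x fun _ => 1

theorem integral_below_sub_below_mul_sub (t x : ℝ) :
    ∫ s, (below x s - below t s) * (s - t) = (x - t) ^ 2 / 2 := by
  rw [integral_below_sub_below_mul]
  simp [intervalIntegral.integral_comp_sub_right (fun s => s) t]

theorem integral_abs_below_sub_below (t x : ℝ) : ∫ s, |below x s - below t s| = |x - t| := by
  rcases le_total t x with h | h
  · rw [abs_of_nonneg (sub_nonneg.2 h), ← integral_below_sub_below]
    refine integral_congr_ae (Eventually.of_forall fun s => abs_of_nonneg ?_)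
    rw [congrFun (below_sub_below_of_le h) s]
    exact indicator_nonneg (fun _ _ => zero_le_one) s
  · rw [abs_of_nonpos (sub_nonpos.2 h), ← integral_below_sub_below, ← integral_neg]
    refine integral_congr_ae (Eventually.of_forall fun s => abs_of_nonpos ?_)
    rw [congrFun (below_sub_below_of_ge h) s]
    exact neg_nonpos.2 (indicator_nonneg (fun _ _ => zero_le_one) s)

theorem objective_eq_coe {M : ℕ} {T : ℝ} (F : ControlSpace M T → ℝ) (β : ℝ) {p : ℝ≥0∞}
    {w : ControlSpace M T} (hw : TV p w ≠ ∞) :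
    objective F β p w = ((F w + β * (TV p w).toReal : ℝ) : EReal) := by
  rw [objective, EReal.coe_add, EReal.coe_mul, ← EReal.coe_ennreal_toReal hw]

theorem norm_sum_scaledControl_le {M m : ℕ} {T : ℝ} {t : Fin m → ℝ} {ρ : ℝ} (hρ : 0 ≤ ρ)
    {θ : Fin m → ℝ → ℝ} (hθ : ∀ j, IsShiftProfile (t j) ρ (θ j)) (μ : Fin m → Fin M → ℝ) :
    ‖∑ j, scaledControl T (hθ j).integrable (μ j)‖ ≤
        (∑ j, pNorm 1 (μ j)) * ∑ j, ∫ s, |θ j s| ∧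
      ‖∑ j, scaledControl T (hθ j).integrable (μ j)‖ ≤ (∑ j, pNorm 1 (μ j)) * (2 * ρ) := by
  have hμ0 : ∀ j, 0 ≤ pNorm 1 (μ j) := fun j => pNorm_nonneg le_rfl _
  have hδ : ‖∑ j, scaledControl T (hθ j).integrable (μ j)‖ ≤ ∑ j, pNorm 1 (μ j) * ∫ s, |θ j s| :=
    norm_sum_le_of_le _ fun j _ => norm_scaledControl_le _ _
  constructor
  · refine hδ.trans ?_
    rw [Finset.mul_sum]
    exact Finset.sum_le_sum fun j _ => mul_le_mul_of_nonneg_right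
      (Finset.single_le_sum (fun j _ => hμ0 j) (Finset.mem_univ j))
      (integral_nonneg fun s => abs_nonneg _)
  · rw [Finset.sum_mul]
    exact hδ.trans (Finset.sum_le_sum fun j _ =>
      mul_le_mul_of_nonneg_left ((hθ j).integral_abs_le hρ) (hμ0 j))

/-- The windows of radius `ρ` are disjoint, so on the support of one profile no other is active, and
jumps have 1-norm at least one. -/
theorem integral_abs_le_norm_sum_scaledControl {M m : ℕ} {T : ℝ} {t : Fin m → ℝ} {ρ : ℝ}
    (hsep : ∀ i j, i ≠ j → 2 * ρ ≤ |t i - t j|) (hin : ∀ j, ρ ≤ t j ∧ t j + ρ ≤ T)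
    {θ : Fin m → ℝ → ℝ} (hθ : ∀ j, IsShiftProfile (t j) ρ (θ j)) {μ : Fin m → Fin M → ℝ}
    (hμ : ∀ j, 1 ≤ pNorm 1 (μ j)) (j : Fin m) :
    ∫ s, |θ j s| ≤ ‖∑ j, scaledControl T (hθ j).integrable (μ j)‖ := by
  rw [norm_control_eq, ← (hθ j).setIntegral_eq (hin j).1 (hin j).2 (f := fun s => |θ j s|)
    (fun s hs => by simp [hs])]
  refine integral_mono_ae (hθ j).integrable.abs.restrict (L1.integrable_coeFn _).norm ?_
  filter_upwards [sum_scaledControl_ae (T := T) (fun j => (hθ j).integrable) μ] with s hs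
  simp only [hs]
  by_cases h : θ j s = 0
  · simpa [h] using pNorm_nonneg le_rfl _
  · rw [Finset.sum_eq_single j]
    · rw [pNorm_smul le_rfl]
      exact le_mul_of_one_le_right (abs_nonneg _) (hμ j)
    · intro k _ hk
      have h1 := (hθ j).mem_of_ne_zero h
      have h2 : θ k s = 0 := by
        by_contra h3
        have h4 := (hθ k).mem_of_ne_zero h3
        have h5 := hsep k j hk
        have h6 := abs_sub_le (t k) s (t j)
        rw [abs_sub_comm (t k) s] at h6
        linarith
      rw [h2, zero_smul]
    · simp

theorem IsShiftProfile.integral_mul_sub_le {t ρ : ℝ} {θ : ℝ → ℝ} (h : IsShiftProfile t ρ θ) :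
    ∫ s, θ s * (s - t) ≤ ρ * ∫ s, |θ s| := by
  rw [← integral_const_mul]
  refine integral_mono_ae h.integrable_mul_sub (h.integrable.abs.const_mul ρ) ?_
  filter_upwards [h.abs_mul] with s hs
  simp only [← hs]
  rw [mul_comm]
  by_cases hθ : θ s = 0
  · simp [hθ]
  · exact mul_le_mul_of_nonneg_right (h.mem_of_ne_zero hθ).le (abs_nonneg _)

/-- First-order expansion of the objective along perturbations concentrated at the switching
times. -/
theorem expansion_one {M m : ℕ} {T : ℝ} {F : ControlSpace M T → ℝ} (hF : Differentiable ℝ F)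
    {u : ControlSpace M T} {g : ℝ → Fin M → ℝ}
    (hg : IsGradient F u g) (hg_cont : ContinuousOn g (Icc 0 T))
    {t : Fin m → ℝ} (ht : ∀ j, t j ∈ Ioo 0 T) (μ : Fin m → Fin M → ℝ) {ε : ℝ} (hε : 0 < ε) :
    ∀ᶠ ρ in 𝓝[>] (0 : ℝ), ∀ (θ : Fin m → ℝ → ℝ) (hθ : ∀ j, IsShiftProfile (t j) ρ (θ j)),
      F (u + ∑ j, scaledControl T (hθ j).integrable (μ j)) - F u ≤
        ∑ j, (μ j ⬝ᵥ g (t j)) * (∫ s, θ j s) + ε * ∑ j, ∫ s, |θ j s| := by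
  set C := ∑ j, pNorm 1 (μ j)
  have hC0 : 0 ≤ C := Finset.sum_nonneg fun j _ => pNorm_nonneg le_rfl _
  obtain ⟨r, hr, hlin⟩ := Metric.eventually_nhds_iff.1
    -- Half of `ε` pays for the remainder of `F`, the other half for the oscillation of the gradient
    -- near the switching times.
    ((hF u).hasFDerivAt.isLittleO.def (show 0 < ε / 2 / (C + 1) by positivity))
  have hfc : ∀ j, ContinuousOn (fun s => μ j ⬝ᵥ g s) (Icc 0 T) := fun j =>
    continuousOn_dotProduct hg_cont _
  have e1 : ∀ᶠ ρ in 𝓝[>] (0 : ℝ), ∀ j, ∀ s, |s - t j| < ρ →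
      |μ j ⬝ᵥ g s - μ j ⬝ᵥ g (t j)| ≤ ε / 2 := eventually_all.2 fun j => by
    obtain ⟨δ, hδ, h⟩ := Metric.continuousAt_iff.1
      ((hfc j).continuousAt (Icc_mem_nhds (ht j).1 (ht j).2)) (ε / 2) (half_pos hε)
    filter_upwards [Ioo_mem_nhdsGT hδ] with ρ hρ s hs
    exact (h (x := s) (hs.trans hρ.2)).le
  have e3 : ∀ᶠ ρ in 𝓝[>] (0 : ℝ), ∀ j, ρ ≤ t j ∧ t j + ρ ≤ T := eventually_all.2 fun j => by
    filter_upwards [Ioo_mem_nhdsGT (ht j).1, Ioo_mem_nhdsGT (sub_pos.2 (ht j).2)] with ρ h1 h2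
    exact ⟨h1.2.le, by linarith [h2.2]⟩
  filter_upwards [e1, e3, Ioo_mem_nhdsGT (show 0 < r / (2 * C + 1) by positivity)]
    with ρ hρ1 hρ3 hρ4 θ hθ
  obtain ⟨hδ1, hδ2⟩ := norm_sum_scaledControl_le (T := T) hρ4.1.le hθ μ
  set δ := ∑ j, scaledControl T (hθ j).integrable (μ j)
  have hδr : ‖δ‖ < r := by
    calc ‖δ‖ ≤ ρ * (2 * C) := by linarith
      _ < ρ * (2 * C + 1) := mul_lt_mul_of_pos_left (by linarith) hρ4.1
      _ < r := (lt_div_iff₀ (by positivity)).1 hρ4.2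
  have h1 := hlin (y := u + δ) (by simpa using hδr)
  rw [add_sub_cancel_left, Real.norm_eq_abs] at h1
  have h2 : fderiv ℝ F u δ ≤ ∑ j, (μ j ⬝ᵥ g (t j)) * (∫ s, θ j s) + ε / 2 * ∑ j, ∫ s, |θ j s| := by
    rw [map_sum, Finset.mul_sum, ← Finset.sum_add_distrib]
    refine Finset.sum_le_sum fun j _ => ?_
    rw [hg.fderiv_scaledControl, ← (hθ j).setIntegral_eq (hρ3 j).1 (hρ3 j).2 (fun s hs => hs),
      ← (hθ j).setIntegral_eq (hρ3 j).1 (hρ3 j).2 (f := fun s => |θ j s|) (fun s hs => by simp [hs]),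
      ← integral_const_mul, ← integral_const_mul, ← integral_add
        ((hθ j).integrable.restrict.const_mul _) ((hθ j).integrable.abs.restrict.const_mul _)]
    obtain ⟨B, hB⟩ := isCompact_Icc.exists_bound_of_continuousOn (hfc j)
    refine integral_mono_ae ?_ (((hθ j).integrable.restrict.const_mul _).add
      ((hθ j).integrable.abs.restrict.const_mul _)) (Eventually.of_forall fun s => ?_)
    · refine Integrable.mul_bdd (c := B) (hθ j).integrable.restrict
        (((hfc j).mono Ioo_subset_Icc_self).aestronglyMeasurable measurableSet_Ioo) ?_
      filter_upwards [ae_restrict_mem measurableSet_Ioo] with s hs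
      exact hB s (Ioo_subset_Icc_self hs)
    · by_cases h : θ j s = 0
      · simp [h]
      · have h3 := hρ1 j s ((hθ j).mem_of_ne_zero h)
        have h4 : θ j s * (μ j ⬝ᵥ g s - μ j ⬝ᵥ g (t j)) ≤ |θ j s| * (ε / 2) :=
          (le_abs_self _).trans (by
            rw [_root_.abs_mul]
            exact mul_le_mul_of_nonneg_left h3 (abs_nonneg _))
        simp only
        linarith
  have h5 : ε / 2 / (C + 1) * ‖δ‖ ≤ ε / 2 * ∑ j, ∫ s, |θ j s| := by
    have hn : 0 ≤ ∑ j, ∫ s, |θ j s| :=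
      Finset.sum_nonneg fun j _ => integral_nonneg fun s => abs_nonneg _
    rw [div_mul_eq_mul_div, div_le_iff₀ (by positivity), mul_assoc]
    refine mul_le_mul_of_nonneg_left ?_ (by positivity)
    linarith
  linarith [(abs_le.1 h1).2]

theorem abs_lt_or_forall {m : ℕ} (t : Fin m → ℝ) (ρ s : ℝ) :
    (∃ j, |s - t j| < ρ) ∨ ∀ j, ρ ≤ |s - t j| := by
  by_cases h : ∃ j, |s - t j| < ρ
  · exact Or.inl h
  · push Not at h
    exact Or.inr h

/-- Shifting the switching times, or splitting a jump at an intermediate value of `V`, leads to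
an admissible control without increasing the total variation. -/
theorem IsMinimalRepresentation.competitor {M m : ℕ} {T : ℝ} (hT : 0 < T)
    {V : Finset (Fin M → ℤ)} {u : ControlSpace M T} {a : Fin (m + 1) → Fin M → ℤ}
    {t : Fin m → ℝ} (h : IsMinimalRepresentation V u a t) {ρ : ℝ}
    (hsep : ∀ i j, i ≠ j → 2 * ρ ≤ |t i - t j|) (hin : ∀ j, ρ ≤ t j ∧ t j + ρ ≤ T)
    {l x y : Fin m → ℝ} (hl : ∀ j, l j ∈ Icc (0 : ℝ) 1) (hx : ∀ j, |x j - t j| < ρ)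
    (hy : ∀ j, |y j - t j| < ρ)
    (hV : ∀ j, x j = y j ∨ y j ≤ x j ∧ ∃ ν ∈ V,
      l j • toReal (a j.castSucc) + (1 - l j) • toReal (a j.succ) = toReal ν)
    (hθ : ∀ j, IsShiftProfile (t j) ρ (shiftProfile (t j) (l j) (x j) (y j))) :
    (u + ∑ j, scaledControl T (hθ j).integrable (jump a j)) ∈ admissible T V ∧
      ∀ q, 1 ≤ q → TV q (u + ∑ j, scaledControl T (hθ j).integrable (jump a j)) ≤ TV q u := by
  have ht := strictMono_of_strictMono_grid h.strictMono
  set w := u + ∑ j, scaledControl T (hθ j).integrable (jump a j)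
  have hw0 : ∀ᵐ s ∂(volume : Measure ℝ).restrict (Ioo 0 T), (w s).ofLp =
      jumpForm a t s + ∑ j, shiftProfile (t j) (l j) (x j) (y j) s • jump a j := by
    filter_upwards [Lp.coeFn_add u (∑ j, scaledControl T (hθ j).integrable (jump a j)),
      sum_scaledControl_ae (T := T) (fun j => (hθ j).integrable) (jump a), h.ae_eq_jumpForm]
      with s h1 h2 h3
    rw [h1, Pi.add_apply, WithLp.ofLp_add, h2, h3]
  have hmem : ∀ {z : ℝ} (j), |z - t j| < ρ → z ∈ Icc 0 T := fun {z} j hz => by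
    have h1 := abs_lt.1 hz
    have h2 := hin j
    exact ⟨by linarith, by linarith⟩
  have hTV : ∀ q, 1 ≤ q → TV q w ≤ TV q u := fun q hq => by
    rw [h.TV_eq hT hq]
    -- The competitor uses the same jumps at times `x` and `y` with weights `l` and `1 - l`, so the
    -- norms of the jumps still bound its variation.
    refine TV_le_sum_pNorm hT hq w (toReal (a (Fin.last m))) (jump a) hl
      (fun j => hmem j (hx j)) (fun j => hmem j (hy j)) ?_
    filter_upwards [hw0] with s hs
    rw [hs, jumpForm, add_assoc, ← Finset.sum_add_distrib]
    congr 1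
    refine Finset.sum_congr rfl fun j _ => ?_
    rw [← add_smul, shiftProfile]
    congr 1
    ring
  refine ⟨⟨(hTV 2 one_le_two).trans_lt ?_, ?_⟩, hTV⟩
  · rw [h.TV_eq hT one_le_two]
    exact ENNReal.ofReal_lt_top
  filter_upwards [hw0] with s hs
  rw [hs]
  rcases abs_lt_or_forall t ρ s with ⟨j, hj⟩ | hfar
  · rw [Finset.sum_eq_single j, jumpForm_of_mem_cell a ht (mem_cell_of_abs_lt hsep hj), add_assoc,
      ← add_smul]
    · have e : below (t j) s + shiftProfile (t j) (l j) (x j) (y j) s =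
          l j * below (x j) s + (1 - l j) * below (y j) s := by
        rw [shiftProfile]
        ring
      rw [e]
      have hone : toReal (a j.succ) + (1 : ℝ) • jump a j = toReal (a j.castSucc) := by
        rw [one_smul, jump, add_sub_cancel]
      -- A plain shift takes only the two old values. In the split case `y j ≤ x j`, and the control
      -- equals `ν` exactly between these times.
      rcases hV j with hxy | ⟨hyx, ν, hν, hνe⟩
      · rw [hxy, ← add_mul, add_sub_cancel, one_mul]
        rcases lt_or_ge s (y j) with h1 | h1
        · exact ⟨_, h.mem j.castSucc, by rw [below_of_lt h1, hone]⟩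
        · exact ⟨_, h.mem j.succ, by rw [below_of_le h1, zero_smul, add_zero]⟩
      · rcases lt_or_ge s (y j) with h1 | h1
        · refine ⟨_, h.mem j.castSucc, ?_⟩
          rw [below_of_lt h1, below_of_lt (h1.trans_le hyx), mul_one, mul_one, add_sub_cancel, hone]
        · rcases lt_or_ge s (x j) with h2 | h2
          · refine ⟨ν, hν, ?_⟩
            rw [below_of_le h1, below_of_lt h2, ← hνe, jump]
            module
          · refine ⟨_, h.mem j.succ, ?_⟩
            rw [below_of_le h1, below_of_le h2, mul_zero, mul_zero, add_zero, zero_smul, add_zero]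
    · intro k _ hk
      rw [(hθ k).eq_zero s, zero_smul]
      by_contra! h4
      have h5 := hsep k j hk
      have h6 := abs_sub_le (t k) s (t j)
      rw [abs_sub_comm (t k) s] at h6
      linarith
    · simp
  · rw [Finset.sum_eq_zero fun j _ => by rw [(hθ j).eq_zero s (hfar j), zero_smul], add_zero]
    obtain ⟨j, h1, h2⟩ := exists_index ht.monotone s
    exact ⟨a j, h.mem j, jumpForm_eq a j h1 h2⟩

/-! ### Necessary conditions -/

theorem le_of_forall_pos_le_add_mul {A B C : ℝ} (hC : 0 ≤ C)
    (h : ∀ ε > 0, A ≤ B + ε * C) : A ≤ B := by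
  refine le_of_forall_pos_le_add fun ε hε => (h (ε / (C + 1)) (by positivity)).trans ?_
  rw [div_mul_eq_mul_div]
  have : ε * C / (C + 1) ≤ ε := (div_le_iff₀ (by positivity)).2 (by linarith)
  linarith

/-- Quadratic growth with constant `η ≥ 0`; local minimality is the case `η = 0`. -/
def GrowthAt {M : ℕ} {T : ℝ} (V : Finset (Fin M → ℤ)) (F : ControlSpace M T → ℝ) (p : ℝ≥0∞)
    (u : ControlSpace M T) (η : ℝ) : Prop :=
  ∃ ε > 0, ∀ w ∈ admissible T V, ‖w - u‖ ≤ ε → TV p w ≤ TV p u →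
    F u + η / 2 * ‖w - u‖ ^ 2 ≤ F w

/-- For competitors of no larger variation the `β` term only helps `w`, so the growth passes to `F`
alone. -/
theorem growthAt_of_objective {M : ℕ} {T : ℝ} {V : Finset (Fin M → ℤ)}
    {F : ControlSpace M T → ℝ} {β : ℝ} (hβ : 0 < β) {p : ℝ≥0∞} {u : ControlSpace M T}
    (hu : TV p u ≠ ∞) {η ε : ℝ} (hε : 0 < ε)
    (h : ∀ w ∈ admissible T V, ‖w - u‖ ≤ ε →
      objective F β p u + ((η / 2 * ‖w - u‖ ^ 2 : ℝ) : EReal) ≤ objective F β p w) :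
    GrowthAt V F p u η := by
  refine ⟨ε, hε, fun w hw hwu hTV => ?_⟩
  have h1 := h w hw hwu
  rw [objective_eq_coe F β hu, objective_eq_coe F β (ne_top_of_le_ne_top hu hTV),
    ← EReal.coe_add, EReal.coe_le_coe_iff] at h1
  have h2 := mul_le_mul_of_nonneg_left (ENNReal.toReal_mono hu hTV) hβ.le
  linarith

theorem IsLocalMinimizer.growthAt {M : ℕ} {T : ℝ} {V : Finset (Fin M → ℤ)}
    {F : ControlSpace M T → ℝ} {β : ℝ} (hβ : 0 < β) {p : ℝ≥0∞} {u : ControlSpace M T}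
    (hu : TV p u ≠ ∞) (h : IsLocalMinimizer V F β p u) : GrowthAt V F p u 0 := by
  obtain ⟨ε, hε, h1⟩ := Metric.eventually_nhds_iff.1 (eventually_nhdsWithin_iff.1 h.2)
  refine growthAt_of_objective hβ hu (half_pos hε) fun w hw hwu => ?_
  have h2 := h1 (y := w) (by rw [dist_eq_norm]; linarith) hw
  simpa using h2

section

variable {M m : ℕ} {T : ℝ} {V : Finset (Fin M → ℤ)} {F : ControlSpace M T → ℝ}
  {p : ℝ≥0∞} {u : ControlSpace M T} {a : Fin (m + 1) → Fin M → ℤ} {t : Fin m → ℝ} {η : ℝ}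
  {g : ℝ → Fin M → ℝ} {H : ℝ → ℝ → Matrix (Fin M) (Fin M) ℝ}

theorem GrowthAt.eventually_competitor (hT : 0 < T) (hp : 1 ≤ p)
    (hrep : IsMinimalRepresentation V u a t) (hgrow : GrowthAt V F p u η) :
    ∀ᶠ ρ in 𝓝[>] (0 : ℝ), ∀ (l x y : Fin m → ℝ), (∀ j, l j ∈ Icc (0 : ℝ) 1) →
      (∀ j, |x j - t j| < ρ) → (∀ j, |y j - t j| < ρ) →
      (∀ j, x j = y j ∨ y j ≤ x j ∧ ∃ ν ∈ V,
        l j • toReal (a j.castSucc) + (1 - l j) • toReal (a j.succ) = toReal ν) →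
      ∀ hθ : ∀ j, IsShiftProfile (t j) ρ (shiftProfile (t j) (l j) (x j) (y j)),
        F u + η / 2 * ‖∑ j, scaledControl T (hθ j).integrable (jump a j)‖ ^ 2 ≤
          F (u + ∑ j, scaledControl T (hθ j).integrable (jump a j)) := by
  obtain ⟨ε, hε, hw⟩ := hgrow
  set C := ∑ j, pNorm 1 (jump a j)
  have hC0 : 0 ≤ C := Finset.sum_nonneg fun j _ => pNorm_nonneg le_rfl _
  filter_upwards [eventually_separated hrep.strictMono,
    Ioo_mem_nhdsGT (show 0 < ε / (2 * C + 1) by positivity)]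
    with ρ ⟨hρ, hsep, hin⟩ hρε l x y hl hx hy hV hθ
  obtain ⟨h1, h2⟩ := hrep.competitor hT hsep hin hl hx hy hV hθ
  have h3 := (norm_sum_scaledControl_le (T := T) hρ.le hθ (jump a)).2
  have h4 := (lt_div_iff₀ (show 0 < 2 * C + 1 by positivity)).1 hρε.2
  have h5 := hw _ h1 (by rw [add_sub_cancel_left]; linarith) (h2 p hp)
  rwa [add_sub_cancel_left] at h5

theorem shiftProfile_self (t l x : ℝ) :
    shiftProfile t l x x = fun s => below x s - below t s := by
  ext s
  rw [shiftProfile]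
  ring

/-- Moving a single switching time by `σ` changes `F` to first order by `σ` times the product in
question; both signs of `σ` are available. -/
theorem GrowthAt.stationary (hT : 0 < T) (hp : 1 ≤ p) (hF : Differentiable ℝ F)
    (hg : IsGradient F u g) (hg_cont : ContinuousOn g (Icc 0 T))
    (hrep : IsMinimalRepresentation V u a t) (hη : 0 ≤ η) (hgrow : GrowthAt V F p u η)
    (j : Fin m) : jump a j ⬝ᵥ g (t j) = 0 := by
  set b := jump a j ⬝ᵥ g (t j)
  have key : ∀ ε > 0, |b| ≤ 0 + ε * 1 := fun ε hε => by
    obtain ⟨ρ, hρ1, hρ2, hρ⟩ := ((expansion_one hF hg hg_cont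
      (mem_Ioo_of_strictMono_grid hrep.strictMono) (jump a) hε).and
      ((hgrow.eventually_competitor hT hp hrep).and eventually_mem_nhdsWithin)).exists
    have hρ0 : 0 < ρ := hρ
    have main : ∀ σ, |σ| < ρ → 0 ≤ b * σ + ε * |σ| := fun σ hσ => by
      set x : Fin m → ℝ := fun k => t k + if k = j then σ else 0
      have hx : ∀ k, |x k - t k| < ρ := fun k => by
        by_cases hk : k = j <;> simp [x, hk, hσ, hρ0]
      have hθ : ∀ k, IsShiftProfile (t k) ρ (shiftProfile (t k) 1 (x k) (x k)) := fun k =>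
        isShiftProfile_shiftProfile (by simp) (hx k) (hx k)
      have h1 := hρ1 _ hθ
      have h2 := hρ2 1 x x (fun k => by simp) hx hx (fun k => Or.inl rfl) hθ
      simp only [Pi.one_apply] at h2
      set δ := ∑ k, scaledControl T (hθ k).integrable (jump a k)
      clear_value δ
      simp only [shiftProfile_self, integral_below_sub_below, integral_abs_below_sub_below, x,
        add_sub_cancel_left, mul_ite, mul_zero, Finset.sum_ite_eq', Finset.mem_univ, if_true,
        apply_ite abs, abs_zero] at h1
      have h3 : 0 ≤ η / 2 * ‖δ‖ ^ 2 := by positivity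
      linarith
    have h4 := main (ρ / 2) (by rw [abs_of_pos (half_pos hρ0)]; linarith)
    have h5 := main (-(ρ / 2)) (by rw [abs_neg, abs_of_pos (half_pos hρ0)]; linarith)
    rw [abs_neg] at h5
    rw [abs_of_pos (half_pos hρ0)] at h4 h5
    rw [abs_le]
    constructor <;> nlinarith
  exact abs_nonpos_iff.1 (le_of_forall_pos_le_add_mul zero_le_one key)

theorem one_le_pNorm_jump (hrep : IsMinimalRepresentation V u a t) (j : Fin m) :
    1 ≤ pNorm 1 (jump a j) := one_le_pNorm_toReal_sub le_rfl (hrep.ne j)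

/-- Shifting all switching times by `e * τ k` changes `F` by `e ^ 2 / 2` times the quadratic form,
while the L¹ distance is at least `e * ‖τ‖`. Dividing by `e ^ 2 / 2` leaves an error proportional to
`ε`. -/
theorem GrowthAt.quadForm_ge (hT : 0 < T) (hp : 1 ≤ p) (hF : Differentiable ℝ F)
    (hF' : Differentiable ℝ (fderiv ℝ F)) (hg : IsGradient F u g)
    (hg_smooth : ContDiffOn ℝ 1 g (Icc 0 T)) (hH : IsHessian F u H)
    (hH_cont : ContinuousOn (fun x : ℝ × ℝ => H x.1 x.2) (Icc 0 T ×ˢ Icc 0 T))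
    (hrep : IsMinimalRepresentation V u a t) (hη : 0 ≤ η) (hgrow : GrowthAt V F p u η)
    (τ : Fin m → ℝ) : η * ‖τ‖ ^ 2 ≤ quadForm T g H a t τ := by
  have h0 := hgrow.stationary hT hp hF hg hg_smooth.continuousOn hrep hη
  set D := ∑ j, |τ j|
  have hD0 : 0 ≤ D := Finset.sum_nonneg fun j _ => abs_nonneg _
  have hDj : ∀ j, |τ j| ≤ D := fun j =>
    Finset.single_le_sum (f := fun j => |τ j|) (fun j _ => abs_nonneg _) (Finset.mem_univ j)
  refine le_of_forall_pos_le_add_mul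
    (show 0 ≤ ∑ j, τ j ^ 2 + 2 * D ^ 2 by positivity) fun ε hε => ?_
  obtain ⟨ρ, hρ1, hρ2, hρ, hsep, hin⟩ := ((expansion hF hF' hg hg_smooth hH hH_cont
    (mem_Ioo_of_strictMono_grid hrep.strictMono) h0 hε).and
    ((hgrow.eventually_competitor hT hp hrep).and (eventually_separated hrep.strictMono))).exists
  set e := ρ / (D + 1)
  have he : 0 < e := by positivity
  set x : Fin m → ℝ := fun k => t k + e * τ k
  have hx : ∀ k, |x k - t k| < ρ := fun k => by
    simp only [x, add_sub_cancel_left]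
    rw [abs_mul, abs_of_pos he, div_mul_eq_mul_div, div_lt_iff₀ (by positivity)]
    exact mul_lt_mul_of_pos_left (by linarith [hDj k]) hρ
  have hθ : ∀ k, IsShiftProfile (t k) ρ (shiftProfile (t k) 1 (x k) (x k)) := fun k =>
    isShiftProfile_shiftProfile (by simp) (hx k) (hx k)
  have h1 := hρ1 _ hθ
  have h2 := hρ2 1 x x (fun k => by simp) hx hx (fun k => Or.inl rfl) hθ
  have h3 := integral_abs_le_norm_sum_scaledControl (T := T) hsep hin hθ (one_le_pNorm_jump hrep)
  simp only [Pi.one_apply] at h2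
  set δ := ∑ k, scaledControl T (hθ k).integrable (jump a k)
  clear_value δ
  set N := ‖δ‖
  have h4 : e * ‖τ‖ ≤ N := by
    rw [← le_div_iff₀' he, pi_norm_le_iff_of_nonneg (by positivity)]
    intro k
    have := h3 k
    rw [shiftProfile_self, integral_abs_below_sub_below] at this
    simp only [x, add_sub_cancel_left] at this
    rw [abs_mul, abs_of_pos he] at this
    rwa [le_div_iff₀' he]
  simp only [shiftProfile_self, integral_below_sub_below, integral_abs_below_sub_below,
    integral_below_sub_below_mul_sub] at h1
  have h5 : ∑ j, (jump a j ⬝ᵥ derivWithin g (Icc 0 T) (t j)) * ((x j - t j) ^ 2 / 2) +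
      1 / 2 * ∑ j, ∑ k, (jump a j ⬝ᵥ (H (t j) (t k) *ᵥ jump a k)) * (x j - t j) * (x k - t k) =
      e ^ 2 / 2 * quadForm T g H a t τ := by
    rw [quadForm, mul_add, Finset.mul_sum, Finset.mul_sum, Finset.mul_sum]
    congr 1
    · refine Finset.sum_congr rfl fun j _ => ?_
      simp only [x, add_sub_cancel_left]
      ring
    · refine Finset.sum_congr rfl fun j _ => ?_
      rw [Finset.mul_sum, Finset.mul_sum]
      refine Finset.sum_congr rfl fun k _ => ?_
      simp only [x, add_sub_cancel_left]
      ring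
  have h6 : ∑ j, (x j - t j) ^ 2 / 2 + (∑ j, |x j - t j|) ^ 2 =
      e ^ 2 / 2 * (∑ j, τ j ^ 2 + 2 * D ^ 2) := by
    have h7 : ∑ j, |x j - t j| = e * D := by
      rw [Finset.mul_sum]
      refine Finset.sum_congr rfl fun j _ => ?_
      simp only [x, add_sub_cancel_left]
      rw [abs_mul, abs_of_pos he]
    have h8 : ∑ j, (x j - t j) ^ 2 / 2 = e ^ 2 / 2 * ∑ j, τ j ^ 2 := by
      rw [Finset.mul_sum]
      refine Finset.sum_congr rfl fun j _ => ?_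
      simp only [x, add_sub_cancel_left]
      ring
    rw [h7, h8]
    ring
  rw [h6] at h1
  have h9 : η / 2 * (e * ‖τ‖) ^ 2 ≤ η / 2 * N ^ 2 :=
    mul_le_mul_of_nonneg_left (pow_le_pow_left₀ (by positivity) h4 2) (by positivity)
  have h10 : e ^ 2 / 2 * (η * ‖τ‖ ^ 2) ≤ e ^ 2 / 2 *
      (quadForm T g H a t τ + ε * (∑ j, τ j ^ 2 + 2 * D ^ 2)) := by
    linarith [(abs_le.1 h1).2]
  exact le_of_mul_le_mul_left h10 (by positivity)

/-- The intermediate value is inserted between `t j - e * l` and `t j + e * (1 - l)`. These lengths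
balance the two sides, so the profile has mean zero; the Hessian term disappears and only the slope
times the positive first moment remains. -/
theorem GrowthAt.slope_ge (hT : 0 < T) (hp : 1 ≤ p) (hF : Differentiable ℝ F)
    (hF' : Differentiable ℝ (fderiv ℝ F)) (hg : IsGradient F u g)
    (hg_smooth : ContDiffOn ℝ 1 g (Icc 0 T)) (hH : IsHessian F u H)
    (hH_cont : ContinuousOn (fun x : ℝ × ℝ => H x.1 x.2) (Icc 0 T ×ˢ Icc 0 T))
    (hrep : IsMinimalRepresentation V u a t) (hη : 0 ≤ η) (hgrow : GrowthAt V F p u η)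
    {j : Fin m} (hj : j ∈ intermediate V a) :
    ∃ k > 0, η * k ≤ jump a j ⬝ᵥ derivWithin g (Icc 0 T) (t j) := by
  have h0 := hgrow.stationary hT hp hF hg hg_smooth.continuousOn hrep hη
  obtain ⟨l, hl, hν⟩ := hj
  have hl' : 0 < 1 - l := sub_pos.2 hl.2
  set κ := l * (1 - l)
  have hκ : 0 < κ := mul_pos hl.1 hl'
  set c := jump a j ⬝ᵥ derivWithin g (Icc 0 T) (t j)
  -- The first moment is `e ^ 2 * κ / 2` and the distance to `u` at least `e * κ / 4`. Comparing the
  -- slope term with `η / 2` times the squared distance gives the constant.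
  refine ⟨κ / 16, by positivity, ?_⟩
  have hc : η * κ ^ 2 / 32 ≤ c * κ / 2 := by
    refine le_of_forall_pos_le_add_mul (show 0 ≤ κ / 2 + 4 * κ ^ 2 by positivity) fun ε hε => ?_
    obtain ⟨ρ, hρ1, hρ2, hρ, hsep, hin⟩ := ((expansion hF hF' hg hg_smooth hH hH_cont
      (mem_Ioo_of_strictMono_grid hrep.strictMono) h0 hε).and
      ((hgrow.eventually_competitor hT hp hrep).and (eventually_separated hrep.strictMono))).exists
    set e := ρ / 2
    have he : 0 < e := half_pos hρ
    have heρ : e < ρ := half_lt_self hρ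
    have hel : 0 < e * l := mul_pos he hl.1
    have hel' : 0 < e * (1 - l) := mul_pos he hl'
    set L : Fin m → ℝ := fun k => if k = j then l else 1
    set x : Fin m → ℝ := fun k => if k = j then t k + e * (1 - l) else t k
    set y : Fin m → ℝ := fun k => if k = j then t k - e * l else t k
    have hL : ∀ k, L k ∈ Icc (0 : ℝ) 1 := fun k => by
      by_cases hk : k = j
      · simp [L, hk, hl.1.le, hl.2.le]
      · simp [L, hk]
    have hx : ∀ k, |x k - t k| < ρ := fun k => by
      by_cases hk : k = j
      · simp only [x, hk, if_true, add_sub_cancel_left]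
        rw [abs_of_pos hel']
        linarith
      · simp [x, hk, hρ]
    have hy : ∀ k, |y k - t k| < ρ := fun k => by
      by_cases hk : k = j
      · simp only [y, hk, if_true]
        rw [abs_of_nonpos (by linarith)]
        linarith
      · simp [y, hk, hρ]
    have hθ : ∀ k, IsShiftProfile (t k) ρ (shiftProfile (t k) (L k) (x k) (y k)) := fun k =>
      isShiftProfile_shiftProfile (hL k) (hx k) (hy k)
    have h1 := hρ1 _ hθ
    have h2 := hρ2 L x y hL hx hy (fun k => by
      by_cases hk : k = j
      · subst hk
        refine Or.inr ⟨?_, by simpa [L] using hν⟩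
        simp only [x, y, if_true]
        linarith
      · exact Or.inl (by simp [x, y, hk])) hθ
    have h3 := integral_abs_le_norm_sum_scaledControl (T := T) hsep hin hθ
      (one_le_pNorm_jump hrep) j
    set δ := ∑ k, scaledControl T (hθ k).integrable (jump a k)
    clear_value δ
    set N := ‖δ‖
    have hzero : ∀ k, k ≠ j → ∀ s, shiftProfile (t k) (L k) (x k) (y k) s = 0 := fun k hk s => by
      simp [shiftProfile, x, y, hk]
    have hb : ∀ z, |z - t j| < ρ → IsShiftProfile (t j) ρ fun s => below z s - below (t j) s :=
      fun z hz => isShiftProfile_below hz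
    have hLj : L j = l := if_pos rfl
    have hxj : x j - t j = e * (1 - l) := by simp [x]
    have hyj : y j - t j = -(e * l) := by simp [y]
    have hτj : ∫ s, shiftProfile (t j) (L j) (x j) (y j) s = 0 := by
      have := integral_add ((hb _ (hx j)).integrable.const_mul (L j))
        ((hb _ (hy j)).integrable.const_mul (1 - L j))
      rw [integral_const_mul, integral_const_mul, integral_below_sub_below,
        integral_below_sub_below, hxj, hyj, hLj] at this
      rw [hLj]
      refine this.trans ?_
      ring
    have hXj : ∫ s, shiftProfile (t j) (L j) (x j) (y j) s * (s - t j) = e ^ 2 * κ / 2 := by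
      have := integral_add ((hb _ (hx j)).integrable_mul_sub.const_mul (L j))
        ((hb _ (hy j)).integrable_mul_sub.const_mul (1 - L j))
      rw [integral_const_mul, integral_const_mul, integral_below_sub_below_mul_sub,
        integral_below_sub_below_mul_sub, hxj, hyj] at this
      refine Eq.trans ?_ (this.trans ?_)
      · congr 1
        ext s
        rw [shiftProfile]
        ring
      · rw [hLj]
        ring
    have hnj : ∫ s, |shiftProfile (t j) (L j) (x j) (y j) s| ≤ 2 * e * κ := by
      have := integral_add ((hb _ (hx j)).integrable.abs.const_mul (L j))
        ((hb _ (hy j)).integrable.abs.const_mul (1 - L j))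
      rw [integral_const_mul, integral_const_mul, integral_abs_below_sub_below,
        integral_abs_below_sub_below, hxj, hyj, abs_neg, abs_of_pos (mul_pos he hl'),
        abs_of_pos (mul_pos he hl.1)] at this
      refine le_trans (integral_mono (hθ j).integrable.abs
        (((hb _ (hx j)).integrable.abs.const_mul (L j)).add
        ((hb _ (hy j)).integrable.abs.const_mul (1 - L j))) fun s => ?_) (this.le.trans ?_)
      · refine (abs_add_le _ _).trans_eq ?_
        rw [abs_mul, abs_mul, abs_of_nonneg (hL j).1, abs_of_nonneg (sub_nonneg.2 (hL j).2)]
        rfl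
      · rw [hLj]
        simp only [κ]
        linarith
    have hnj' : e * κ / 4 ≤ N := by
      -- The first moment is at most `ρ = 2 * e` times the mass, which bounds the mass from below.
      have := (hθ j).integral_mul_sub_le
      rw [hXj] at this
      refine le_trans ?_ h3
      have h4 : ρ * (e * κ / 4) ≤ ρ * ∫ s, |shiftProfile (t j) (L j) (x j) (y j) s| := by
        refine le_trans (le_of_eq ?_) this
        simp only [e]
        ring
      exact le_of_mul_le_mul_left h4 hρ
    have hn0 : 0 ≤ ∫ s, |shiftProfile (t j) (L j) (x j) (y j) s| :=
      integral_nonneg fun s => abs_nonneg _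
    have hτ : ∀ k, ∫ s, shiftProfile (t k) (L k) (x k) (y k) s = 0 := fun k => by
      by_cases hk : k = j
      · rw [hk, hτj]
      · simp [hzero k hk]
    have hC : ∑ k, (jump a k ⬝ᵥ derivWithin g (Icc 0 T) (t k)) *
        (∫ s, shiftProfile (t k) (L k) (x k) (y k) s * (s - t k)) = c * (e ^ 2 * κ / 2) := by
      rw [Finset.sum_eq_single j (fun k _ hk => by simp [hzero k hk]) (by simp), hXj]
    have hX : ∑ k, (∫ s, shiftProfile (t k) (L k) (x k) (y k) s * (s - t k)) =
        e ^ 2 * κ / 2 := by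
      rw [Finset.sum_eq_single j (fun k _ hk => by simp [hzero k hk]) (by simp), hXj]
    have hn : ∑ k, (∫ s, |shiftProfile (t k) (L k) (x k) (y k) s|) =
        ∫ s, |shiftProfile (t j) (L j) (x j) (y j) s| :=
      Finset.sum_eq_single j (fun k _ hk => by simp [hzero k hk]) (by simp)
    rw [hC, hX, hn] at h1
    simp only [hτ, mul_zero, Finset.sum_const_zero, sub_zero] at h1
    have h5 : η / 2 * (e * κ / 4) ^ 2 ≤ η / 2 * N ^ 2 :=
      mul_le_mul_of_nonneg_left (pow_le_pow_left₀ (by positivity) hnj' 2) (by positivity)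
    have h6 : ε * (∫ s, |shiftProfile (t j) (L j) (x j) (y j) s|) ^ 2 ≤ ε * (2 * e * κ) ^ 2 :=
      mul_le_mul_of_nonneg_left (pow_le_pow_left₀ hn0 hnj 2) hε.le
    have h7 : e ^ 2 * (η * κ ^ 2 / 32) ≤ e ^ 2 * (c * κ / 2 + ε * (κ / 2 + 4 * κ ^ 2)) := by
      linarith [(abs_le.1 h1).2]
    exact le_of_mul_le_mul_left h7 (by positivity)
  have : κ / 2 * (η * (κ / 16)) ≤ κ / 2 * c := by linarith
  exact le_of_mul_le_mul_left this (by positivity)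

end

/-! ### A rearrangement bound for the first moment -/

/-- The first moment of a profile with given positive and negative mass is minimal for a profile
concentrated next to the switching time. -/
theorem IsShiftProfile.moment_ge {t ρ : ℝ} {θ : ℝ → ℝ} (h : IsShiftProfile t ρ θ) :
    ((∫ s, θ s) ^ 2 + (∫ s, |θ s|) ^ 2) / 4 ≤ ∫ s, θ s * (s - t) := by
  set τ := ∫ s, θ s
  set n := ∫ s, |θ s|
  have hτn : |τ| ≤ n := abs_integral_le_integral_abs
  have hτn' := abs_le.1 hτn
  -- The offsets `x - t` and `t - y` are the positive and the negative mass of `θ`; the extremal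
  -- profile has modulus one between `y` and `x`.
  set x := t + (n + τ) / 2
  set y := t - (n - τ) / 2
  have hx : IsShiftProfile t (|x - t| + 1) _ := isShiftProfile_below (lt_add_one _)
  have hy : IsShiftProfile t (|y - t| + 1) _ := isShiftProfile_below (lt_add_one _)
  have hx' : Integrable fun s => (below x s - below t s) * (s - t) -
      (x - t) * (below x s - below t s) := hx.integrable_mul_sub.sub (hx.integrable.const_mul _)
  have hy' : Integrable fun s => (below y s - below t s) * (s - t) -
      (y - t) * (below y s - below t s) := hy.integrable_mul_sub.sub (hy.integrable.const_mul _)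
  have hθ' : Integrable fun s => θ s * (s - t) - τ / 2 * θ s :=
    h.integrable_mul_sub.sub (h.integrable.const_mul _)
  -- With these masses as multipliers, the right side is `θ s * (s - x)` to the right of `t` and `θ
  -- s * (s - y)` to the left. As `θ` has modulus at most one, the extremal profile minimises it
  -- pointwise.
  have h_int := integral_mono_ae
    (f := fun s => ((below x s - below t s) * (s - t) - (x - t) * (below x s - below t s)) +
      ((below y s - below t s) * (s - t) - (y - t) * (below y s - below t s)))
    (g := fun s => θ s * (s - t) - τ / 2 * θ s - n / 2 * |θ s|)
    (hx'.add hy') (hθ'.sub (h.integrable.abs.const_mul _)) (by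
      filter_upwards [h.abs_le_one, h.sign, Measure.ae_ne volume t] with s h1 h2 h3
      rcases lt_or_gt_of_ne h3 with hst | hst
      · have hθ : θ s ≤ 0 := by nlinarith
        have h4 := (abs_le.1 h1).1
        rw [below_of_lt hst, below_of_lt (show s < x by simp only [x]; linarith),
          abs_of_nonpos hθ]
        rcases lt_or_ge s y with hy' | hy'
        · rw [below_of_lt hy']
          simp only [y] at hy'
          nlinarith
        · rw [below_of_le hy']
          simp only [y] at hy' ⊢
          nlinarith
      · have hθ : 0 ≤ θ s := by nlinarith
        have h4 := (abs_le.1 h1).2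
        rw [below_of_le hst.le, below_of_le (show y ≤ s by simp only [y]; linarith),
          abs_of_nonneg hθ]
        rcases lt_or_ge s x with hx' | hx'
        · rw [below_of_lt hx']
          simp only [x] at hx' ⊢
          nlinarith
        · rw [below_of_le hx']
          simp only [x] at hx'
          nlinarith)
  rw [integral_add hx' hy',
    integral_sub hx.integrable_mul_sub (hx.integrable.const_mul _),
    integral_sub hy.integrable_mul_sub (hy.integrable.const_mul _),
    integral_sub hθ' (h.integrable.abs.const_mul _),
    integral_sub h.integrable_mul_sub (h.integrable.const_mul _),
    integral_const_mul, integral_const_mul, integral_const_mul, integral_const_mul,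
    integral_below_sub_below, integral_below_sub_below, integral_below_sub_below_mul_sub,
    integral_below_sub_below_mul_sub] at h_int
  have e1 : x - t = (n + τ) / 2 := by simp [x]
  have e2 : y - t = -((n - τ) / 2) := by simp [y]
  rw [e1, e2] at h_int
  change _ ≤ _ - τ / 2 * τ - n / 2 * n at h_int
  linarith

/-! ### Nearby controls with small excess variation -/

theorem ofReal_dist_add_le_eVariationOn {E : Type*} [PseudoMetricSpace E] (f : ℝ → E) {S : Set ℝ}
    {x y z v : ℝ} (hx : x ∈ S) (hy : y ∈ S) (hz : z ∈ S) (hv : v ∈ S) (hxy : x ≤ y) (hyz : y ≤ z)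
    (hzv : z ≤ v) : ENNReal.ofReal (dist (f x) (f y) + dist (f y) (f z) + dist (f z) (f v)) ≤
      eVariationOn f S := by
  rw [ENNReal.ofReal_add (by positivity) dist_nonneg, ENNReal.ofReal_add dist_nonneg dist_nonneg,
    ← edist_dist, ← edist_dist, ← edist_dist, ← eVariationOn.pair, ← eVariationOn.pair,
    ← eVariationOn.pair]
  refine le_trans (add_le_add_left (eVariationOn.add_le_union f ?_) _)
    ((eVariationOn.add_le_union f ?_).trans (eVariationOn.mono f ?_))
  · rintro r (rfl | rfl) q (rfl | rfl) <;> linarith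
  · rintro r ((rfl | rfl) | (rfl | rfl)) q (rfl | rfl) <;> linarith
  · rintro r (((rfl | rfl) | (rfl | rfl)) | (rfl | rfl)) <;> assumption

/-- Consequences of small excess variation for a function with values in a set with gaps. -/
theorem structure_of_small_excess {E : Type*} [MetricSpace E] {f : ℝ → E} {S : Set ℝ}
    {x y γ : ℝ} (hx : x ∈ S) (hy : y ∈ S) (hxy : x ≤ y) (hne : f x ≠ f y)
    (hsep : ∀ r ∈ S, ∀ q ∈ S, f r ≠ f q → γ ≤ dist (f r) (f q))
    (hgap : ∀ s ∈ S, dist (f x) (f y) < dist (f x) (f s) + dist (f s) (f y) →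
      dist (f x) (f y) + γ ≤ dist (f x) (f s) + dist (f s) (f y))
    (hvar : eVariationOn f S < ENNReal.ofReal (dist (f x) (f y) + γ)) :
    (∀ s ∈ S, s ≤ x → f s = f x) ∧ (∀ s ∈ S, y ≤ s → f s = f y) ∧
      (∀ s ∈ S, dist (f x) (f s) + dist (f s) (f y) = dist (f x) (f y)) ∧
      ∀ s ∈ S, ∀ s' ∈ S, s ≤ s' → f s = f y → f s' ≠ f x := by
  -- Any deviation from the claims yields a chain of at most four points whose length exceeds the
  -- distance of the end values by at least `γ`. Returning from `f y` to `f x` would even cross the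
  -- jump three times.
  have key : ∀ {x₁ x₂ x₃ x₄}, x₁ ∈ S → x₂ ∈ S → x₃ ∈ S → x₄ ∈ S → x₁ ≤ x₂ → x₂ ≤ x₃ → x₃ ≤ x₄ →
      dist (f x₁) (f x₂) + dist (f x₂) (f x₃) + dist (f x₃) (f x₄) < dist (f x) (f y) + γ :=
    fun h1 h2 h3 h4 h12 h23 h34 => lt_of_not_ge fun h =>
      absurd (lt_of_le_of_lt (ofReal_dist_add_le_eVariationOn f h1 h2 h3 h4 h12 h23 h34) hvar)
        (not_lt.2 (ENNReal.ofReal_le_ofReal h))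
  have h1 : ∀ s ∈ S, s ≤ x → f s = f x := fun s hs hsx => by
    by_contra h
    have := key hs hx hy hy hsx hxy le_rfl
    rw [dist_self] at this
    linarith [hsep s hs x hx h]
  have h2 : ∀ s ∈ S, y ≤ s → f s = f y := fun s hs hys => by
    by_contra h
    have := key hx hx hy hs le_rfl hxy hys
    rw [dist_self] at this
    linarith [hsep y hy s hs (Ne.symm h)]
  refine ⟨h1, h2, fun s hs => ?_, fun s hs s' hs' hss hsy hsx => ?_⟩
  · rcases le_total s x with h | h
    · rw [h1 s hs h, dist_self, zero_add]
    rcases le_total s y with h' | h'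
    · have := key hx hs hy hy h h' le_rfl
      rw [dist_self] at this
      refine le_antisymm (not_lt.1 fun h3 => ?_) (dist_triangle _ _ _)
      linarith [hgap s hs h3]
    · rw [h2 s hs h', dist_self, add_zero]
  · rcases le_total s x with h | h
    · exact hne ((h1 s hs h).symm.trans hsy)
    rcases le_total s' y with h' | h'
    · have := key hx hs hs' hy h hss h'
      rw [hsy, hsx, dist_comm (f y) (f x)] at this
      linarith [hsep x hx y hy hne, dist_nonneg (x := f x) (y := f y)]
    · exact hne (hsx.symm.trans (h2 s' hs' h'))

theorem exists_gap {E : Type*} [MetricSpace E] (W : Set E) (hW : W.Finite) :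
    ∃ γ > 0, (∀ a ∈ W, ∀ b ∈ W, a ≠ b → γ ≤ dist a b) ∧ ∀ a ∈ W, ∀ b ∈ W, ∀ c ∈ W,
      dist a c < dist a b + dist b c → dist a c + γ ≤ dist a b + dist b c := by
  have h1 : ∀ᶠ γ in 𝓝[>] (0 : ℝ), ∀ a ∈ W, ∀ b ∈ W, a ≠ b → γ ≤ dist a b := by
    refine (eventually_all_finite hW).2 fun a _ => (eventually_all_finite hW).2 fun b _ => ?_
    by_cases hab : a = b
    · simp [hab]
    · filter_upwards [Ioo_mem_nhdsGT (dist_pos.2 hab)] with γ hγ _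
      exact hγ.2.le
  have h2 : ∀ᶠ γ in 𝓝[>] (0 : ℝ), ∀ a ∈ W, ∀ b ∈ W, ∀ c ∈ W,
      dist a c < dist a b + dist b c → dist a c + γ ≤ dist a b + dist b c := by
    refine (eventually_all_finite hW).2 fun a _ => (eventually_all_finite hW).2 fun b _ =>
      (eventually_all_finite hW).2 fun c _ => ?_
    by_cases h : dist a c < dist a b + dist b c
    · filter_upwards [Ioo_mem_nhdsGT (sub_pos.2 h)] with γ hγ _
      linarith [hγ.2]
    · simp [h]
  obtain ⟨γ, hγ1, hγ2, hγ⟩ := (h1.and (h2.and eventually_mem_nhdsWithin)).exists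
  exact ⟨γ, hγ, hγ1, hγ2⟩

/-- Two integer controls that are close in `L¹` agree somewhere in every interval that is not
too short. -/
theorem exists_mem_Ioo_eq {M : ℕ} {T : ℝ} {w u : ControlSpace M T} {P : ℝ → Prop}
    (hP : ∀ᵐ s ∂(volume : Measure ℝ).restrict (Ioo 0 T), P s)
    (hw : ∀ᵐ s ∂(volume : Measure ℝ).restrict (Ioo 0 T), ∃ ν : Fin M → ℤ, (w s).ofLp = toReal ν)
    (hu : ∀ᵐ s ∂(volume : Measure ℝ).restrict (Ioo 0 T), ∃ ν : Fin M → ℤ, (u s).ofLp = toReal ν)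
    {x y : ℝ} (hx : 0 ≤ x) (hy : y ≤ T) (hxy : ‖w - u‖ < y - x) :
    ∃ s ∈ Ioo x y, P s ∧ (w s).ofLp = (u s).ofLp := by
  by_contra! hcon
  refine absurd hxy (not_lt.2 ?_)
  have hsub : Ioo x y ⊆ Ioo 0 T := Ioo_subset_Ioo hx hy
  have hlt : x < y := by linarith [norm_nonneg (w - u)]
  have hi : Integrable (fun s => pNorm 1 ((w - u) s).ofLp) (volume.restrict (Ioo 0 T)) :=
    (L1.integrable_coeFn (w - u)).norm
  rw [norm_control_eq]
  calc y - x = ∫ _ in Ioo x y, (1 : ℝ) := by simp [hlt.le]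
    _ ≤ ∫ s in Ioo x y, pNorm 1 ((w - u) s).ofLp := by
        refine integral_mono_ae (integrableOn_const (by simp)) (hi.mono_measure
          (Measure.restrict_mono hsub le_rfl)) ?_
        have hall : ∀ᵐ s ∂(volume : Measure ℝ).restrict (Ioo 0 T), P s ∧
            (∃ ν : Fin M → ℤ, (w s).ofLp = toReal ν) ∧ (∃ ν : Fin M → ℤ, (u s).ofLp = toReal ν) ∧
            ((w - u) s) = w s - u s := by
          filter_upwards [hP, hw, hu, Lp.coeFn_sub w u] with s h1 h2 h3 h4
          exact ⟨h1, h2, h3, h4⟩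
        filter_upwards [ae_restrict_of_ae_restrict_of_subset hsub hall,
          ae_restrict_mem measurableSet_Ioo] with s ⟨h1, ⟨ν, hν⟩, ⟨ν', hν'⟩, h4⟩ hs
        have hne : ν ≠ ν' := by
          rintro rfl
          exact hcon s hs h1 (hν.trans hν'.symm)
        rw [h4, WithLp.ofLp_sub, hν, hν']
        exact one_le_pNorm_toReal_sub le_rfl hne
    _ ≤ ∫ s in Ioo 0 T, pNorm 1 ((w - u) s).ofLp :=
        setIntegral_mono_set hi (Eventually.of_forall fun s => pNorm_nonneg le_rfl _)
          hsub.eventuallyLE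

section

variable {M m : ℕ} {T : ℝ} {V : Finset (Fin M → ℤ)}
  {p : ℝ≥0∞} {u w : ControlSpace M T} {a : Fin (m + 1) → Fin M → ℤ} {t : Fin m → ℝ}

/-- Points `x` and `y` on the two sides where `w` agrees with `u` fix the end values of the jump.
With excess below `γ`, every value of `w` in the cell realises equality in the triangle inequality,
so strict convexity puts it on the segment between them. -/
theorem eq_shift_of_small_excess [Fact (1 ≤ p)] (hp1 : 1 < p) (hp2 : p < ∞)
    (hrep : IsMinimalRepresentation V u a t) {ρ γ : ℝ}
    (hsep : ∀ i j, i ≠ j → 2 * ρ ≤ |t i - t j|) (hin : ∀ j, ρ ≤ t j ∧ t j + ρ ≤ T)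
    {G : Set ℝ} (hG : ∀ s ∈ G, (u s).ofLp = jumpForm a t s ∧ ∃ ν ∈ V, (w s).ofLp = toReal ν)
    (hGae : ∀ᵐ s ∂(volume : Measure ℝ).restrict (Ioo 0 T), s ∈ G) (j : Fin m)
    {W : Set (PiLp p fun _ : Fin M => ℝ)} (hW : ∀ ν ∈ V, WithLp.toLp p (toReal ν) ∈ W)
    (hγ1 : ∀ a ∈ W, ∀ b ∈ W, a ≠ b → γ ≤ dist a b)
    (hγ2 : ∀ a ∈ W, ∀ b ∈ W, ∀ c ∈ W,
      dist a c < dist a b + dist b c → dist a c + γ ≤ dist a b + dist b c)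
    {x y : ℝ} (hx : x ∈ Ioo (t j - ρ) (t j)) (hxG : x ∈ G) (hxw : (w x).ofLp = (u x).ofLp)
    (hy : y ∈ Ioo (t j) (t j + ρ)) (hyG : y ∈ G) (hyw : (w y).ofLp = (u y).ofLp)
    (hvar : eVariationOn (fun s => (WithLp.toLp p (w s).ofLp : PiLp p (fun _ : Fin M => ℝ)))
      (G ∩ cell t j) < ENNReal.ofReal (pNorm p (jump a j) + γ)) :
    ∃ θ, IsShiftProfile (t j) ρ θ ∧
      (∀ s ∈ G, s ∈ cell t j → (w s).ofLp = (u s).ofLp + θ s • jump a j) ∧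
      (j ∉ intermediate V a → ∃ σ, ∀ᵐ s, θ s = below σ s - below (t j) s) := by
  have ht := strictMono_of_strictMono_grid hrep.strictMono
  have : StrictConvexSpace ℝ (PiLp p fun _ : Fin M => ℝ) := strictConvexSpace_piLp hp1 hp2
  set f : ℝ → PiLp p (fun _ : Fin M => ℝ) := fun s => WithLp.toLp p (w s).ofLp with hf
  set S := G ∩ cell t j
  have hucell : ∀ s ∈ S, (u s).ofLp = toReal (a j.succ) + below (t j) s • jump a j := fun s hs =>
    (hG s hs.1).1.trans (jumpForm_of_mem_cell a ht hs.2)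
  have hjump : toReal (a j.succ) + jump a j = toReal (a j.castSucc) := by
    rw [jump, add_sub_cancel]
  have hxS : x ∈ S := ⟨hxG, mem_cell_of_abs_lt hsep
    (abs_lt.2 ⟨by linarith [hx.1], by linarith [hx.1, hx.2, hy.1, hy.2]⟩)⟩
  have hyS : y ∈ S := ⟨hyG, mem_cell_of_abs_lt hsep
    (abs_lt.2 ⟨by linarith [hx.1, hx.2, hy.1], by linarith [hy.2]⟩)⟩
  have hwx : (w x).ofLp = toReal (a j.castSucc) := by
    rw [hxw, hucell x hxS, below_of_lt hx.2, one_smul, hjump]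
  have hwy : (w y).ofLp = toReal (a j.succ) := by
    rw [hyw, hucell y hyS, below_of_le hy.1.le, zero_smul, add_zero]
  have hfinj : ∀ r q, f r = f q ↔ (w r).ofLp = (w q).ofLp := fun r q =>
    (WithLp.toLp_injective p).eq_iff
  have hfW : ∀ s ∈ S, f s ∈ W := fun s hs => by
    obtain ⟨ν, hν, h⟩ := (hG s hs.1).2
    rw [hf]
    simp only [h]
    exact hW ν hν
  have hdist : dist (f x) (f y) = pNorm p (jump a j) := by
    rw [dist_eq_norm, hf]
    simp only [hwx, hwy]
    rw [← WithLp.toLp_sub]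
    rfl
  have hjne : jump a j ≠ 0 := fun h =>
    hrep.ne j (toReal_injective (sub_eq_zero.1 h))
  have hne : f x ≠ f y := by
    rw [Ne, hfinj, hwx, hwy]
    exact fun h => hrep.ne j (toReal_injective h)
  rw [← hdist] at hvar
  obtain ⟨c1, c2, c3, c4⟩ := structure_of_small_excess hxS hyS (hx.2.trans hy.1).le hne
    (fun r hr q hq => hγ1 _ (hfW r hr) _ (hfW q hq))
    (fun s hs => hγ2 _ (hfW x hxS) _ (hfW s hs) _ (hfW y hyS)) hvar
  have hlam : ∀ s ∈ S, ∃ l ∈ Icc (0 : ℝ) 1,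
      (w s).ofLp = toReal (a j.succ) + l • jump a j := fun s hs => by
    obtain ⟨r, hr, hrs⟩ := dist_add_dist_eq_iff.1 (c3 s hs)
    refine ⟨1 - r, ⟨sub_nonneg.2 hr.2, by linarith [hr.1]⟩, ?_⟩
    have h1 := congrArg WithLp.ofLp hrs
    rw [AffineMap.lineMap_apply_module] at h1
    simp only [hf, WithLp.ofLp_add, WithLp.ofLp_smul, hwx, hwy] at h1
    rw [← h1, jump]
    module
  -- Since `w - u` is a multiple of the jump on `S`, projecting onto the jump recovers the factor
  -- and makes it integrable. Outside the window `w` equals `u` on the cell, because `x` and `y` lie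
  -- in the window.
  set θ : ℝ → ℝ := (Ioo (t j - ρ) (t j + ρ)).indicator fun s =>
    (jump a j ⬝ᵥ ((w s).ofLp - (u s).ofLp)) / (jump a j ⬝ᵥ jump a j) with hθdef
  have hdot : jump a j ⬝ᵥ jump a j ≠ 0 := fun h => hjne (dotProduct_self_eq_zero.1 h)
  have hθ0 : ∀ s, ρ ≤ |s - t j| → θ s = 0 := fun s hs => by
    refine indicator_of_notMem (fun h => ?_) _
    exact absurd hs (not_le.2 (abs_lt.2 ⟨by linarith [h.1], by linarith [h.2]⟩))
  have hθ : ∀ s ∈ S, |s - t j| < ρ → ∀ l : ℝ,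
      (w s).ofLp = toReal (a j.succ) + l • jump a j → θ s = l - below (t j) s :=
    fun s hs hst l hl => by
      have h' := abs_lt.1 hst
      rw [hθdef, indicator_of_mem (show s ∈ Ioo (t j - ρ) (t j + ρ) from
        ⟨by linarith, by linarith⟩), hl, hucell s hs, add_sub_add_left_eq_sub, ← sub_smul,
        dotProduct_smul, smul_eq_mul, mul_div_assoc, div_self hdot, mul_one]
  have hGae' : ∀ᵐ s, s ∈ Ioo 0 T → s ∈ G := (ae_restrict_iff' measurableSet_Ioo).1 hGae
  have hnear : ∀ᵐ s, |s - t j| < ρ → s ∈ S := by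
    filter_upwards [hGae'] with s hs hst
    have h' := abs_lt.1 hst
    exact ⟨hs ⟨by linarith [(hin j).1], by linarith [(hin j).2]⟩, mem_cell_of_abs_lt hsep hst⟩
  refine ⟨θ, ⟨?_, hθ0, ?_, ?_⟩, ?_, ?_⟩
  · refine (integrable_indicator_iff measurableSet_Ioo).2 (Integrable.div_const ?_ _)
    refine IntegrableOn.mono_set (t := Ioo 0 T) ?_
      (Ioo_subset_Ioo (by linarith [(hin j).1]) (hin j).2)
    exact integrable_finsetSum _ fun k _ =>
      ((integrable_coord w k).sub (integrable_coord u k)).const_mul _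
  · filter_upwards [hnear] with s hs
    by_cases hst : |s - t j| < ρ
    · obtain ⟨l, hl, hwl⟩ := hlam s (hs hst)
      rw [hθ s (hs hst) hst l hwl, abs_le]
      have h1 := below_nonneg (t j) s
      have h2 := below_le_one (t j) s
      exact ⟨by linarith [hl.1], by linarith [hl.2]⟩
    · rw [hθ0 s (not_lt.1 hst)]
      simp
  · filter_upwards [hnear] with s hs
    by_cases hst : |s - t j| < ρ
    · obtain ⟨l, hl, hwl⟩ := hlam s (hs hst)
      rw [hθ s (hs hst) hst l hwl]
      rcases lt_or_ge s (t j) with h | h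
      · rw [below_of_lt h]
        exact mul_nonneg_of_nonpos_of_nonpos (by linarith [hl.2]) (by linarith)
      · rw [below_of_le h, sub_zero]
        exact mul_nonneg hl.1 (by linarith)
    · rw [hθ0 s (not_lt.1 hst)]
      simp
  · intro s hsG hsc
    have hs : s ∈ S := ⟨hsG, hsc⟩
    by_cases hst : |s - t j| < ρ
    · obtain ⟨l, hl, hwl⟩ := hlam s hs
      rw [hθ s hs hst l hwl, hwl, hucell s hs, add_assoc, ← add_smul, add_sub_cancel]
    · rw [hθ0 s (not_lt.1 hst), zero_smul, add_zero, hucell s hs]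
      rcases le_abs.1 (not_lt.1 hst) with h | h
      · have h1 := (hfinj _ _).1 (c2 s hs (by linarith [hy.2]))
        rw [h1, hwy, below_of_le (by linarith [hy.1, hy.2]), zero_smul, add_zero]
      · have h1 := (hfinj _ _).1 (c1 s hs (by linarith [hx.1]))
        rw [h1, hwx, below_of_lt (by linarith [hx.1, hx.2]), one_smul, hjump]
  · intro hj
    have hbin : ∀ s ∈ S, f s = f x ∨ f s = f y := fun s hs => by
      obtain ⟨l, hl, hwl⟩ := hlam s hs
      rcases hl.1.eq_or_lt with h0 | h0
      · right
        rw [hfinj, hwl, ← h0, zero_smul, add_zero, hwy]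
      rcases hl.2.eq_or_lt with h1 | h1
      · left
        rw [hfinj, hwl, h1, one_smul, hjump, hwx]
      · obtain ⟨ν, hν, hνs⟩ := (hG s hs.1).2
        refine absurd ⟨l, ⟨h0, h1⟩, ν, hν, ?_⟩ hj
        rw [← hνs, hwl, jump]
        module
    -- Only the two end values occur and `w` never returns to the first one, so it switches once, at
    -- the supremum of `R`.
    set R := {s ∈ S | f s = f x}
    have hRy : ∀ s ∈ R, s ≤ y := fun s hs => by
      by_contra! h
      exact hne (hs.2.symm.trans (c2 s hs.1 h.le))
    have hRb : BddAbove R := ⟨y, hRy⟩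
    have hxR : x ∈ R := ⟨hxS, rfl⟩
    refine ⟨sSup R, ?_⟩
    have hσx : x ≤ sSup R := le_csSup hRb hxR
    have hσy : sSup R ≤ y := csSup_le ⟨x, hxR⟩ hRy
    filter_upwards [hnear, Measure.ae_ne volume (sSup R)] with s hs hsσ
    by_cases hst : |s - t j| < ρ
    · have hsS := hs hst
      rcases lt_or_gt_of_ne hsσ with h | h
      · obtain ⟨s', hs'R, hss'⟩ := exists_lt_of_lt_csSup ⟨x, hxR⟩ h
        have hfs : f s = f x := (hbin s hsS).resolve_right fun h' =>
          c4 s hsS s' hs'R.1 hss'.le h' hs'R.2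
        rw [below_of_lt h, hθ s hsS hst 1]
        rw [(hfinj _ _).1 hfs, hwx, one_smul, hjump]
      · have hfs : f s = f y := (hbin s hsS).resolve_left fun h' =>
          absurd (le_csSup hRb ⟨hsS, h'⟩) (not_le.2 h)
        rw [below_of_le h.le, hθ s hsS hst 0]
        rw [(hfinj _ _).1 hfs, hwy, zero_smul, add_zero]
    · rw [hθ0 s (not_lt.1 hst)]
      rcases le_abs.1 (not_lt.1 hst) with h | h
      · rw [below_of_le (by linarith [hy.2]), below_of_le (by linarith [hy.1, hy.2]), sub_zero]
      · rw [below_of_lt (by linarith [hx.1]), below_of_lt (by linarith [hx.1, hx.2]), sub_self]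

end

/-- `w` arises from `u` by perturbations near the switching times, which are shifts at the jumps
without intermediate values in `V`. -/
structure IsShiftOf {M m : ℕ} {T : ℝ} (V : Finset (Fin M → ℤ)) (u w : ControlSpace M T)
    (a : Fin (m + 1) → Fin M → ℤ) (t : Fin m → ℝ) (ρ : ℝ) (θ : Fin m → ℝ → ℝ) : Prop where
  profile : ∀ j, IsShiftProfile (t j) ρ (θ j)
  eq : w = u + ∑ j, scaledControl T (profile j).integrable (jump a j)
  shift : ∀ j, j ∉ intermediate V a → ∃ σ, ∀ᵐ s, θ j s = below σ s - below (t j) s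

section

variable {M m : ℕ} {T : ℝ} {V : Finset (Fin M → ℤ)}
  {p : ℝ≥0∞} {u w : ControlSpace M T} {a : Fin (m + 1) → Fin M → ℤ} {t : Fin m → ℝ}

/-- A pure shift is an indicator with one sign; its mass and first moment are functions of the
displacement. -/
theorem IsShiftOf.abs_integral_eq {ρ : ℝ} {θ : Fin m → ℝ → ℝ} (h : IsShiftOf V u w a t ρ θ)
    {j : Fin m} (hj : j ∉ intermediate V a) :
    ∫ s, |θ j s| = |∫ s, θ j s| ∧ ∫ s, θ j s * (s - t j) = (∫ s, θ j s) ^ 2 / 2 := by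
  obtain ⟨σ, hσ⟩ := h.shift j hj
  rw [integral_congr_ae hσ, integral_below_sub_below]
  constructor
  · rw [← integral_abs_below_sub_below]
    exact integral_congr_ae (hσ.mono fun s hs => by simp only [hs])
  · rw [← integral_below_sub_below_mul_sub]
    exact integral_congr_ae (hσ.mono fun s hs => by simp only [hs])

theorem IsMinimalRepresentation.ae_exists_eq_toReal (hrep : IsMinimalRepresentation V u a t) :
    ∀ᵐ s ∂(volume : Measure ℝ).restrict (Ioo 0 T), ∃ ν : Fin M → ℤ, (u s).ofLp = toReal ν := by
  filter_upwards [hrep.ae_eq_jumpForm] with s hs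
  obtain ⟨j, h1, h2⟩ := exists_index (strictMono_of_strictMono_grid hrep.strictMono).monotone s
  exact ⟨a j, hs.trans (jumpForm_eq a j h1 h2)⟩

/-- An admissible control close to `u` either has a definitely larger total variation or is a
perturbation of `u` near the switching times. -/
theorem IsMinimalRepresentation.dichotomy (hT : 0 < T) [Fact (1 ≤ p)] (hp1 : 1 < p) (hp2 : p < ∞) (hm : m ≠ 0)
    (hrep : IsMinimalRepresentation V u a t) {W : Set (PiLp p fun _ : Fin M => ℝ)}
    (hW : ∀ ν ∈ V, WithLp.toLp p (toReal ν) ∈ W) {γ : ℝ} (hγ : 0 < γ)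
    (hγ1 : ∀ a ∈ W, ∀ b ∈ W, a ≠ b → γ ≤ dist a b)
    (hγ2 : ∀ a ∈ W, ∀ b ∈ W, ∀ c ∈ W,
      dist a c < dist a b + dist b c → dist a c + γ ≤ dist a b + dist b c) {ρ : ℝ}
    (hsep : ∀ i j, i ≠ j → 2 * ρ ≤ |t i - t j|) (hin : ∀ j, ρ ≤ t j ∧ t j + ρ ≤ T)
    (hw : w ∈ admissible T V) (hwu : ‖w - u‖ < ρ) :
    TV p u + ENNReal.ofReal γ ≤ TV p w ∨ TV p u ≤ TV p w ∧ ∃ θ, IsShiftOf V u w a t ρ θ := by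
  have : Nonempty (Fin m) := ⟨⟨0, Nat.pos_of_ne_zero hm⟩⟩
  have ht := strictMono_of_strictMono_grid hrep.strictMono
  have htT := mem_Ioo_of_strictMono_grid hrep.strictMono
  set G := {s | (s ∈ Ioo 0 T ∧ IsRegularPoint w s) ∧
    (u s).ofLp = jumpForm a t s ∧ ∃ ν ∈ V, (w s).ofLp = toReal ν}
  have hGae : ∀ᵐ s ∂(volume : Measure ℝ).restrict (Ioo 0 T), s ∈ G := by
    filter_upwards [ae_restrict_mem measurableSet_Ioo, ae_isRegularPoint w, hrep.ae_eq_jumpForm,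
      hw.2] with s h1 h2 h3 h4
    exact ⟨⟨h1, h2⟩, h3, h4⟩
  have hwZ : ∀ᵐ s ∂(volume : Measure ℝ).restrict (Ioo 0 T),
      ∃ ν : Fin M → ℤ, (w s).ofLp = toReal ν := hw.2.mono fun s ⟨ν, _, h⟩ => ⟨ν, h⟩
  have huZ := hrep.ae_exists_eq_toReal
  -- Where two integer controls differ, they are at least one apart in the 1-norm. Closeness below
  -- `ρ` therefore forces agreement somewhere in each half window.
  choose x hx hxG using fun j => exists_mem_Ioo_eq hGae hwZ huZ
    (show 0 ≤ t j - ρ by linarith [(hin j).1]) (htT j).2.le (by linarith)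
  choose y hy hyG using fun j => exists_mem_Ioo_eq hGae hwZ huZ (htT j).1.le (hin j).2
    (by linarith)
  set f : ℝ → PiLp p (fun _ : Fin M => ℝ) := fun s => WithLp.toLp p (w s).ofLp with hf
  have hvar : ∀ j, ENNReal.ofReal (pNorm p (jump a j)) ≤ eVariationOn f (G ∩ cell t j) :=
    fun j => by
    have hρ : t j - ρ < t j ∧ t j < t j + ρ :=
      ⟨(hx j).1.trans (hx j).2, (hy j).1.trans (hy j).2⟩
    have hxc : x j ∈ cell t j := mem_cell_of_abs_lt hsep
      (abs_lt.2 ⟨by linarith [(hx j).1], by linarith [(hx j).2]⟩)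
    have hyc : y j ∈ cell t j := mem_cell_of_abs_lt hsep
      (abs_lt.2 ⟨by linarith [(hy j).1], by linarith [(hy j).2]⟩)
    refine le_trans (le_of_eq ?_) (eVariationOn.edist_le _ ⟨(hxG j).1, hxc⟩ ⟨(hyG j).1, hyc⟩)
    rw [hf]
    simp only [(hxG j).2, (hyG j).2, (hxG j).1.2.1, (hyG j).1.2.1]
    rw [jumpForm_of_mem_cell a ht hxc, jumpForm_of_mem_cell a ht hyc,
      below_of_lt (hx j).2, below_of_le (hy j).1.le, edist_dist, dist_eq_norm, ← WithLp.toLp_sub,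
      pNorm]
    congr 3
    simp
  have hsum := sum_eVariationOn_cell_le_TV (p := p) w (G := G) (fun x hx => hx.1) ht
  have hTVu := hrep.TV_eq hT hp1.le
  rw [ENNReal.ofReal_sum_of_nonneg fun j _ => pNorm_nonneg hp1.le _] at hTVu
  -- Every cell carries at least its jump, so an excess of `γ` in a single cell is an excess in
  -- total.
  by_cases hbig : ∃ i, ENNReal.ofReal (pNorm p (jump a i) + γ) ≤ eVariationOn f (G ∩ cell t i)
  · obtain ⟨i, hi⟩ := hbig
    left
    calc TV p u + ENNReal.ofReal γ = ∑ j, (ENNReal.ofReal (pNorm p (jump a j)) +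
          if j = i then ENNReal.ofReal γ else 0) := by
          rw [hTVu, Finset.sum_add_distrib]
          simp
      _ ≤ ∑ j, eVariationOn f (G ∩ cell t j) := by
          refine Finset.sum_le_sum fun j _ => ?_
          split_ifs with hji
          · rw [hji, ← ENNReal.ofReal_add (pNorm_nonneg hp1.le _) hγ.le]
            exact hi
          · rw [add_zero]
            exact hvar j
      _ ≤ TV p w := hsum
  · push Not at hbig
    right
    refine ⟨hTVu.trans_le ((Finset.sum_le_sum fun j _ => hvar j).trans hsum), ?_⟩
    choose θ hθ hθw hθs using fun j => eq_shift_of_small_excess hp1 hp2 hrep hsep hin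
      (G := G) (fun s hs => hs.2) hGae j hW hγ1 hγ2 (hx j) (hxG j).1 (hxG j).2 (hy j) (hyG j).1
      (hyG j).2 (hbig j)
    refine ⟨θ, hθ, Lp.ext ?_, hθs⟩
    filter_upwards [hGae, Lp.coeFn_add u (∑ j, scaledControl T (hθ j).integrable (jump a j)),
      sum_scaledControl_ae (T := T) (fun j => (hθ j).integrable) (jump a)] with s h1 h2 h3
    obtain ⟨j, hj⟩ := exists_mem_cell t s
    refine WithLp.ofLp_injective 1 ?_
    rw [h2, Pi.add_apply, WithLp.ofLp_add, h3, hθw j s h1 hj, Finset.sum_eq_single j]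
    · intro k _ hk
      rw [(hθ k).eq_zero s, zero_smul]
      have h4 := hsep k j hk
      have h5 := abs_sub_le (t k) s (t j)
      rw [abs_sub_comm (t k) s] at h5
      linarith [hj k]
    · simp

/-- Without switching times there are no cells. Here `w` agrees with the constant `u` somewhere, and
any other value costs at least `γ`. -/
theorem IsMinimalRepresentation.dichotomy_of_const (hT : 0 < T) [hp : Fact (1 ≤ p)] (hm : m = 0)
    (hrep : IsMinimalRepresentation V u a t) {W : Set (PiLp p fun _ : Fin M => ℝ)}
    (hW : ∀ ν ∈ V, WithLp.toLp p (toReal ν) ∈ W) {γ : ℝ}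
    (hγ1 : ∀ a ∈ W, ∀ b ∈ W, a ≠ b → γ ≤ dist a b) (ρ : ℝ)
    (hw : w ∈ admissible T V) (hwu : ‖w - u‖ < T) :
    TV p u + ENNReal.ofReal γ ≤ TV p w ∨ TV p u ≤ TV p w ∧ ∃ θ, IsShiftOf V u w a t ρ θ := by
  subst hm
  have hTVu := hrep.TV_eq hT hp.out
  rw [Finset.univ_eq_empty, Finset.sum_empty, ENNReal.ofReal_zero] at hTVu
  rw [hTVu, zero_add]
  set G := {s | (s ∈ Ioo 0 T ∧ IsRegularPoint w s) ∧
    (u s).ofLp = jumpForm a t s ∧ ∃ ν ∈ V, (w s).ofLp = toReal ν}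
  have hGae : ∀ᵐ s ∂(volume : Measure ℝ).restrict (Ioo 0 T), s ∈ G := by
    filter_upwards [ae_restrict_mem measurableSet_Ioo, ae_isRegularPoint w, hrep.ae_eq_jumpForm,
      hw.2] with s h1 h2 h3 h4
    exact ⟨⟨h1, h2⟩, h3, h4⟩
  obtain ⟨q, -, hqG, hq⟩ := exists_mem_Ioo_eq hGae (hw.2.mono fun s ⟨ν, _, h⟩ => ⟨ν, h⟩)
    hrep.ae_exists_eq_toReal le_rfl le_rfl (by linarith)
  have hconst : ∀ s ∈ G, (u s).ofLp = toReal (a (Fin.last 0)) := fun s hs => by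
    rw [hs.2.1, jumpForm, Finset.univ_eq_empty, Finset.sum_empty, add_zero]
  by_cases h : ∀ s ∈ G, (w s).ofLp = (w q).ofLp
  · refine Or.inr ⟨zero_le, fun j => j.elim0, fun j => j.elim0, Lp.ext ?_, fun j => j.elim0⟩
    rw [Finset.univ_eq_empty, Finset.sum_empty, add_zero]
    filter_upwards [hGae] with s hs
    refine WithLp.ofLp_injective 1 ?_
    rw [h s hs, hq, hconst s hs, hconst q hqG]
  · push Not at h
    obtain ⟨s, hs, hsq⟩ := h
    left
    have h1 := eVariationOn.edist_le (fun s => (WithLp.toLp p (w s).ofLp :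
      PiLp p (fun _ : Fin M => ℝ))) hs hqG
    refine le_trans ?_ (h1.trans (eVariationOn_le_TV w fun x hx => hx.1))
    rw [edist_dist]
    have hmem : ∀ r ∈ G, WithLp.toLp p (w r).ofLp ∈ W := fun r hr => by
      obtain ⟨ν, hν, h⟩ := hr.2.2
      rw [h]
      exact hW ν hν
    exact ENNReal.ofReal_le_ofReal (hγ1 _ (hmem s hs) _ (hmem q hqG)
      fun h => hsq (WithLp.toLp_injective p h))

/-- Close to `u`, the total variation has a gap above its value at `u`, except at perturbations
of `u` near the switching times. -/
theorem IsMinimalRepresentation.exists_gap (hT : 0 < T) (hp1 : 1 < p) (hp2 : p < ∞)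
    (hrep : IsMinimalRepresentation V u a t) :
    ∃ γ > 0, ∀ᶠ ρ in 𝓝[>] (0 : ℝ), ∃ ε > 0, ∀ w ∈ admissible T V, ‖w - u‖ ≤ ε →
      TV p u + ENNReal.ofReal γ ≤ TV p w ∨ TV p u ≤ TV p w ∧ ∃ θ, IsShiftOf V u w a t ρ θ := by
  have : Fact (1 ≤ p) := ⟨hp1.le⟩
  obtain ⟨γ, hγ, hγ1, hγ2⟩ := SwitchingControl.exists_gap
    ((fun ν : Fin M → ℤ => (WithLp.toLp p (toReal ν) : PiLp p fun _ : Fin M => ℝ)) '' V)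
    (V.finite_toSet.image _)
  have hW : ∀ ν ∈ V, (WithLp.toLp p (toReal ν) : PiLp p fun _ : Fin M => ℝ) ∈
      (fun ν : Fin M → ℤ => (WithLp.toLp p (toReal ν) : PiLp p fun _ : Fin M => ℝ)) '' V :=
    fun ν hν => mem_image_of_mem _ hν
  refine ⟨γ, hγ, ?_⟩
  filter_upwards [eventually_separated hrep.strictMono] with ρ ⟨hρ, hsep, hin⟩
  -- The bound by `T` serves the case without switching times.
  refine ⟨min ρ T / 2, by positivity, fun w hw hwu => ?_⟩
  have hlt : ‖w - u‖ < min ρ T := hwu.trans_lt (half_lt_self (by positivity))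
  by_cases hm : m = 0
  · exact hrep.dichotomy_of_const hT hm hW hγ1 ρ hw (hlt.trans_le (min_le_right _ _))
  · exact hrep.dichotomy hT hp1 hp2 hm hW hγ hγ1 hγ2 hsep hin hw (hlt.trans_le (min_le_left _ _))

end

/-! ### Coercivity and quadratic growth -/

/-- Positivity on the compact unit sphere is uniform, and homogeneity of degree two extends the
bound to all vectors. -/
theorem quadForm_coercive {M m : ℕ} {T : ℝ} {g : ℝ → Fin M → ℝ}
    {H : ℝ → ℝ → Matrix (Fin M) (Fin M) ℝ} {a : Fin (m + 1) → Fin M → ℤ} {t : Fin m → ℝ}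
    (h : ∀ τ : Fin m → ℝ, τ ≠ 0 → 0 < quadForm T g H a t τ) :
    ∃ κ > 0, ∀ τ : Fin m → ℝ, κ * ∑ j, τ j ^ 2 ≤ quadForm T g H a t τ := by
  have hcont : Continuous (quadForm T g H a t) := by
    unfold quadForm
    fun_prop
  have hhom : ∀ (r : ℝ) (τ : Fin m → ℝ),
      quadForm T g H a t (r • τ) = r ^ 2 * quadForm T g H a t τ := fun r τ => by
    simp only [quadForm, Pi.smul_apply, smul_eq_mul, mul_add, Finset.mul_sum]
    congr 1
    · exact Finset.sum_congr rfl fun j _ => by ring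
    · exact Finset.sum_congr rfl fun j _ => Finset.sum_congr rfl fun k _ => by ring
  have hsphere : ∃ κ > 0, ∀ τ ∈ Metric.sphere (0 : Fin m → ℝ) 1, κ ≤ quadForm T g H a t τ := by
    rcases (Metric.sphere (0 : Fin m → ℝ) 1).eq_empty_or_nonempty with he | hne
    · exact ⟨1, one_pos, by simp [he]⟩
    · obtain ⟨τ₀, hτ₀, hmin⟩ := (isCompact_sphere _ _).exists_isMinOn hne hcont.continuousOn
      refine ⟨_, h τ₀ ?_, fun τ hτ => hmin hτ⟩
      rintro rfl
      simp at hτ₀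
  obtain ⟨κ, hκ, hκ'⟩ := hsphere
  refine ⟨κ / (m + 1), by positivity, fun τ => ?_⟩
  have h1 : ∑ j, τ j ^ 2 ≤ (m + 1) * ‖τ‖ ^ 2 := by
    calc ∑ j, τ j ^ 2 ≤ ∑ _j : Fin m, ‖τ‖ ^ 2 := Finset.sum_le_sum fun j _ => by
          rw [← sq_abs]
          exact pow_le_pow_left₀ (abs_nonneg _) (norm_le_pi_norm τ j) 2
      _ ≤ (m + 1) * ‖τ‖ ^ 2 := by
          rw [Finset.sum_const, Finset.card_univ, Fintype.card_fin, nsmul_eq_mul]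
          nlinarith [sq_nonneg ‖τ‖]
  have h2 : κ * ‖τ‖ ^ 2 ≤ quadForm T g H a t τ := by
    by_cases hτ : τ = 0
    · have := hhom 0 0
      rw [zero_smul, zero_pow two_ne_zero, zero_mul] at this
      simp [hτ, this]
    · have hn : ‖τ‖ ≠ 0 := norm_ne_zero_iff.2 hτ
      have h3 := hκ' (‖τ‖⁻¹ • τ) (by simp [norm_smul, hn])
      rw [hhom, inv_pow, inv_mul_eq_div, le_div_iff₀ (by positivity)] at h3
      exact h3
  calc κ / (m + 1) * ∑ j, τ j ^ 2 ≤ κ / (m + 1) * ((m + 1) * ‖τ‖ ^ 2) :=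
        mul_le_mul_of_nonneg_left h1 (by positivity)
    _ = κ * ‖τ‖ ^ 2 := by field_simp
    _ ≤ _ := h2

/-- Coercivity of the second order expansion in terms of the moments of the perturbations. -/
theorem exists_coercive_moments {m : ℕ} {c : Fin m → ℝ} {h : Fin m → Fin m → ℝ} {κ : ℝ}
    (hκ : 0 < κ) (hquad : ∀ τ : Fin m → ℝ,
      κ * ∑ j, τ j ^ 2 ≤ ∑ j, c j * τ j ^ 2 + ∑ j, ∑ k, h j k * τ j * τ k)
    {J : Set (Fin m)} (hJ : ∀ j ∈ J, 0 < c j) :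
    ∃ ε > 0, ∀ τ n X : Fin m → ℝ, (∀ j, |τ j| ≤ n j) → (∀ j, (τ j ^ 2 + n j ^ 2) / 4 ≤ X j) →
      (∀ j, j ∉ J → n j = |τ j| ∧ X j = τ j ^ 2 / 2) →
      ε * (∑ j, n j) ^ 2 ≤ ∑ j, c j * X j + 1 / 2 * ∑ j, ∑ k, h j k * τ j * τ k -
        ε * (∑ j, X j + (∑ j, n j) ^ 2) := by
  have hd : ∀ᶠ d in 𝓝[>] (0 : ℝ), ∀ j ∈ J, d ≤ c j := by
    refine (eventually_all_finite J.toFinite).2 fun j hj => ?_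
    filter_upwards [Ioo_mem_nhdsGT (hJ j hj)] with d hd
    exact hd.2.le
  obtain ⟨d, hd, hd0⟩ := (hd.and eventually_mem_nhdsWithin).exists
  rw [mem_Ioi] at hd0
  -- The slopes on `J` absorb `e * (n j ^ 2 - τ j ^ 2)` and the quadratic form pays back `e * τ j ^
  -- 2`, leaving `e * n j ^ 2`. Cauchy–Schwarz turns the sum of these into `2 * ε` times the squared
  -- total mass: once for the growth and once for the expansion error.
  set e := min (d / 8) (κ / 4)
  have he0 : 0 < e := by positivity
  have he1 : e ≤ d / 8 := min_le_left _ _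
  have he2 : e ≤ κ / 4 := min_le_right _ _
  set ε := e / (2 * (m + 1))
  have hε0 : 0 < ε := by positivity
  have hε1 : ε * (2 * (m + 1)) = e := div_mul_cancel₀ _ (by positivity)
  have hε2 : ε ≤ e := by
    have : (0 : ℝ) ≤ m := Nat.cast_nonneg m
    nlinarith
  refine ⟨ε, hε0, fun τ n X hτn hX hJc => ?_⟩
  have hn2 : ∀ j, τ j ^ 2 ≤ n j ^ 2 := fun j => sq_le_sq.2 ((hτn j).trans (le_abs_self _))
  have hterm : ∀ j, c j * τ j ^ 2 / 2 - ε / 2 * τ j ^ 2 + e * (n j ^ 2 - τ j ^ 2) ≤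
      c j * X j - ε * X j := fun j => by
    by_cases hj : j ∈ J
    · have h1 : (c j - ε) * ((τ j ^ 2 + n j ^ 2) / 4) ≤ (c j - ε) * X j :=
        mul_le_mul_of_nonneg_left (hX j) (by linarith [hd j hj])
      have h2 : e * (n j ^ 2 - τ j ^ 2) ≤ (c j - ε) / 4 * (n j ^ 2 - τ j ^ 2) :=
        mul_le_mul_of_nonneg_right (by linarith [hd j hj]) (sub_nonneg.2 (hn2 j))
      linarith
    · obtain ⟨h1, h2⟩ := hJc j hj
      rw [h1, h2, sq_abs]
      linarith
  have hsum := Finset.sum_le_sum fun j (_ : j ∈ Finset.univ) => hterm j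
  rw [Finset.sum_add_distrib, Finset.sum_sub_distrib, Finset.sum_sub_distrib, ← Finset.mul_sum,
    ← Finset.mul_sum, ← Finset.mul_sum, Finset.sum_sub_distrib, ← Finset.sum_div] at hsum
  have hcs : (∑ j, n j) ^ 2 ≤ m * ∑ j, n j ^ 2 := by
    simpa using sq_sum_le_card_mul_sum_sq (s := Finset.univ) (f := n)
  have hτ0 : 0 ≤ ∑ j, τ j ^ 2 := Finset.sum_nonneg fun j _ => sq_nonneg _
  have hn0 : 0 ≤ ∑ j, n j ^ 2 := Finset.sum_nonneg fun j _ => sq_nonneg _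
  have h3 : (ε / 2 + e) * ∑ j, τ j ^ 2 ≤ κ / 2 * ∑ j, τ j ^ 2 :=
    mul_le_mul_of_nonneg_right (by linarith) hτ0
  have h4 : 2 * ε * (∑ j, n j) ^ 2 ≤ e * ∑ j, n j ^ 2 := by
    rw [← hε1]
    have := mul_le_mul_of_nonneg_left hcs (show 0 ≤ 2 * ε by positivity)
    have h5 : 0 ≤ ε * ∑ j, n j ^ 2 := by positivity
    linarith
  linarith [hquad τ]

/-- Either the variation rises by `γ`, and continuity of `F` suffices, or `w` is a perturbation near
the switching times, and the coercive expansion applies. -/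
theorem IsMinimalRepresentation.hasQuadraticGrowth {M m : ℕ} {T : ℝ} (hT : 0 < T)
    {V : Finset (Fin M → ℤ)} {F : ControlSpace M T → ℝ} {β : ℝ} (hβ : 0 < β) {p : ℝ≥0∞}
    (hp1 : 1 < p) (hp2 : p < ∞) (hF : Differentiable ℝ F) (hF' : Differentiable ℝ (fderiv ℝ F))
    {u : ControlSpace M T} {g : ℝ → Fin M → ℝ} (hg : IsGradient F u g)
    (hg_smooth : ContDiffOn ℝ 1 g (Icc 0 T)) {H : ℝ → ℝ → Matrix (Fin M) (Fin M) ℝ}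
    (hH : IsHessian F u H)
    (hH_cont : ContinuousOn (fun x : ℝ × ℝ => H x.1 x.2) (Icc 0 T ×ˢ Icc 0 T))
    {a : Fin (m + 1) → Fin M → ℤ} {t : Fin m → ℝ} (hrep : IsMinimalRepresentation V u a t)
    (hstat : ∀ j, jump a j ⬝ᵥ g (t j) = 0)
    (hslope : ∀ j ∈ intermediate V a, 0 < jump a j ⬝ᵥ derivWithin g (Icc 0 T) (t j))
    (hquad : ∀ τ : Fin m → ℝ, τ ≠ 0 → 0 < quadForm T g H a t τ) :
    HasQuadraticGrowth V F β p u := by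
  obtain ⟨κ, hκ, hκ'⟩ := quadForm_coercive hquad
  obtain ⟨e, he, hcoer⟩ := exists_coercive_moments hκ hκ' hslope
  obtain ⟨γ, hγ, hgap⟩ := hrep.exists_gap hT hp1 hp2
  obtain ⟨ρ, ⟨ε₁, hε₁, hdich⟩, hexp, hρ⟩ := (hgap.and ((expansion hF hF' hg hg_smooth hH hH_cont
    (mem_Ioo_of_strictMono_grid hrep.strictMono) hstat he).and eventually_mem_nhdsWithin)).exists
  rw [mem_Ioi] at hρ
  set C := ∑ j, pNorm 1 (jump a j)
  obtain ⟨r, hr, hFr⟩ := Metric.continuousAt_iff.1 (hF u).continuousAt (β * γ / 2) (by positivity)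
  -- The first bound converts mass into L¹ distance. The second lets `β * γ` pay for both the drop
  -- of `F`, below `β * γ / 2`, and the growth term, as the distance is at most one.
  set η := min (2 * e / (C ^ 2 + 1)) (β * γ)
  have hη0 : 0 < η := by positivity
  have hη1 : η * (C ^ 2 + 1) ≤ 2 * e := (le_div_iff₀ (by positivity)).1 (min_le_left _ _)
  have hη2 : η ≤ β * γ := min_le_right _ _
  refine ⟨min ε₁ (min (r / 2) 1), by positivity, η, hη0, fun w hw hwu => ?_⟩
  -- Admissibility only bounds the variation for the exponent 2; the representation of `w` makes it
  -- finite for `p`.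
  obtain ⟨m', a', t', hrep'⟩ := exists_isMinimalRepresentation hT hw
  have hTVu : TV p u ≠ ∞ := by
    rw [hrep.TV_eq hT hp1.le]
    exact ENNReal.ofReal_ne_top
  have hTVw : TV p w ≠ ∞ := by
    rw [hrep'.TV_eq hT hp1.le]
    exact ENNReal.ofReal_ne_top
  rw [objective_eq_coe F β hTVu, objective_eq_coe F β hTVw, ← EReal.coe_add,
    EReal.coe_le_coe_iff]
  rcases hdich w hw (hwu.trans (min_le_left _ _)) with hbig | ⟨hle, θ, hθ⟩
  · have h1 : (TV p u).toReal + γ ≤ (TV p w).toReal := by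
      have := ENNReal.toReal_mono hTVw hbig
      rwa [ENNReal.toReal_add hTVu ENNReal.ofReal_ne_top, ENNReal.toReal_ofReal hγ.le] at this
    have h2 : dist (F w) (F u) < β * γ / 2 := hFr (by
      rw [dist_eq_norm]
      linarith [hwu.trans ((min_le_right _ _).trans (min_le_left _ _))])
    have h3 : ‖w - u‖ ^ 2 ≤ 1 :=
      pow_le_one₀ (norm_nonneg _) (hwu.trans ((min_le_right _ _).trans (min_le_right _ _)))
    have h4 := mul_le_mul_of_nonneg_left h1 hβ.le
    have h5 := mul_le_mul_of_nonneg_left h3 (half_pos hη0).le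
    have h6 := (abs_lt.1 (Real.dist_eq _ _ ▸ h2)).1
    linarith
  · have h1 := mul_le_mul_of_nonneg_left (ENNReal.toReal_mono hTVw hle) hβ.le
    have h2 := (abs_le.1 (hexp θ hθ.profile)).1
    have h3 := hcoer (fun j => ∫ s, θ j s) (fun j => ∫ s, |θ j s|)
      (fun j => ∫ s, θ j s * (s - t j)) (fun j => abs_integral_le_integral_abs)
      (fun j => (hθ.profile j).moment_ge) fun j hj => hθ.abs_integral_eq hj
    have h4 := (norm_sum_scaledControl_le (T := T) hρ.le hθ.profile (jump a)).1
    have h5 : w - u = ∑ j, scaledControl T (hθ.profile j).integrable (jump a j) :=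
      sub_eq_iff_eq_add'.2 hθ.eq
    rw [← hθ.eq] at h2
    rw [← h5] at h4
    have h6 : ‖w - u‖ ^ 2 ≤ C ^ 2 * (∑ j, ∫ s, |θ j s|) ^ 2 := by
      rw [← mul_pow]
      exact pow_le_pow_left₀ (norm_nonneg _) h4 2
    have h7 := mul_le_mul_of_nonneg_left h6 (half_pos hη0).le
    have h8 := mul_le_mul_of_nonneg_right hη1 (sq_nonneg (∑ j, ∫ s, |θ j s|))
    have h9 : 0 ≤ η * (∑ j, ∫ s, |θ j s|) ^ 2 := by positivity
    linarith

theorem HasQuadraticGrowth.isLocalMinimizer {M : ℕ} {T : ℝ} {V : Finset (Fin M → ℤ)}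
    {F : ControlSpace M T → ℝ} {β : ℝ} {p : ℝ≥0∞} {u : ControlSpace M T}
    (hu : u ∈ admissible T V) (h : HasQuadraticGrowth V F β p u) :
    IsLocalMinimizer V F β p u := by
  obtain ⟨ε, hε, η, hη, hgrow⟩ := h
  refine ⟨hu, ?_⟩
  filter_upwards [self_mem_nhdsWithin, mem_nhdsWithin_of_mem_nhds (Metric.closedBall_mem_nhds u hε)]
    with w hw hwu
  rw [mem_closedBall_iff_norm] at hwu
  refine le_trans ?_ (hgrow w hw hwu)
  exact le_add_of_nonneg_right (EReal.coe_nonneg.2 (by positivity))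

/-! ### The optimality conditions -/

theorem mainTheorem2 {M : ℕ} {T : ℝ} (hT : 0 < T)
    (V : Finset (Fin M → ℤ)) (hV : 2 ≤ V.card)
    (F : SwitchingControl.ControlSpace M T → ℝ) {β : ℝ} (hβ : 0 < β)
    {p : ℝ≥0∞} (hp : 1 ≤ p)
    (hF : Differentiable ℝ F) (hF' : Differentiable ℝ (fderiv ℝ F))
    (u : SwitchingControl.ControlSpace M T) (hu : u ∈ SwitchingControl.admissible T V)
    (g : ℝ → Fin M → ℝ) (hg : SwitchingControl.IsGradient F u g)
    (hg_smooth : ContDiffOn ℝ 1 g (Icc 0 T))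
    (H : ℝ → ℝ → Matrix (Fin M) (Fin M) ℝ) (hH : SwitchingControl.IsHessian F u H)
    (hH_cont : ContinuousOn (fun x : ℝ × ℝ => H x.1 x.2) (Icc 0 T ×ˢ Icc 0 T)) :
    (∃ (m : ℕ) (a : Fin (m + 1) → Fin M → ℤ) (t : Fin m → ℝ),
      SwitchingControl.IsMinimalRepresentation V u a t) ∧
    ∀ (m : ℕ) (a : Fin (m + 1) → Fin M → ℤ) (t : Fin m → ℝ),
      SwitchingControl.IsMinimalRepresentation V u a t →
      (SwitchingControl.IsLocalMinimizer V F β p u →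
        (∀ j, SwitchingControl.jump a j ⬝ᵥ g (t j) = 0) ∧
        (∀ j ∈ SwitchingControl.intermediate V a,
          0 ≤ SwitchingControl.jump a j ⬝ᵥ derivWithin g (Icc 0 T) (t j)) ∧
        (∀ τ : Fin m → ℝ, 0 ≤ SwitchingControl.quadForm T g H a t τ)) ∧
      (1 < p → p < ∞ →
        (SwitchingControl.IsLocalMinimizer V F β p u ∧
            SwitchingControl.HasQuadraticGrowth V F β p u ↔
          (∀ j, SwitchingControl.jump a j ⬝ᵥ g (t j) = 0) ∧
          (∀ j ∈ SwitchingControl.intermediate V a,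
            0 < SwitchingControl.jump a j ⬝ᵥ derivWithin g (Icc 0 T) (t j)) ∧
          (∀ τ : Fin m → ℝ, τ ≠ 0 → 0 < SwitchingControl.quadForm T g H a t τ))) := by
  refine ⟨SwitchingControl.exists_isMinimalRepresentation hT hu, fun m a t hrep => ?_⟩
  have hTVu : SwitchingControl.TV p u ≠ ∞ := by
    rw [hrep.TV_eq hT hp]
    exact ENNReal.ofReal_ne_top
  refine ⟨fun hmin => ?_, fun hp1 hp2 => ⟨fun ⟨_, ε, hε, η, hη, h⟩ => ?_,
    fun ⟨hstat, hslope, hquad⟩ => ?_⟩⟩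
  -- Local minimality is growth with constant zero, which leaves weak inequalities; a positive
  -- constant below makes them strict.
  · have hgrow := hmin.growthAt hβ hTVu
    have hstat := hgrow.stationary hT hp hF hg hg_smooth.continuousOn hrep le_rfl
    refine ⟨hstat, fun j hj => ?_, fun τ => ?_⟩
    · obtain ⟨k, -, h⟩ := hgrow.slope_ge hT hp hF hF' hg hg_smooth hH hH_cont hrep le_rfl hj
      rwa [zero_mul] at h
    · have h := hgrow.quadForm_ge hT hp hF hF' hg hg_smooth hH hH_cont hrep le_rfl τ
      rwa [zero_mul] at h
  · have hgrow := SwitchingControl.growthAt_of_objective hβ hTVu hε h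
    have hstat := hgrow.stationary hT hp hF hg hg_smooth.continuousOn hrep hη.le
    refine ⟨hstat, fun j hj => ?_, fun τ hτ => ?_⟩
    · obtain ⟨k, hk, h⟩ := hgrow.slope_ge hT hp hF hF' hg hg_smooth hH hH_cont hrep hη.le hj
      exact (mul_pos hη hk).trans_le h
    · exact (mul_pos hη (pow_pos (norm_pos_iff.2 hτ) 2)).trans_le
        (hgrow.quadForm_ge hT hp hF hF' hg hg_smooth hH hH_cont hrep hη.le τ)
  · have hgrow : SwitchingControl.HasQuadraticGrowth V F β p u := hrep.hasQuadraticGrowth hT hβ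
      hp1 hp2 hF hF' hg hg_smooth hH hH_cont hstat hslope hquad
    exact ⟨hgrow.isLocalMinimizer hu, hgrow⟩

end SwitchingControl

theorem mainTheorem2 {M : ℕ} {T : ℝ} (hT : 0 < T)
    (V : Finset (Fin M → ℤ)) (hV : 2 ≤ V.card)
    (F : SwitchingControl.ControlSpace M T → ℝ) {β : ℝ} (hβ : 0 < β)
    {p : ℝ≥0∞} (hp : 1 ≤ p)
    (hF : Differentiable ℝ F) (hF' : Differentiable ℝ (fderiv ℝ F))
    (u : SwitchingControl.ControlSpace M T) (hu : u ∈ SwitchingControl.admissible T V)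
    (g : ℝ → Fin M → ℝ) (hg : SwitchingControl.IsGradient F u g)
    (hg_smooth : ContDiffOn ℝ 1 g (Icc 0 T))
    (H : ℝ → ℝ → Matrix (Fin M) (Fin M) ℝ) (hH : SwitchingControl.IsHessian F u H)
    (hH_cont : ContinuousOn (fun x : ℝ × ℝ => H x.1 x.2) (Icc 0 T ×ˢ Icc 0 T)) :
    (∃ (m : ℕ) (a : Fin (m + 1) → Fin M → ℤ) (t : Fin m → ℝ),
      SwitchingControl.IsMinimalRepresentation V u a t) ∧
    ∀ (m : ℕ) (a : Fin (m + 1) → Fin M → ℤ) (t : Fin m → ℝ),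
      SwitchingControl.IsMinimalRepresentation V u a t →
      (SwitchingControl.IsLocalMinimizer V F β p u →
        (∀ j, SwitchingControl.jump a j ⬝ᵥ g (t j) = 0) ∧
        (∀ j ∈ SwitchingControl.intermediate V a,
          0 ≤ SwitchingControl.jump a j ⬝ᵥ derivWithin g (Icc 0 T) (t j)) ∧
        (∀ τ : Fin m → ℝ, 0 ≤ SwitchingControl.quadForm T g H a t τ)) ∧
      (1 < p → p < ∞ →
        (SwitchingControl.IsLocalMinimizer V F β p u ∧
            SwitchingControl.HasQuadraticGrowth V F β p u ↔
          (∀ j, SwitchingControl.jump a j ⬝ᵥ g (t j) = 0) ∧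
          (∀ j ∈ SwitchingControl.intermediate V a,
            0 < SwitchingControl.jump a j ⬝ᵥ derivWithin g (Icc 0 T) (t j)) ∧
          (∀ τ : Fin m → ℝ, τ ≠ 0 → 0 < SwitchingControl.quadForm T g H a t τ))) := by
  refine ⟨SwitchingControl.exists_isMinimalRepresentation hT hu, fun m a t hrep => ?_⟩
  have hTVu : SwitchingControl.TV p u ≠ ∞ := by
    rw [hrep.TV_eq hT hp]
    exact ENNReal.ofReal_ne_top
  refine ⟨fun hmin => ?_, fun hp1 hp2 => ⟨fun ⟨_, ε, hε, η, hη, h⟩ => ?_,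
    fun ⟨hstat, hslope, hquad⟩ => ?_⟩⟩
  · have hgrow := hmin.growthAt hβ hTVu
    have hstat := hgrow.stationary hT hp hF hg hg_smooth.continuousOn hrep le_rfl
    refine ⟨hstat, fun j hj => ?_, fun τ => ?_⟩
    · obtain ⟨k, -, h⟩ := hgrow.slope_ge hT hp hF hF' hg hg_smooth hH hH_cont hrep le_rfl hj
      rwa [zero_mul] at h
    · have h := hgrow.quadForm_ge hT hp hF hF' hg hg_smooth hH hH_cont hrep le_rfl τ
      rwa [zero_mul] at h
  · have hgrow := SwitchingControl.growthAt_of_objective hβ hTVu hε h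
    have hstat := hgrow.stationary hT hp hF hg hg_smooth.continuousOn hrep hη.le
    refine ⟨hstat, fun j hj => ?_, fun τ hτ => ?_⟩
    · obtain ⟨k, hk, h⟩ := hgrow.slope_ge hT hp hF hF' hg hg_smooth hH hH_cont hrep hη.le hj
      exact (mul_pos hη hk).trans_le h
    · exact (mul_pos hη (pow_pos (norm_pos_iff.2 hτ) 2)).trans_le
        (hgrow.quadForm_ge hT hp hF hF' hg hg_smooth hH hH_cont hrep hη.le τ)
  · have hgrow : SwitchingControl.HasQuadraticGrowth V F β p u := hrep.hasQuadraticGrowth hT hβ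
      hp1 hp2 hF hF' hg hg_smooth hH hH_cont hstat hslope hquad
    exact ⟨hgrow.isLocalMinimizer hu, hgrow⟩
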